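/- **Model.** Ground base stations (BSs) form a homogeneous Poisson point process $\Phi$ of intensity $\lambda>0$ in $\mathbb R^2$; those in the closed disc $\mathcal D$ of radius $R_c>0$ around the origin are out of service. A UAV hovers at altitude $H>0$ above the origin, and a user (UE) is at $x_0=(r_0,0)$ with $0\le r_0\le R_c$. Let $r_1<r_2<\cdots$ be the distances from the UE to the points of $\Phi\setminus\mathcal D$. The link to the UAV has a random state $s\in\{L,N\}$ (line of sight or not), with probabilities $P_L(r_0)=\frac1{1+Ce^{-B(\phi-C)}}$ and $P_N=1-P_L$, where $C>0$, $B\in\mathbb R$, and $\phi=\arctan(H/r_0)$ is the elevation angle ($\phi=\pi/2$ if $r_0=0$). The channel gains are $h_0=g_{0s}\,d^{-\alpha_s}$ with $d=\sqrt{H^2+r_0^2}$, and $h_i=g_i r_i^{-\alpha_N}$, where the fading powers satisfy $g_{0s}\sim\mathrm{Gamma}(m_s,m_s)$ (shape, rate) and $g_i\sim\mathrm{Exp}(1)$; the $g_i$ are i.i.d., and the BSs, $(g_i)_i$, $(g_{0L},g_{0N})$ and $s$ are independent. Here $m_L\ge1$ is an integer, $m_N=1$, $\alpha_L>0$, $\alpha_N>2$.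 Let $0\le\delta\le1$ and let $\epsilon>0$ be the SIR threshold. The UE is in $\mathcal A_1$ if $r_1^{\alpha_N}\le\delta d^{\alpha_s}$, in $\mathcal A_2$ if $\delta d^{\alpha_s}<r_1^{\alpha_N}\le\frac1\delta d^{\alpha_s}$, and in $\mathcal A_3$ if $r_1^{\alpha_N}>\frac1\delta d^{\alpha_s}$ (with $\frac10=\infty$). Put $I_2=\sum_{i\ge2}h_i$ and $$\mathrm{SIR}_1=\frac{h_1}{h_0+I_2},\qquad \mathrm{SIR}_2=\frac{h_0+h_1}{I_2},\qquad \mathrm{SIR}_3=\frac{h_0}{h_1+I_2}.$$ The UE is covered if it is in $\mathcal A_i$ and $\mathrm{SIR}_i>\epsilon$, for some $i$. **Formulas.** Put $\theta_1(r)=\arccos\frac{R_c^2+r_0^2-r^2}{2R_cr_0}$, $\theta_2(r)=\arccos\frac{r_0^2+r^2-R_c^2}{2r_0r}$, $$\zeta_2(r)=\pi r^2-\theta_1(r)R_c^2+R_c^2\sin\theta_1(r)\cos\theta_1(r)-\theta_2(r)r^2+r^2\sin\theta_2(r)\cos\theta_2(r),\qquad \zeta_1(r)=2\pi r-2r\,\theta_2(r),$$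 $$f(r)=\begin{cases}0,&r\le R_c-r_0\\ \lambda\zeta_1(r)e^{-\lambda\zeta_2(r)},&R_c-r_0<r<R_c+r_0\\ 2\pi\lambda re^{-\lambda(\pi r^2-\pi R_c^2)},&\text{otherwise.}\end{cases}$$ Put $\bar B(x;a,b)=\int_x^1t^{a-1}(1-t)^{b-1}dt$, $b_\rho(u)=\bar B\big(\tfrac1{1+u\rho^{-\alpha_N}};\tfrac2{\alpha_N},1-\tfrac2{\alpha_N}\big)$, $z(\theta)=\sqrt{R_c^2-r_0^2\sin^2\theta}-r_0\cos\theta$, $\Theta=\theta_2(r_1)$, and $\mathcal L(u)=\mathcal L_{r_0,r_1}(u)=e^{\eta(u)}$ (the Laplace transform of $I_2$ for fixed $r_0,r_1$), where $$\eta(u)=-\frac{2\lambda(\pi-\Theta)u^{2/\alpha_N}}{\alpha_N}b_{r_1}(u)-\frac{2\lambda u^{2/\alpha_N}}{\alpha_N}\int_{\pi-\Theta}^{\pi}b_{z(\theta)}(u)\,d\theta\quad\text{if } R_c-r_0<r_1<R_c+r_0,$$ $$\eta(u)=-\frac{2\lambda\pi u^{2/\alpha_N}}{\alpha_N}b_{r_1}(u)\quad\text{if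 } r_1\ge R_c+r_0.$$ For $s\in\{L,N\}$ put $a_0=m_s$, $\beta_0=m_sd^{\alpha_s}$, $a_1=1$, $\beta_1=r_1^{\alpha_N}$, $u_j=\beta_j\epsilon$, $$A_{jk}=(-1)^{a_j-k}\frac{\beta_0^{a_0}\beta_1^{a_1}(a_{1-j}+a_j-k-1)!}{(a_j-k)!\,(a_{1-j}-1)!}(\beta_{1-j}-\beta_j)^{-a_{1-j}-a_j+k},$$ $$P^1_s(r_0,r_1)=\frac{\mathcal L(r_1^{\alpha_N}\epsilon)}{\big(1+\frac{r_1^{\alpha_N}\epsilon}{d^{\alpha_s}m_s}\big)^{m_s}},\qquad P^2_s(r_0,r_1)=\sum_{j=0}^1\sum_{k=1}^{a_j}\frac{A_{jk}}{\beta_j^k}\sum_{l=0}^{k-1}\frac{(-u_j)^l}{l!}\mathcal L^{(l)}(u_j),$$ $$P^3_s(r_0,r_1)=\sum_{l=0}^{m_s-1}\frac{(-u_0)^l}{l!}\sum_{q=0}^{l}\binom lq\mathcal L^{(q)}(u_0)\,\frac{r_1^{\alpha_N}(l-q)!\,(-1)^{l-q}}{(u_0+r_1^{\alpha_N})^{l-q+1}}.$$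 **Theorem.** Let $A_s(r_0)=(\delta d^{\alpha_s})^{1/\alpha_N}$ and $B_s(r_0)=(\frac1\delta d^{\alpha_s})^{1/\alpha_N}$ (with $B_s=\infty$ if $\delta=0$). For $s\in\{L,N\}$ the integrals $$Pc_{1,s}=\int_0^{A_s}P^1_s(r_0,r_1)f(r_1)\,dr_1,\quad Pc_{2,s}=\int_{A_s}^{B_s}P^2_s(r_0,r_1)f(r_1)\,dr_1,\quad Pc_{3,s}=\int_{B_s}^{\infty}P^3_s(r_0,r_1)f(r_1)\,dr_1$$ exist, and, given the state $s$ of the air-to-ground link, $Pc_{i,s}$ is the probability that the UE is in $\mathcal A_i$ and is covered ($i=1,2,3$), and $Pc_{1,s}+Pc_{2,s}+Pc_{3,s}$ is the coverage probability. Consequently, averaged over the state, the probability that the UE is in $\mathcal A_i$ and is covered is $Pc_i(r_0)=P_L(r_0)Pc_{i,L}+P_N(r_0)Pc_{i,N}$, and the coverage probability is $P(r_0)=Pc_1(r_0)+Pc_2(r_0)+Pc_3(r_0)$. -/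

import Mathlib

open MeasureTheory ProbabilityTheory

/-- The state of the link between the UAV and the UE: line of sight or not. -/
inductive LinkState
  | los
  | nlos

instance : MeasurableSpace LinkState := ⊤

/-- The three types of UE: `bs` is `𝒜₁` (nearest ground BS only), `coop` is `𝒜₂` (UAV and nearest
ground BS), `uav` is `𝒜₃` (UAV only). -/
inductive Region
  | bs
  | coop
  | uav

/-- The numerical parameters of the network. -/
structure NetParams where
  /-- intensity of the ground BSs -/
  lam : ℝ
  /-- radius of the malfunction disc -/
  Rc : ℝ
  /-- altitude of the UAV -/
  H : ℝ
  /-- path loss exponent of a LoS link -/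
  alphaL : ℝ
  /-- path loss exponent of an NLoS link -/
  alphaN : ℝ
  /-- Nakagami parameter of a LoS link -/
  mL : ℕ
  /-- first environment constant of the LoS probability -/
  B : ℝ
  /-- second environment constant of the LoS probability -/
  C : ℝ
  /-- cooperation indication parameter -/
  delta : ℝ
  /-- SIR threshold -/
  eps : ℝ

namespace NetParams

/-- The path loss exponent `α_s` of the air-to-ground link. -/
def alpha (p : NetParams) : LinkState → ℝ
  | .los => p.alphaL
  | .nlos => p.alphaN

/-- The Nakagami parameter `m_s` of the air-to-ground link; `m_N = 1` (Rayleigh fading). -/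
def m (p : NetParams) : LinkState → ℕ
  | .los => p.mL
  | .nlos => 1

/-- The malfunction disc. -/
def disc (p : NetParams) : Set (EuclideanSpace ℝ (Fin 2)) := Metric.closedBall 0 p.Rc

/-- The elevation angle `arctan (H / r₀)` from the UE to the UAV, written as an arcsine so that it
is `π / 2` at `r₀ = 0`. -/
noncomputable def elevation (p : NetParams) (r₀ : ℝ) : ℝ :=
  Real.arcsin (p.H / Real.sqrt (p.H ^ 2 + r₀ ^ 2))

/-- The probabilities `P_L(r₀)` and `P_N(r₀)` of a LoS and of an NLoS link. -/
noncomputable def linkProb (p : NetParams) (r₀ : ℝ) : LinkState → ℝ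
  | .los => 1 / (1 + p.C * Real.exp (-p.B * (p.elevation r₀ - p.C)))
  | .nlos => 1 - 1 / (1 + p.C * Real.exp (-p.B * (p.elevation r₀ - p.C)))

/-- The path loss `(√(H² + r₀²)) ^ α_s` of the air-to-ground link. -/
noncomputable def airLoss (p : NetParams) (r₀ : ℝ) (s : LinkState) : ℝ :=
  Real.sqrt (p.H ^ 2 + r₀ ^ 2) ^ p.alpha s

/-! ### The transmission scheme -/

/-- The upper limit `(1 / δ) (√(H² + r₀²)) ^ α_s` of the cooperation region, in `[0, ∞]`: it is `∞`
for `δ = 0`. -/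
noncomputable def upperLevel (p : NetParams) (r₀ : ℝ) (s : LinkState) : ENNReal :=
  (ENNReal.ofReal p.delta)⁻¹ * ENNReal.ofReal (p.airLoss r₀ s)

open Classical in
/-- The type of a UE at horizontal distance `r₀` from the UAV, at distance `r₁` from the nearest
ground BS, and with link state `s`. -/
noncomputable def regionOf (p : NetParams) (r₀ : ℝ) (s : LinkState) (r₁ : ℝ) : Region :=
  if r₁ ^ p.alphaN ≤ p.delta * p.airLoss r₀ s then .bs
  else if ENNReal.ofReal (r₁ ^ p.alphaN) ≤ p.upperLevel r₀ s then .coop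
  else .uav

/-- The threshold `A_s(r₀)`. -/
noncomputable def thresholdA (p : NetParams) (r₀ : ℝ) (s : LinkState) : ℝ :=
  (p.delta * p.airLoss r₀ s) ^ (1 / p.alphaN)

/-- The threshold `B_s(r₀)`, in `[0, ∞]`. -/
noncomputable def thresholdB (p : NetParams) (r₀ : ℝ) (s : LinkState) : ENNReal :=
  p.upperLevel r₀ s ^ (1 / p.alphaN)

/-- The range of `r₁` over which the coverage of each type of UE is integrated: `(0, A]`, `(A, B]`
and `(B, ∞)`. -/
noncomputable def range (p : NetParams) (r₀ : ℝ) (s : LinkState) : Region → Set ℝ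
  | .bs => {r | 0 < r ∧ r ≤ p.thresholdA r₀ s}
  | .coop => {r | p.thresholdA r₀ s < r ∧ ENNReal.ofReal r ≤ p.thresholdB r₀ s}
  | .uav => {r | p.thresholdB r₀ s < ENNReal.ofReal r}

/-! ### The density of the distance to the nearest ground BS -/

/-- The function `ζ₁`; the inverse secant of `x` is `arccos x⁻¹` (and `π / 2` where `x` is
infinite, that is at a zero of its denominator). -/
noncomputable def zeta1 (p : NetParams) (r₀ r : ℝ) : ℝ :=
  2 * Real.pi * r
    + r / r₀ * Real.sqrt (-((r - r₀ - p.Rc) * (r + r₀ - p.Rc) * (r - r₀ + p.Rc) * (r + r₀ + p.Rc))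
        / r₀ ^ 2)
    - r / r₀ * Real.sqrt (-((-r + r₀ - p.Rc) * (r + r₀ - p.Rc) * (-r + r₀ + p.Rc)
        * (r + r₀ + p.Rc)) / r₀ ^ 2)
    - 2 * r * Real.arccos (2 * r * r₀ / (r ^ 2 + r₀ ^ 2 - p.Rc ^ 2))⁻¹

/-- The angle `θ₁`. -/
noncomputable def theta1 (p : NetParams) (r₀ r : ℝ) : ℝ :=
  Real.arccos ((p.Rc ^ 2 + r₀ ^ 2 - r ^ 2) / (2 * p.Rc * r₀))

/-- The angle `θ₂`; it is also the angle `Θ` when `r = r₁`. -/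
noncomputable def theta2 (p : NetParams) (r₀ r : ℝ) : ℝ :=
  Real.arccos ((r₀ ^ 2 + r ^ 2 - p.Rc ^ 2) / (2 * r₀ * r))

/-- The function `ζ₂`. -/
noncomputable def zeta2 (p : NetParams) (r₀ r : ℝ) : ℝ :=
  Real.pi * r ^ 2 - p.theta1 r₀ r * p.Rc ^ 2
    + p.Rc ^ 2 * Real.sin (p.theta1 r₀ r) * Real.cos (p.theta1 r₀ r)
    - p.theta2 r₀ r * r ^ 2
    + r ^ 2 * Real.sin (p.theta2 r₀ r) * Real.cos (p.theta2 r₀ r)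

/-- The conditional pdf `f_{r₁|r₀}`. -/
noncomputable def pdf (p : NetParams) (r₀ r : ℝ) : ℝ :=
  if r ≤ p.Rc - r₀ then 0
  else if r < p.Rc + r₀ then p.lam * p.zeta1 r₀ r * Real.exp (-p.lam * p.zeta2 r₀ r)
  else 2 * Real.pi * p.lam * r * Real.exp (-p.lam * (Real.pi * r ^ 2 - Real.pi * p.Rc ^ 2))

/-! ### The Laplace transform of the interference beyond the nearest ground BS -/

/-- The upper incomplete beta function `∫ₓ¹ t^(a-1) (1-t)^(b-1) dt`. -/
noncomputable def upperBeta (x a b : ℝ) : ℝ :=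
  ∫ t in x..1, t ^ (a - 1) * (1 - t) ^ (b - 1)

/-- The distance `z(θ)` from the UE to the boundary of the disc in direction `θ`. -/
noncomputable def boundaryDist (p : NetParams) (r₀ θ : ℝ) : ℝ :=
  Real.sqrt (p.Rc ^ 2 - r₀ ^ 2 * Real.sin θ ^ 2) - r₀ * Real.cos θ

/-- The exponent `η(s)` for the two cases `R_c - r₀ < r₁ < R_c + r₀` and `r₁ ≥ R_c + r₀`. The
integral over `θ` is the exact value of which a Chebyshev-Gauss sum is a numerical
approximation. -/
noncomputable def eta (p : NetParams) (r₀ r₁ s : ℝ) : ℝ :=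
  if r₁ < p.Rc + r₀ then
    -(2 * p.lam * (Real.pi - p.theta2 r₀ r₁) * s ^ (2 / p.alphaN) / p.alphaN
        * upperBeta (1 / (1 + s * r₁ ^ (-p.alphaN))) (2 / p.alphaN) (1 - 2 / p.alphaN))
    - 2 * p.lam * s ^ (2 / p.alphaN) / p.alphaN
        * ∫ θ in (Real.pi - p.theta2 r₀ r₁)..Real.pi,
            upperBeta (1 / (1 + s * p.boundaryDist r₀ θ ^ (-p.alphaN)))
              (2 / p.alphaN) (1 - 2 / p.alphaN)
  else
    -(2 * p.lam * Real.pi * s ^ (2 / p.alphaN) / p.alphaN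
        * upperBeta (1 / (1 + s * r₁ ^ (-p.alphaN))) (2 / p.alphaN) (1 - 2 / p.alphaN))

/-- The conditional Laplace transform `ℒ_{I₂|r₀,r₁}(s) = exp (η(s))`. -/
noncomputable def lap (p : NetParams) (r₀ r₁ s : ℝ) : ℝ := Real.exp (p.eta r₀ r₁ s)

/-! ### The conditional coverage probabilities given `r₀`, `r₁` and the link state -/

/-- `P¹(r₀, r₁)`. -/
noncomputable def cov1 (p : NetParams) (r₀ : ℝ) (s : LinkState) (r₁ : ℝ) : ℝ :=
  p.lap r₀ r₁ (r₁ ^ p.alphaN * p.eps)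
    / (1 + r₁ ^ p.alphaN * p.eps / ((p.H ^ 2 + r₀ ^ 2) ^ (p.alpha s / 2) * p.m s)) ^ p.m s

/-- The shapes `α₀ = m_s`, `α₁ = 1`. -/
def shape (p : NetParams) (s : LinkState) : Fin 2 → ℕ := ![p.m s, 1]

/-- The rates `β₀ = m_s (H² + r₀²)^(α_s/2)`, `β₁ = r₁^α_N`. -/
noncomputable def rate (p : NetParams) (r₀ : ℝ) (s : LinkState) (r₁ : ℝ) : Fin 2 → ℝ :=
  ![p.m s * (p.H ^ 2 + r₀ ^ 2) ^ (p.alpha s / 2), r₁ ^ p.alphaN]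

/-- The coefficients `A_{jk}`, for `1 ≤ k ≤ α_j`. -/
noncomputable def fracCoeff (p : NetParams) (r₀ : ℝ) (s : LinkState) (r₁ : ℝ)
    (j : Fin 2) (k : ℕ) : ℝ :=
  (-1) ^ (p.shape s j - k)
    * (p.rate r₀ s r₁ 0 ^ p.shape s 0 * p.rate r₀ s r₁ 1 ^ p.shape s 1
        * (p.shape s (1 - j) + p.shape s j - k - 1).factorial
      / ((p.shape s j - k).factorial * (p.shape s (1 - j) - 1).factorial))
    * (p.rate r₀ s r₁ (1 - j) - p.rate r₀ s r₁ j)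
        ^ (-(p.shape s (1 - j) : ℤ) - (p.shape s j : ℤ) + (k : ℤ))

/-- `P²(r₀, r₁)`. -/
noncomputable def cov2 (p : NetParams) (r₀ : ℝ) (s : LinkState) (r₁ : ℝ) : ℝ :=
  ∑ j : Fin 2, ∑ k ∈ Finset.Icc 1 (p.shape s j),
    p.fracCoeff r₀ s r₁ j k / p.rate r₀ s r₁ j ^ k
      * ∑ l ∈ Finset.range k,
          (-(p.rate r₀ s r₁ j * p.eps)) ^ l / l.factorial
            * iteratedDeriv l (p.lap r₀ r₁) (p.rate r₀ s r₁ j * p.eps)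

/-- The `t`-th derivative of the Laplace transform of `h₁` at `u`. -/
noncomputable def lapNearestDeriv (p : NetParams) (r₁ : ℝ) (t : ℕ) (u : ℝ) : ℝ :=
  r₁ ^ p.alphaN * t.factorial * (-1) ^ t / (u + r₁ ^ p.alphaN) ^ (t + 1)

/-- The `l`-th derivative of the Laplace transform of `h₁ + I₂` at `u`. -/
noncomputable def lapTotalDeriv (p : NetParams) (r₀ r₁ : ℝ) (l : ℕ) (u : ℝ) : ℝ :=
  ∑ q ∈ Finset.range (l + 1),
    (l.choose q : ℝ) * iteratedDeriv q (p.lap r₀ r₁) u * p.lapNearestDeriv r₁ (l - q) u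

/-- `P³(r₀, r₁)`. -/
noncomputable def cov3 (p : NetParams) (r₀ : ℝ) (s : LinkState) (r₁ : ℝ) : ℝ :=
  ∑ l ∈ Finset.range (p.m s),
    (-(p.m s * (p.H ^ 2 + r₀ ^ 2) ^ (p.alpha s / 2) * p.eps)) ^ l / l.factorial
      * p.lapTotalDeriv r₀ r₁ l (p.m s * (p.H ^ 2 + r₀ ^ 2) ^ (p.alpha s / 2) * p.eps)

/-- The conditional coverage probability `Pⁱ(r₀, r₁)`. -/
noncomputable def cov (p : NetParams) (r₀ : ℝ) (s : LinkState) : Region → ℝ → ℝ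
  | .bs => p.cov1 r₀ s
  | .coop => p.cov2 r₀ s
  | .uav => p.cov3 r₀ s

/-- The integral `Pcᵢ(r₀)`, for the link state `s`. -/
noncomputable def Pc (p : NetParams) (r₀ : ℝ) (s : LinkState) (i : Region) : ℝ :=
  ∫ r in p.range r₀ s i, p.cov r₀ s i r * p.pdf r₀ r

end NetParams

/-! ### The random network -/

/-- `Φ` is a homogeneous Poisson point process of intensity `lam` in the plane: a locally finite
random set whose numbers of points in bounded Borel sets are Poisson, and independent for disjoint
sets. -/
structure IsHPPP {Ω : Type*} [MeasurableSpace Ω] (μ : Measure Ω) (lam : ℝ)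
    (Φ : Ω → Set (EuclideanSpace ℝ (Fin 2))) : Prop where
  locallyFinite : ∀ᵐ ω ∂μ, ∀ K : Set (EuclideanSpace ℝ (Fin 2)),
    Bornology.IsBounded K → (Φ ω ∩ K).Finite
  hasLaw_count : ∀ K : Set (EuclideanSpace ℝ (Fin 2)), MeasurableSet K → Bornology.IsBounded K →
    HasLaw (fun ω ↦ (Φ ω ∩ K).ncard) (poissonMeasure (lam * volume.real K).toNNReal) μ
  indep_count : ∀ (n : ℕ) (K : Fin n → Set (EuclideanSpace ℝ (Fin 2))),
    (∀ i, MeasurableSet (K i)) → (∀ i, Bornology.IsBounded (K i)) →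
    Pairwise (fun i j ↦ Disjoint (K i) (K j)) →
    iIndepFun (fun i ω ↦ (Φ ω ∩ K i).ncard) μ

/-- The location of the UE. -/
noncomputable def uePos (r₀ : ℝ) : EuclideanSpace ℝ (Fin 2) := !₂[r₀, 0]

/-- The random network seen by a UE at horizontal distance `r₀` from the UAV. Here `Φ` is the
process of all ground BSs, and `y 0, y 1, …` are the BSs outside the disc by increasing distance
from the UE (so that `y 0` is the nearest one); `g i` is the fading power of the channel from `y i`,
`g0 s` that of the air-to-ground channel if its state is `s` (Nakagami fading with parameter `m_s`
and unit mean power), and `S` is that state. The BSs, the ground fading, the air-to-ground fading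
and the link state are independent. -/
structure IsNetwork {Ω : Type*} [MeasurableSpace Ω] (μ : Measure Ω) (p : NetParams) (r₀ : ℝ)
    (Φ : Ω → Set (EuclideanSpace ℝ (Fin 2))) (y : ℕ → Ω → EuclideanSpace ℝ (Fin 2))
    (g : ℕ → Ω → ℝ) (g0 : LinkState → Ω → ℝ) (S : Ω → LinkState) : Prop where
  isHPPP : IsHPPP μ p.lam Φ
  measurable_y : ∀ i, Measurable (y i)
  injective_y : ∀ᵐ ω ∂μ, Function.Injective (fun i ↦ y i ω)
  range_y : ∀ᵐ ω ∂μ, Set.range (fun i ↦ y i ω) = Φ ω \ p.disc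
  monotone_y : ∀ᵐ ω ∂μ, Monotone (fun i ↦ dist (y i ω) (uePos r₀))
  measurable_g : ∀ i, Measurable (g i)
  hasLaw_g : ∀ i, HasLaw (g i) (expMeasure 1) μ
  iIndepFun_g : iIndepFun g μ
  measurable_g0 : ∀ s, Measurable (g0 s)
  hasLaw_g0 : ∀ s, HasLaw (g0 s) (gammaMeasure (p.m s) (p.m s)) μ
  measurable_S : Measurable S
  prob_S : ∀ s, μ.real (S ⁻¹' {s}) = p.linkProb r₀ s
  indep_y : IndepFun (fun ω i ↦ y i ω) (fun ω ↦ ((fun i ↦ g i ω), (fun s ↦ g0 s ω), S ω)) μ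
  indep_g : IndepFun (fun ω i ↦ g i ω) (fun ω ↦ ((fun s ↦ g0 s ω), S ω)) μ
  indep_g0 : IndepFun (fun ω s ↦ g0 s ω) S μ

section Network

/-- The channel gain `h₀` from the UAV. -/
noncomputable def airGain {Ω : Type*} (p : NetParams) (r₀ : ℝ) (g0 : LinkState → Ω → ℝ)
    (S : Ω → LinkState) (ω : Ω) : ENNReal :=
  ENNReal.ofReal (g0 (S ω) ω / p.airLoss r₀ (S ω))

/-- The channel gain from the ground BS `y i`. -/
noncomputable def groundGain {Ω : Type*} (p : NetParams) (r₀ : ℝ)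
    (y : ℕ → Ω → EuclideanSpace ℝ (Fin 2)) (g : ℕ → Ω → ℝ) (i : ℕ) (ω : Ω) : ENNReal :=
  ENNReal.ofReal (g i ω / dist (y i ω) (uePos r₀) ^ p.alphaN)

/-- The interference `I₂` from all ground BSs but the nearest one. -/
noncomputable def farInterference {Ω : Type*} (p : NetParams) (r₀ : ℝ)
    (y : ℕ → Ω → EuclideanSpace ℝ (Fin 2)) (g : ℕ → Ω → ℝ) (ω : Ω) : ENNReal :=
  ∑' i, groundGain p r₀ y g (i + 1) ω

/-- The SIR of a UE of each type. -/
noncomputable def sir {Ω : Type*} (p : NetParams) (r₀ : ℝ)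
    (y : ℕ → Ω → EuclideanSpace ℝ (Fin 2)) (g : ℕ → Ω → ℝ) (g0 : LinkState → Ω → ℝ)
    (S : Ω → LinkState) (ω : Ω) : Region → ENNReal
  | .bs => groundGain p r₀ y g 0 ω / (airGain p r₀ g0 S ω + farInterference p r₀ y g ω)
  | .coop => (airGain p r₀ g0 S ω + groundGain p r₀ y g 0 ω) / farInterference p r₀ y g ω
  | .uav => airGain p r₀ g0 S ω / ∑' i, groundGain p r₀ y g i ω

/-- The type of the UE in the random network. -/
noncomputable def ueRegion {Ω : Type*} (p : NetParams) (r₀ : ℝ)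
    (y : ℕ → Ω → EuclideanSpace ℝ (Fin 2)) (S : Ω → LinkState) (ω : Ω) : Region :=
  p.regionOf r₀ (S ω) (dist (y 0 ω) (uePos r₀))

/-- The event that the UE is covered: its SIR exceeds the threshold. -/
noncomputable def covered {Ω : Type*} (p : NetParams) (r₀ : ℝ)
    (y : ℕ → Ω → EuclideanSpace ℝ (Fin 2)) (g : ℕ → Ω → ℝ) (g0 : LinkState → Ω → ℝ)
    (S : Ω → LinkState) : Set Ω :=
  {ω | ENNReal.ofReal p.eps < sir p r₀ y g g0 S ω (ueRegion p r₀ y S ω)}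

/-- The event that the UE is of type `i` and is covered. -/
noncomputable def coveredIn {Ω : Type*} (p : NetParams) (r₀ : ℝ)
    (y : ℕ → Ω → EuclideanSpace ℝ (Fin 2)) (g : ℕ → Ω → ℝ) (g0 : LinkState → Ω → ℝ)
    (S : Ω → LinkState) (i : Region) : Set Ω :=
  {ω | ueRegion p r₀ y S ω = i ∧ ENNReal.ofReal p.eps < sir p r₀ y g g0 S ω i}

end Network

/-! The proof reduces the network to one dimension, finds the joint law of the nearest distance R₀
and of the far interference I₂, and then averages elementary functions of I₂.

Seen from the UE, the distances to the stations outside the disc form a Poisson process on (0, ∞).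
Its intensity w(r) is λ times the length of the part of the circle of radius r that lies outside the
disc (`radialMeasure_eq_withDensity`). The Laplace functional E exp(-∑ψ(Rᵢ)) = exp(-∫(1 - e^(-ψ))w)
(`IsPoissonSeq.lintegral_expNeg_tsum`) carries all the probability. Exponential fading turns e^(-uh)
at distance ρ into 1/(1 + uρ^(-α)) on average, and 1 minus this is the kernel u/(u + ρ^α). The value
ψ = ∞ on (-∞, t] encodes the event R₀ > t. Differentiating in t and dividing by the factor of the
nearest point gives E[F(R₀)e^(-u I₂)] = ∫ F(r) w(r) exp(-∫₀ʳ w) exp(-∫_{ρ>r} u/(u + ρ^α) w(ρ) dρ) dr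
(`IsPoissonSeq.lintegral_nearest_mul_interference`).

Two computations identify the terms. First, w(r) exp(-∫₀ʳ w) is the density f (`pdf_eq`), because
λζ₂ is a primitive of w. Secondly, the last exponent is η(u) (`eta_eq`), by polar coordinates around
the UE and the substitution z = t^α/(t^α + u) in each direction. Hence the conditional law of I₂
given R₀ = r has Laplace transform ℒ (`IsNetwork.lintegral_condDistrib`).

For I₂ = z fixed, the probability over the two remaining fading powers that the UE is covered is a
linear combination of functions zˡe^(-uz). This comes from the Erlang tail, from the binomial
theorem, and, for two cooperating transmitters, from the convolution of an Erlang with an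
exponential law. The mean of zˡe^(-uz) is (-1)ˡℒ⁽ˡ⁾(u) (`integrable_powMulExp_and_integral`), which
yields P¹, P² and P³ (`integral_coverSet`). Independence of (R₀, I₂), the two fading powers and the
link state assembles these into the integrals over r₁. The single radius with β₀ = β₁, where P² is
not defined by partial fractions, is a null set.

Sums and gains take values in [0, ∞] throughout, so that no finiteness of the interference has to be
proved: an infinite interference has Laplace weight 0 and never allows coverage. -/

open Set Filter Topology
open scoped ENNReal NNReal

/-! ### The exponential on [0, ∞] and the Laplace functional of a Poisson process -/

/-- The function `x ↦ exp (-x)` on `[0, ∞]`. -/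
noncomputable def expNeg (x : ℝ≥0∞) : ℝ≥0∞ := EReal.exp (-(x : EReal))

lemma expNeg_zero : expNeg 0 = 1 := by simp [expNeg]

lemma expNeg_top : expNeg ⊤ = 0 := by simp [expNeg]

lemma expNeg_ofReal {x : ℝ} (hx : 0 ≤ x) : expNeg (ENNReal.ofReal x) = ENNReal.ofReal (Real.exp (-x)) := by
  rw [expNeg, EReal.coe_ennreal_ofReal, max_eq_left hx, ← EReal.coe_neg, EReal.exp_coe]

lemma expNeg_add (x y : ℝ≥0∞) : expNeg (x + y) = expNeg x * expNeg y := by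
  simp only [expNeg, EReal.exp_neg, EReal.coe_ennreal_add, EReal.exp_add]
  rw [ENNReal.mul_inv] <;> simp [EReal.exp_eq_zero_iff]

lemma expNeg_sum {ι : Type*} (s : Finset ι) (f : ι → ℝ≥0∞) :
    expNeg (∑ i ∈ s, f i) = ∏ i ∈ s, expNeg (f i) := by
  classical
  induction s using Finset.induction_on with
  | empty => simp [expNeg_zero]
  | insert a s ha ih => rw [Finset.sum_insert ha, Finset.prod_insert ha, expNeg_add, ih]

lemma expNeg_antitone : Antitone expNeg := fun x y h ↦ by
  simp only [expNeg, EReal.exp_le_exp_iff, EReal.neg_le_neg_iff]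
  exact_mod_cast h

lemma expNeg_le_one (x : ℝ≥0∞) : expNeg x ≤ 1 :=
  (expNeg_antitone (zero_le : (0 : ℝ≥0∞) ≤ x)).trans expNeg_zero.le

lemma continuous_expNeg : Continuous expNeg :=
  ENNReal.continuous_exp.comp (continuous_neg.comp continuous_coe_ennreal_ereal)

lemma measurable_expNeg : Measurable expNeg := continuous_expNeg.measurable

lemma expNeg_mul_natCast (c : ℝ≥0∞) (n : ℕ) : expNeg (c * n) = expNeg c ^ n := by
  induction n with
  | zero => simp [expNeg_zero]
  | succ n ih => rw [Nat.cast_succ, mul_add, expNeg_add, ih, mul_one, pow_succ]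

lemma expNeg_eq_ofReal (c : ℝ≥0∞) : ∃ a : ℝ, 0 ≤ a ∧ a ≤ 1 ∧ expNeg c = ENNReal.ofReal a :=
  ⟨(expNeg c).toReal, ENNReal.toReal_nonneg,
    ENNReal.toReal_le_of_le_ofReal zero_le_one (by simpa using expNeg_le_one c),
    (ENNReal.ofReal_toReal ((expNeg_le_one c).trans_lt ENNReal.one_lt_top).ne).symm⟩

/-- With a = e^(-c) this is the generating function E aᴺ = e^(-(1-a)m). It includes c = ∞, where a =
0 and both sides are the probability that N = 0. -/
lemma lintegral_expNeg_mul_poissonMeasure (c : ℝ≥0∞) (m : ℝ≥0) :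
    ∫⁻ n, expNeg (c * (n : ℕ)) ∂(poissonMeasure m) = expNeg ((1 - expNeg c) * m) := by
  obtain ⟨a, ha0, ha1, ha⟩ := expNeg_eq_ofReal c
  have h1 : (1 : ℝ≥0∞) - expNeg c = ENNReal.ofReal (1 - a) := by
    rw [ha, ENNReal.ofReal_sub _ ha0, ENNReal.ofReal_one]
  have h2 : (1 - expNeg c) * (m : ℝ≥0∞) = ENNReal.ofReal ((1 - a) * m) := by
    rw [h1, ENNReal.ofReal_mul (by linarith), ENNReal.ofReal_coe_nnreal]
  rw [h2, expNeg_ofReal (mul_nonneg (sub_nonneg.2 ha1) m.coe_nonneg), poissonMeasure, lintegral_sum_measure]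
  simp_rw [lintegral_smul_measure, lintegral_dirac, expNeg_mul_natCast, ha]
  have h3 : HasSum (fun n : ℕ ↦ Real.exp (-m) * ((m * a) ^ n / n.factorial))
      (Real.exp (-m) * Real.exp (m * a)) := by
    rw [Real.exp_eq_exp_ℝ]
    exact (NormedSpace.expSeries_div_hasSum_exp ((m : ℝ) * a)).mul_left _
  have h4 : ∀ n : ℕ, ENNReal.ofReal (Real.exp (-m) * m ^ n / n.factorial) • ENNReal.ofReal a ^ n
      = ENNReal.ofReal (Real.exp (-m) * ((m * a) ^ n / n.factorial)) := fun n ↦ by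
    rw [smul_eq_mul, ← ENNReal.ofReal_pow ha0, ← ENNReal.ofReal_mul (by positivity)]
    congr 1
    rw [mul_pow]; ring
  simp_rw [h4]
  rw [← ENNReal.ofReal_tsum_of_nonneg (fun n ↦ by positivity) h3.summable, h3.tsum_eq, ← Real.exp_add]
  congr 2; ring

/-- The condition F 0 = 0 removes the fibre over 0. This matters because counts are controlled only
in sets bounded above, and that fibre is unbounded when ψ has bounded support. -/
lemma SimpleFunc.eq_sum_indicator (ψ : SimpleFunc ℝ ℝ≥0∞) (F : ℝ≥0∞ → ℝ≥0∞) (hF : F 0 = 0) (r : ℝ) :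
    F (ψ r) = ∑ c ∈ ψ.range.erase 0, (ψ ⁻¹' {c}).indicator (fun _ ↦ F c) r := by
  classical
  by_cases h0 : ψ r = 0
  · rw [h0, hF, Finset.sum_eq_zero]
    intro c hc
    rw [indicator_of_notMem]
    simp only [mem_preimage, mem_singleton_iff]
    exact fun h ↦ (Finset.ne_of_mem_erase hc) (h.symm.trans h0)
  · rw [Finset.sum_eq_single (ψ r)]
    · simp
    · intro c _ hc
      rw [indicator_of_notMem]
      simpa using hc.symm
    · intro h
      exact absurd (Finset.mem_erase.2 ⟨h0, SimpleFunc.mem_range_self ψ r⟩) h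

section LaplaceFunctional

variable {Ω : Type*} [MeasurableSpace Ω]

/-- The number of points of the sequence `R` in the set `J`. -/
noncomputable def pointCount (R : ℕ → Ω → ℝ) (J : Set ℝ) (ω : Ω) : ℝ≥0∞ :=
  ∑' i, J.indicator 1 (R i ω)

lemma measurable_pointCount {R : ℕ → Ω → ℝ} (hR : ∀ i, Measurable (R i)) {J : Set ℝ}
    (hJ : MeasurableSet J) : Measurable (pointCount R J) :=
  Measurable.tsum fun i ↦ (measurable_one.indicator hJ).comp (hR i)

variable {μ : Measure Ω} {ν : Measure ℝ} {R : ℕ → Ω → ℝ}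

/-- The radial counts of a Poisson process with intensity `ν`: counts in sets that are bounded
above are Poisson, and independent for disjoint sets. -/
structure IsPoissonSeq (μ : Measure Ω) (ν : Measure ℝ) (R : ℕ → Ω → ℝ) : Prop where
  measurable : ∀ i, Measurable (R i)
  laplace_count : ∀ J : Set ℝ, MeasurableSet J → BddAbove J → ∀ c : ℝ≥0∞,
    ∫⁻ ω, expNeg (c * pointCount R J ω) ∂μ = expNeg ((1 - expNeg c) * ν J)
  indep_count : ∀ (n : ℕ) (J : Fin n → Set ℝ), (∀ k, MeasurableSet (J k)) →
    (∀ k, BddAbove (J k)) → Pairwise (fun k l ↦ Disjoint (J k) (J l)) →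
    iIndepFun (fun k ↦ pointCount R (J k)) μ

/-- The sum of ψ over the points is a linear combination of the counts in the fibres over nonzero
values. These counts are independent, so the expectation factors into Poisson generating functions.
-/
lemma IsPoissonSeq.lintegral_expNeg_simpleFunc (h : IsPoissonSeq μ ν R) (ψ : SimpleFunc ℝ ℝ≥0∞)
    (hψ : BddAbove (Function.support ψ)) :
    ∫⁻ ω, expNeg (∑' i, ψ (R i ω)) ∂μ = expNeg (∫⁻ r, (1 - expNeg (ψ r)) ∂ν) := by
  classical
  set s := ψ.range.erase 0 with hs
  let e : Fin s.card ≃ s := s.equivFin.symm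
  let J : Fin s.card → Set ℝ := fun k ↦ ψ ⁻¹' {(e k : ℝ≥0∞)}
  have hJm : ∀ k, MeasurableSet (J k) := fun k ↦ ψ.measurableSet_fiber _
  have hJb : ∀ k, BddAbove (J k) := fun k ↦ hψ.mono fun r hr ↦ by
    have : ψ r = e k := hr
    rw [Function.mem_support, this]
    exact Finset.ne_of_mem_erase (e k).2
  have hJd : Pairwise (fun k l ↦ Disjoint (J k) (J l)) := fun k l hkl ↦ by
    refine Set.disjoint_left.2 ?_
    intro r hr hr'
    have h1 : ψ r = e k := hr
    have h2 : ψ r = e l := hr'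
    exact hkl (e.injective (Subtype.ext (h1.symm.trans h2)))
  -- Used with F the identity, for the sum over the points, and with F c = 1 - e^(-c), for the
  -- integral of the intensity.
  have key : ∀ F : ℝ≥0∞ → ℝ≥0∞, F 0 = 0 → ∀ r,
      F (ψ r) = ∑ k, (J k).indicator (fun _ ↦ F (e k)) r := fun F hF r ↦ by
    rw [SimpleFunc.eq_sum_indicator ψ F hF r, ← hs, ← Finset.sum_coe_sort s, ← Equiv.sum_comp e]
  have h1 : ∀ ω, expNeg (∑' i, ψ (R i ω)) = ∏ k, expNeg ((e k : ℝ≥0∞) * pointCount R (J k) ω) := by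
    intro ω
    rw [← expNeg_sum]
    congr 1
    simp_rw [pointCount, ← ENNReal.tsum_mul_left]
    rw [← Summable.tsum_finsetSum (fun _ _ ↦ ENNReal.summable)]
    congr 1 with i
    rw [key (fun x ↦ x) rfl]
    refine Finset.sum_congr rfl fun k _ ↦ ?_
    by_cases hk : R i ω ∈ J k <;> simp [hk]
  simp_rw [h1]
  rw [lintegral_prod_eq_prod_lintegral_of_indepFun Finset.univ
    (fun k ω ↦ expNeg ((e k : ℝ≥0∞) * pointCount R (J k) ω))
    ((h.indep_count _ J hJm hJb hJd).comp (fun k x ↦ expNeg ((e k : ℝ≥0∞) * x))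
      (fun k ↦ measurable_expNeg.comp (measurable_const.mul measurable_id)))
    (fun k ↦ measurable_expNeg.comp ((measurable_pointCount h.measurable (hJm k)).const_mul _))]
  simp_rw [h.laplace_count _ (hJm _) (hJb _)]
  rw [← expNeg_sum]
  congr 1
  have h2 : ∀ r, 1 - expNeg (ψ r) = ∑ k, (J k).indicator (fun _ ↦ 1 - expNeg (e k)) r :=
    key (fun c ↦ 1 - expNeg c) (by simp [expNeg_zero])
  simp_rw [h2]
  rw [lintegral_finsetSum _ (fun k _ ↦ measurable_const.indicator (hJm k))]
  refine Finset.sum_congr rfl fun k _ ↦ ?_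
  rw [lintegral_indicator (hJm k), lintegral_const, Measure.restrict_apply_univ]

/-- The Laplace functional of a Poisson process. -/
theorem IsPoissonSeq.lintegral_expNeg_tsum [IsProbabilityMeasure μ] (h : IsPoissonSeq μ ν R) {ψ : ℝ → ℝ≥0∞}
    (hψ : Measurable ψ) :
    ∫⁻ ω, expNeg (∑' i, ψ (R i ω)) ∂μ = expNeg (∫⁻ r, (1 - expNeg (ψ r)) ∂ν) := by
  -- Truncation to (-∞, n] makes the supports bounded above. Both sides then pass to the limit: the
  -- left by domination by 1, the right by monotone convergence.
  let φ : ℕ → SimpleFunc ℝ ℝ≥0∞ := fun n ↦ (SimpleFunc.eapprox ψ n).restrict (Iic (n : ℝ))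
  have hφ : ∀ n r, φ n r = (Iic (n : ℝ)).indicator (SimpleFunc.eapprox ψ n) r := fun n r ↦
    SimpleFunc.restrict_apply _ measurableSet_Iic _
  have hmono : ∀ r, Monotone fun n ↦ φ n r := fun r m n hmn ↦ by
    simp only [hφ]
    by_cases hr : r ≤ m
    · have hr' : r ≤ n := hr.trans (by exact_mod_cast hmn)
      rw [indicator_of_mem (by exact hr), indicator_of_mem (by exact hr')]
      exact SimpleFunc.monotone_eapprox ψ hmn r
    · rw [indicator_of_notMem (by exact hr)]
      exact zero_le
  have htend : ∀ r, Tendsto (fun n ↦ φ n r) atTop (𝓝 (ψ r)) := fun r ↦ by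
    have h1 : Tendsto (fun n ↦ SimpleFunc.eapprox ψ n r) atTop (𝓝 (ψ r)) := by
      have := tendsto_atTop_iSup (f := fun n ↦ SimpleFunc.eapprox ψ n r)
        (fun m n hmn ↦ SimpleFunc.monotone_eapprox ψ hmn r)
      rwa [SimpleFunc.iSup_eapprox_apply hψ] at this
    refine h1.congr' ?_
    filter_upwards [eventually_ge_atTop ⌈r⌉₊] with n hn
    rw [hφ, indicator_of_mem]
    exact (Nat.le_ceil r).trans (by exact_mod_cast hn)
  -- The sum is an integral for the counting measure, so monotone convergence applies.
  have hsum : ∀ ω, Tendsto (fun n ↦ ∑' i, φ n (R i ω)) atTop (𝓝 (∑' i, ψ (R i ω))) := fun ω ↦ by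
    simp_rw [← lintegral_count]
    exact lintegral_tendsto_of_tendsto_of_monotone (fun n ↦ (measurable_of_countable _).aemeasurable)
      (ae_of_all _ fun i ↦ hmono _) (ae_of_all _ fun i ↦ htend _)
  have hmeas : ∀ n, Measurable fun ω ↦ expNeg (∑' i, φ n (R i ω)) := fun n ↦
    measurable_expNeg.comp (Measurable.tsum fun i ↦ (φ n).measurable.comp (h.measurable i))
  have hL : Tendsto (fun n ↦ ∫⁻ ω, expNeg (∑' i, φ n (R i ω)) ∂μ) atTop
      (𝓝 (∫⁻ ω, expNeg (∑' i, ψ (R i ω)) ∂μ)) :=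
    tendsto_lintegral_of_dominated_convergence (fun _ ↦ 1) hmeas
      (fun n ↦ ae_of_all _ fun ω ↦ expNeg_le_one _) (by simp)
      (ae_of_all _ fun ω ↦ (continuous_expNeg.tendsto _).comp (hsum ω))
  have hRt : Tendsto (fun n ↦ expNeg (∫⁻ r, (1 - expNeg (φ n r)) ∂ν)) atTop
      (𝓝 (expNeg (∫⁻ r, (1 - expNeg (ψ r)) ∂ν))) := by
    refine (continuous_expNeg.tendsto _).comp ?_
    refine lintegral_tendsto_of_tendsto_of_monotone
      (fun n ↦ (measurable_const.sub (measurable_expNeg.comp (φ n).measurable)).aemeasurable)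
      (ae_of_all _ fun r m n hmn ↦ ?_) (ae_of_all _ fun r ↦ ?_)
    · exact tsub_le_tsub_left (expNeg_antitone (hmono r hmn)) _
    · exact ENNReal.Tendsto.sub tendsto_const_nhds ((continuous_expNeg.tendsto _).comp (htend r))
        (Or.inl ENNReal.one_ne_top)
  refine tendsto_nhds_unique hL (hRt.congr fun n ↦ ?_)
  refine (h.lintegral_expNeg_simpleFunc (φ n) ⟨n, fun r hr ↦ ?_⟩).symm
  by_contra hlt
  refine hr ?_
  rw [hφ, indicator_of_notMem (by exact hlt)]

end LaplaceFunctional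

/-! ### Gamma moments and exponential fading as marks of the points -/

lemma measurable_gammaPDF (k r : ℝ) : Measurable (gammaPDF k r) :=
  (measurable_gammaPDFReal k r).ennreal_ofReal

/-- Multiplying the Gamma(k, r) density by xᵗe^(-ax) gives a constant times the Gamma(k + t, r + a)
density, whose total mass is 1. -/
lemma lintegral_gammaMeasure_pow_mul_exp {k r a : ℝ} (hk : 0 < k) (hr : 0 < r) (ha : 0 ≤ a) (t : ℕ) :
    ∫⁻ x, ENNReal.ofReal (x ^ t * Real.exp (-(a * x))) ∂gammaMeasure k r
      = ENNReal.ofReal (r ^ k * Real.Gamma (k + t) / (Real.Gamma k * (r + a) ^ (k + t))) := by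
  set c := r ^ k * Real.Gamma (k + t) / (Real.Gamma k * (r + a) ^ (k + t)) with hc
  have hkt : 0 < k + t := by positivity
  have hra : 0 < r + a := by positivity
  have hG1 := Real.Gamma_pos_of_pos hk
  have hG2 := Real.Gamma_pos_of_pos hkt
  have hp : 0 < (r + a) ^ (k + t) := Real.rpow_pos_of_pos hra _
  have hc0 : 0 ≤ c := by positivity
  rw [gammaMeasure, lintegral_withDensity_eq_lintegral_mul _ (measurable_gammaPDF k r)
    (by fun_prop)]
  have : ∀ᵐ x : ℝ, (gammaPDF k r * fun x ↦ ENNReal.ofReal (x ^ t * Real.exp (-(a * x)))) x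
      = ENNReal.ofReal c * gammaPDF (k + t) (r + a) x := by
    filter_upwards [Measure.ae_ne volume (0 : ℝ)] with x hx
    rcases lt_or_gt_of_ne hx with h | h
    · simp [gammaPDF_of_neg h]
    · rw [Pi.mul_apply, gammaPDF_of_nonneg h.le, gammaPDF_of_nonneg h.le,
        ← ENNReal.ofReal_mul (by positivity), ← ENNReal.ofReal_mul hc0]
      congr 1
      have h1 : x ^ (k + t - 1) = x ^ (k - 1) * x ^ t := by
        rw [← Real.rpow_natCast, ← Real.rpow_add h]; congr 1; ring
      have h2 : Real.exp (-((r + a) * x)) = Real.exp (-(r * x)) * Real.exp (-(a * x)) := by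
        rw [← Real.exp_add]; congr 1; ring
      rw [h1, h2, hc]
      field_simp
  rw [lintegral_congr_ae this, lintegral_const_mul _ (measurable_gammaPDF _ _),
    lintegral_gammaPDF_eq_one hkt hra, mul_one]

lemma ae_gammaMeasure_nonneg (k r : ℝ) : ∀ᵐ x ∂gammaMeasure k r, 0 ≤ x := by
  rw [gammaMeasure, ae_withDensity_iff (measurable_gammaPDF k r)]
  refine ae_of_all _ fun x hx ↦ ?_
  by_contra h
  exact hx (gammaPDF_of_neg (not_le.1 h))

lemma ProbabilityTheory.IndepFun.lintegral_comp_prod {Ω α β : Type*} [MeasurableSpace Ω]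
    [MeasurableSpace α] [MeasurableSpace β] {μ : Measure Ω} [IsProbabilityMeasure μ]
    {X : Ω → α} {Y : Ω → β} (hXY : IndepFun X Y μ) (hX : Measurable X) (hY : Measurable Y)
    {F : α × β → ℝ≥0∞} (hF : Measurable F) :
    ∫⁻ ω, F (X ω, Y ω) ∂μ = ∫⁻ ω, ∫⁻ ω', F (X ω, Y ω') ∂μ ∂μ := by
  have h := (indepFun_iff_map_prod_eq_prod_map_map hX.aemeasurable hY.aemeasurable).1 hXY
  have : IsProbabilityMeasure (μ.map Y) := Measure.isProbabilityMeasure_map hY.aemeasurable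
  rw [← lintegral_map hF (hX.prodMk hY), h, lintegral_prod _ hF.aemeasurable,
    lintegral_map hF.lintegral_prod_right' hX]
  refine lintegral_congr fun ω ↦ ?_
  exact lintegral_map (hF.comp measurable_prodMk_left) hY

section Marks

variable {Ω : Type*} [MeasurableSpace Ω] {μ : Measure Ω}

/-- The value 1/(1 + a) is written as e^(-log(1+a)) so that a product over the points becomes a sum
inside `expNeg`, to which the Laplace functional applies. -/
lemma lintegral_expNeg_mul_exp {X : Ω → ℝ} (hX : HasLaw X (expMeasure 1) μ) {a : ℝ} (ha : 0 ≤ a) :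
    ∫⁻ ω, expNeg (ENNReal.ofReal (a * X ω)) ∂μ = expNeg (ENNReal.ofReal (Real.log (1 + a))) := by
  have hm : Measurable fun x : ℝ ↦ expNeg (ENNReal.ofReal (a * x)) :=
    measurable_expNeg.comp (by fun_prop)
  have h1 : ∫⁻ ω, expNeg (ENNReal.ofReal (a * X ω)) ∂μ
      = ∫⁻ x, expNeg (ENNReal.ofReal (a * x)) ∂(gammaMeasure 1 1) := by
    rw [← expMeasure, ← hX.map_eq, lintegral_map' hm.aemeasurable hX.aemeasurable]
  have h2 : ∫⁻ x, expNeg (ENNReal.ofReal (a * x)) ∂(gammaMeasure 1 1)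
      = ∫⁻ x, ENNReal.ofReal (x ^ 0 * Real.exp (-(a * x))) ∂(gammaMeasure 1 1) :=
    lintegral_congr_ae <| by
      filter_upwards [ae_gammaMeasure_nonneg 1 1] with x hx
      rw [expNeg_ofReal (by positivity), pow_zero, one_mul]
  rw [h1, h2, lintegral_gammaMeasure_pow_mul_exp one_pos one_pos ha,
    expNeg_ofReal (Real.log_nonneg (by linarith)), Real.exp_neg, Real.exp_log (by linarith)]
  simp

variable [IsProbabilityMeasure μ]

/-- Finite sums factor by independence. The limit is taken under the integral because `expNeg` is
continuous and at most 1. -/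
lemma lintegral_expNeg_tsum_mul_exp {g : ℕ → Ω → ℝ} (hg : ∀ i, Measurable (g i))
    (hlaw : ∀ i, HasLaw (g i) (expMeasure 1) μ) (hind : iIndepFun g μ) {a : ℕ → ℝ}
    (ha : ∀ i, 0 ≤ a i) :
    ∫⁻ ω, expNeg (∑' i, ENNReal.ofReal (a i * g i ω)) ∂μ
      = expNeg (∑' i, ENNReal.ofReal (Real.log (1 + a i))) := by
  have hmi : ∀ i, Measurable fun x : ℝ ↦ expNeg (ENNReal.ofReal (a i * x)) := fun i ↦
    measurable_expNeg.comp (by fun_prop)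
  have hn : ∀ n : ℕ, ∫⁻ ω, expNeg (∑ i ∈ Finset.range n, ENNReal.ofReal (a i * g i ω)) ∂μ
      = expNeg (∑ i ∈ Finset.range n, ENNReal.ofReal (Real.log (1 + a i))) := fun n ↦ by
    simp_rw [expNeg_sum]
    rw [lintegral_prod_eq_prod_lintegral_of_indepFun _
      (fun i ω ↦ expNeg (ENNReal.ofReal (a i * g i ω)))
      (hind.comp (fun i x ↦ expNeg (ENNReal.ofReal (a i * x))) hmi) (fun i ↦ (hmi i).comp (hg i))]
    exact Finset.prod_congr rfl fun i _ ↦ lintegral_expNeg_mul_exp (hlaw i) (ha i)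
  have hL : Tendsto (fun n : ℕ ↦ ∫⁻ ω, expNeg (∑ i ∈ Finset.range n, ENNReal.ofReal (a i * g i ω)) ∂μ)
      atTop (𝓝 (∫⁻ ω, expNeg (∑' i, ENNReal.ofReal (a i * g i ω)) ∂μ)) :=
    tendsto_lintegral_of_dominated_convergence (fun _ ↦ 1)
      (fun n ↦ measurable_expNeg.comp (Finset.measurable_fun_sum _ fun i _ ↦
        ((hg i).const_mul _).ennreal_ofReal))
      (fun n ↦ ae_of_all _ fun ω ↦ expNeg_le_one _) (by simp)
      (ae_of_all _ fun ω ↦ (continuous_expNeg.tendsto _).comp (ENNReal.tendsto_nat_tsum _))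
  refine tendsto_nhds_unique hL (Tendsto.congr (fun n ↦ (hn n).symm) ?_)
  exact (continuous_expNeg.tendsto _).comp (ENNReal.tendsto_nat_tsum _)

/-- The exponential fading can be integrated out given the locations. -/
lemma lintegral_mul_expNeg_interference {g R : ℕ → Ω → ℝ} {α u : ℝ} (hu : 0 ≤ u)
    (hg : ∀ i, Measurable (g i)) (hlaw : ∀ i, HasLaw (g i) (expMeasure 1) μ) (hind : iIndepFun g μ)
    (hR : ∀ i, Measurable (R i)) (hRpos : ∀ᵐ ω ∂μ, ∀ i, 0 < R i ω)
    (hRg : IndepFun (fun ω i ↦ R i ω) (fun ω i ↦ g i ω) μ) {F : ℝ → ℝ≥0∞} (hF : Measurable F) (j : ℕ) :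
    ∫⁻ ω, F (R 0 ω) * expNeg (ENNReal.ofReal u * ∑' i, ENNReal.ofReal (g (i + j) ω / R (i + j) ω ^ α)) ∂μ
      = ∫⁻ ω, F (R 0 ω) * expNeg (∑' i, ENNReal.ofReal (Real.log (1 + u / R (i + j) ω ^ α))) ∂μ := by
  let G : (ℕ → ℝ) × (ℕ → ℝ) → ℝ≥0∞ := fun z ↦ F (z.1 0) *
    expNeg (ENNReal.ofReal u * ∑' i, ENNReal.ofReal (z.2 (i + j) / z.1 (i + j) ^ α))
  have hG : Measurable G := by
    refine (hF.comp (by fun_prop)).mul (measurable_expNeg.comp ((Measurable.tsum fun i ↦ ?_).const_mul _))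
    exact (Measurable.div (by fun_prop) (Measurable.pow_const (by fun_prop) _)).ennreal_ofReal
  have hR' : Measurable fun ω i ↦ R i ω := measurable_pi_lambda _ hR
  have hg' : Measurable fun ω i ↦ g i ω := measurable_pi_lambda _ hg
  have h1 := hRg.lintegral_comp_prod hR' hg' hG
  simp only [G] at h1
  rw [h1]
  -- From here the locations are frozen at ω and only the fading varies, with ω'.
  refine lintegral_congr_ae ?_
  filter_upwards [hRpos] with ω hω
  have hpos : ∀ i, 0 ≤ u / R (i + j) ω ^ α := fun i ↦ by have := hω (i + j); positivity
  have hm : Measurable fun ω' ↦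
      expNeg (ENNReal.ofReal u * ∑' i, ENNReal.ofReal (g (i + j) ω' / R (i + j) ω ^ α)) :=
    measurable_expNeg.comp ((Measurable.tsum fun i ↦ ((hg _).div_const _).ennreal_ofReal).const_mul _)
  rw [lintegral_const_mul _ hm,
    ← lintegral_expNeg_tsum_mul_exp (g := fun i ↦ g (i + j)) (fun i ↦ hg _) (fun i ↦ hlaw _)
    (hind.precomp (add_left_injective j)) hpos]
  congr 1
  refine lintegral_congr fun ω' ↦ ?_
  rw [← ENNReal.tsum_mul_left]
  congr 2 with i
  rw [← ENNReal.ofReal_mul hu]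
  congr 1; ring

end Marks

/-! ### Joint law of the nearest point and of the interference of the others -/

section Nearest

variable {Ω : Type*} [MeasurableSpace Ω] {μ : Measure Ω} [IsProbabilityMeasure μ]

lemma one_sub_expNeg_log {u ρ α : ℝ} (hu : 0 ≤ u) (hρ : 0 < ρ) :
    1 - expNeg (ENNReal.ofReal (Real.log (1 + u / ρ ^ α))) = ENNReal.ofReal (u / (u + ρ ^ α)) := by
  have hp : 0 < ρ ^ α := Real.rpow_pos_of_pos hρ _
  have h1 : 0 ≤ u / ρ ^ α := by positivity
  rw [expNeg_ofReal (Real.log_nonneg (by linarith)), Real.exp_neg, Real.exp_log (by linarith),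
    ← ENNReal.ofReal_one, ← ENNReal.ofReal_sub _ (by positivity)]
  congr 1
  field_simp
  ring

/-- The event is absorbed into the Laplace functional by giving ψ the value ∞ on (-∞, t]: a point
there makes the sum infinite and its weight 0. That part of ψ contributes ν(-∞, t] to the exponent.
-/
lemma IsPoissonSeq.lintegral_indicator_mul_expNeg {ν : Measure ℝ} {R : ℕ → Ω → ℝ}
    (h : IsPoissonSeq μ ν R) (hRmono : ∀ᵐ ω ∂μ, Monotone fun i ↦ R i ω) {α u t : ℝ} (hu : 0 ≤ u)
    (ht : 0 ≤ t) :
    ∫⁻ ω, (Ioi t).indicator 1 (R 0 ω) * expNeg (∑' i, ENNReal.ofReal (Real.log (1 + u / R i ω ^ α))) ∂μ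
      = expNeg (ν (Iic t) + ∫⁻ ρ in Ioi t, ENNReal.ofReal (u / (u + ρ ^ α)) ∂ν) := by
  classical
  let ψ : ℝ → ℝ≥0∞ := fun ρ ↦ if ρ ≤ t then ⊤ else ENNReal.ofReal (Real.log (1 + u / ρ ^ α))
  have hψ : Measurable ψ := Measurable.ite measurableSet_Iic measurable_const
    (Real.measurable_log.comp ((measurable_id.pow_const α).const_div u |>.const_add 1)).ennreal_ofReal
  have h1 := h.lintegral_expNeg_tsum hψ
  have h2 : ∫⁻ ρ, (1 - expNeg (ψ ρ)) ∂ν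
      = ν (Iic t) + ∫⁻ ρ in Ioi t, ENNReal.ofReal (u / (u + ρ ^ α)) ∂ν := by
    rw [← lintegral_add_compl _ (measurableSet_Iic (a := t)), compl_Iic]
    congr 1
    · rw [setLIntegral_congr_fun measurableSet_Iic (g := fun _ ↦ 1), setLIntegral_one]
      intro ρ hρ
      simp only [ψ, if_pos (show ρ ≤ t from hρ), expNeg_top, tsub_zero]
    · refine setLIntegral_congr_fun measurableSet_Ioi fun ρ hρ ↦ ?_
      simp only [ψ, if_neg (not_le.2 (show t < ρ from hρ))]
      exact one_sub_expNeg_log hu (ht.trans_lt hρ)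
  rw [← h2, ← h1]
  refine lintegral_congr_ae ?_
  filter_upwards [hRmono] with ω hω
  by_cases h0 : t < R 0 ω
  · rw [indicator_of_mem (by exact h0), Pi.one_apply, one_mul]
    congr 2 with i
    simp only [ψ, if_neg (not_le.2 (h0.trans_le (hω (Nat.zero_le i))))]
  · have h3 : ∑' i, ψ (R i ω) = ⊤ :=
      ENNReal.tsum_eq_top_of_eq_top ⟨0, by simp only [ψ, if_pos (not_lt.1 h0)]⟩
    rw [h3, expNeg_top, indicator_of_notMem (by exact h0), zero_mul]

/-- The integrand is the derivative of -e^(-(K+V)), with V the primitive of v, except at countably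
many points. The exception is needed because the radial intensity jumps at R_c when the UE is at the
centre. -/
lemma integral_mul_exp_neg_primitive {v : ℝ → ℝ} {K T : ℝ} (hT : 0 ≤ T)
    (hv : IntervalIntegrable v volume 0 T) {s : Set ℝ} (hs : s.Countable)
    (hcont : ∀ x ∈ Ioo 0 T \ s, ContinuousAt v x) (hvm : Measurable v) :
    IntervalIntegrable (fun x ↦ v x * Real.exp (-(K + ∫ y in (0 : ℝ)..x, v y))) volume 0 T ∧
    ∫ x in (0 : ℝ)..T, v x * Real.exp (-(K + ∫ y in (0 : ℝ)..x, v y))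
      = Real.exp (-K) - Real.exp (-(K + ∫ y in (0 : ℝ)..T, v y)) := by
  have hcontV : ContinuousOn (fun x ↦ ∫ y in (0 : ℝ)..x, v y) (Icc 0 T) := by
    have := intervalIntegral.continuousOn_primitive_interval' (a := 0) (μ := volume) hv left_mem_uIcc
    rwa [uIcc_of_le hT] at this
  have hcontE : ContinuousOn (fun x ↦ Real.exp (-(K + ∫ y in (0 : ℝ)..x, v y))) (Icc 0 T) :=
    Real.continuous_exp.comp_continuousOn (continuousOn_const.add hcontV).neg
  have hint : IntervalIntegrable (fun x ↦ v x * Real.exp (-(K + ∫ y in (0 : ℝ)..x, v y))) volume 0 T :=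
    hv.mul_continuousOn (by rwa [uIcc_of_le hT])
  refine ⟨hint, ?_⟩
  rw [integral_eq_of_hasDerivAt_off_countable_of_le
    (fun x ↦ -Real.exp (-(K + ∫ y in (0 : ℝ)..x, v y))) _ hT hs hcontE.neg ?_ hint]
  · simp; ring
  · intro x hx
    have hd : HasDerivAt (fun x ↦ ∫ y in (0 : ℝ)..x, v y) (v x) x :=
      intervalIntegral.integral_hasDerivAt_right
        (hv.mono_set (by rw [uIcc_of_le hx.1.1.le, uIcc_of_le hT]; exact Icc_subset_Icc_right hx.1.2.le))
        hvm.stronglyMeasurable.stronglyMeasurableAtFilter (hcont x hx)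
    have he : HasDerivAt (fun x ↦ -Real.exp (-(K + ∫ y in (0 : ℝ)..x, v y)))
        (-(Real.exp (-(K + ∫ y in (0 : ℝ)..x, v y)) * -v x)) x :=
      (HasDerivAt.exp (hd.const_add K).neg).neg
    convert! he using 1
    ring

/-- A nonnegative radial intensity with at most linear growth and countably many discontinuities. -/
structure IsRadialIntensity (w : ℝ → ℝ) : Prop where
  measurable : Measurable w
  nonneg : ∀ x, 0 < x → 0 ≤ w x
  le_linear : ∃ c, 0 ≤ c ∧ ∀ x, 0 < x → w x ≤ c * x
  continuousAt : ∃ s : Set ℝ, s.Countable ∧ ∀ x, 0 < x → x ∉ s → ContinuousAt w x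

namespace IsRadialIntensity

variable {w : ℝ → ℝ}

lemma intervalIntegrable (hw : IsRadialIntensity w) {a b : ℝ} (ha : 0 ≤ a) (hb : 0 ≤ b) :
    IntervalIntegrable w volume a b := by
  obtain ⟨c, hc, hwc⟩ := hw.le_linear
  have hci : IntervalIntegrable (fun x : ℝ ↦ c * x) volume a b :=
    Continuous.intervalIntegrable (by fun_prop) a b
  refine hci.mono_fun hw.measurable.aestronglyMeasurable ?_
  rw [EventuallyLE, ae_restrict_iff' measurableSet_uIoc]
  refine ae_of_all _ fun x hx ↦ ?_
  have hx0 : 0 < x := (le_min ha hb).trans_lt hx.1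
  rw [Real.norm_of_nonneg (hw.nonneg x hx0),
    Real.norm_of_nonneg (mul_nonneg hc hx0.le)]
  exact hwc x hx0

/-- On (0, 1] the kernel is at most 1. Beyond 1 it is at most uρ^(-α) while w grows at most
linearly, so the integrand is O(ρ^(1-α)), integrable since α > 2. -/
lemma integrableOn (hw : IsRadialIntensity w) {α u : ℝ} (hα : 2 < α) (hu : 0 ≤ u) :
    IntegrableOn (fun ρ ↦ u / (u + ρ ^ α) * w ρ) (Ioi 0) := by
  obtain ⟨c, hc, hwc⟩ := hw.le_linear
  have hm : Measurable fun ρ : ℝ ↦ u / (u + ρ ^ α) * w ρ :=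
    (((measurable_id.pow_const α).const_add u).const_div u).mul hw.measurable
  rw [← Ioc_union_Ioi_eq_Ioi zero_le_one]
  refine IntegrableOn.union ?_ ?_
  · refine Integrable.mono' ((intervalIntegrable_iff_integrableOn_Ioc_of_le zero_le_one).1
      (hw.intervalIntegrable le_rfl zero_le_one)) hm.aestronglyMeasurable ?_
    rw [ae_restrict_iff' measurableSet_Ioc]
    refine ae_of_all _ fun x hx ↦ ?_
    have h0 := hw.nonneg x hx.1
    have hp : 0 < x ^ α := Real.rpow_pos_of_pos hx.1 _
    rw [Real.norm_of_nonneg (by positivity)]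
    refine mul_le_of_le_one_left h0 ?_
    rw [div_le_one (by positivity)]; linarith
  · refine Integrable.mono' ((integrableOn_Ioi_rpow_of_lt (by linarith : 1 - α < -1) one_pos).const_mul
      (u * c)) hm.aestronglyMeasurable ?_
    rw [ae_restrict_iff' measurableSet_Ioi]
    refine ae_of_all _ fun x hx ↦ ?_
    have hx0 : 0 < x := one_pos.trans hx
    have h0 := hw.nonneg x hx0
    have hp : 0 < x ^ α := Real.rpow_pos_of_pos hx0 _
    rw [Real.norm_of_nonneg (by positivity), Real.rpow_sub hx0, Real.rpow_one]
    calc u / (u + x ^ α) * w x ≤ u / x ^ α * (c * x) := by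
          refine mul_le_mul ?_ (hwc x hx0) h0 (by positivity)
          exact div_le_div_of_nonneg_left hu hp (by linarith)
      _ = u * c * (x / x ^ α) := by ring

end IsRadialIntensity

/-- This writes the exponent as a constant plus a primitive that vanishes at 0, the form required by
`integral_mul_exp_neg_primitive`. -/
lemma integral_add_integral_Ioi {w : ℝ → ℝ} (hw : IsRadialIntensity w) {α u t : ℝ} (hα : 2 < α)
    (hu : 0 ≤ u) (ht : 0 ≤ t) :
    (∫ ρ in (0 : ℝ)..t, w ρ) + ∫ ρ in Ioi t, u / (u + ρ ^ α) * w ρ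
      = (∫ ρ in Ioi 0, u / (u + ρ ^ α) * w ρ) + ∫ ρ in (0 : ℝ)..t, (1 - u / (u + ρ ^ α)) * w ρ := by
  have hI := hw.integrableOn hα hu
  have h1 : IntervalIntegrable (fun ρ ↦ u / (u + ρ ^ α) * w ρ) volume 0 t :=
    (intervalIntegrable_iff_integrableOn_Ioc_of_le ht).2 (hI.mono_set Ioc_subset_Ioi_self)
  rw [← Ioc_union_Ioi_eq_Ioi ht, setIntegral_union (Ioc_disjoint_Ioi le_rfl) measurableSet_Ioi
    (hI.mono_set Ioc_subset_Ioi_self) (hI.mono_set (Ioi_subset_Ioi ht)),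
    ← intervalIntegral.integral_of_le ht]
  simp_rw [sub_mul, one_mul]
  rw [intervalIntegral.integral_sub (hw.intervalIntegrable le_rfl ht) h1]
  ring

/-- The joint law of the distance to the nearest point and of the Laplace weight of all points. -/
lemma IsPoissonSeq.lintegral_comp_mul_expNeg {w : ℝ → ℝ} (hw : IsRadialIntensity w)
    {R : ℕ → Ω → ℝ}
    (h : IsPoissonSeq μ ((volume.restrict (Ioi 0)).withDensity fun r ↦ ENNReal.ofReal (w r)) R)
    (hRmono : ∀ᵐ ω ∂μ, Monotone fun i ↦ R i ω) (hRpos : ∀ᵐ ω ∂μ, ∀ i, 0 < R i ω) {α u : ℝ}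
    (hα : 2 < α) (hu : 0 ≤ u) {F : ℝ → ℝ≥0∞} (hF : Measurable F) :
    ∫⁻ ω, F (R 0 ω) * expNeg (∑' i, ENNReal.ofReal (Real.log (1 + u / R i ω ^ α))) ∂μ
      = ∫⁻ r in Ioi 0, F r * ENNReal.ofReal ((1 - u / (u + r ^ α)) * w r *
          Real.exp (-((∫ ρ in (0 : ℝ)..r, w ρ) + ∫ ρ in Ioi r, u / (u + ρ ^ α) * w ρ))) := by
  set K := ∫ ρ in Ioi 0, u / (u + ρ ^ α) * w ρ with hK
  set v : ℝ → ℝ := fun ρ ↦ (1 - u / (u + ρ ^ α)) * w ρ with hv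
  have hfrac : ∀ ρ : ℝ, 0 < ρ → 0 ≤ u / (u + ρ ^ α) ∧ u / (u + ρ ^ α) ≤ 1 := fun ρ hρ ↦ by
    have hp : 0 < ρ ^ α := Real.rpow_pos_of_pos hρ _
    exact ⟨by positivity, by rw [div_le_one (by positivity)]; linarith⟩
  have hmfrac : Measurable fun ρ : ℝ ↦ u / (u + ρ ^ α) :=
    ((measurable_id.pow_const α).const_add u).const_div u
  have hvm : Measurable v := (hmfrac.const_sub 1).mul hw.measurable
  have hv0 : ∀ ρ, 0 < ρ → 0 ≤ v ρ := fun ρ hρ ↦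
    mul_nonneg (sub_nonneg.2 (hfrac ρ hρ).2) (hw.nonneg ρ hρ)
  have hvint : ∀ t, 0 ≤ t → IntervalIntegrable v volume 0 t := fun t ht ↦ by
    refine (hw.intervalIntegrable le_rfl ht).mono_fun hvm.aestronglyMeasurable ?_
    rw [EventuallyLE, ae_restrict_iff' measurableSet_uIoc]
    refine ae_of_all _ fun x hx ↦ ?_
    have hx0 : 0 < x := by rw [uIoc_of_le ht] at hx; exact hx.1
    rw [Real.norm_of_nonneg (hw.nonneg x hx0), Real.norm_of_nonneg (hv0 x hx0)]
    exact mul_le_of_le_one_left (hw.nonneg x hx0) (by linarith [(hfrac x hx0).1])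
  obtain ⟨s, hs, hcs⟩ := hw.continuousAt
  have hvc : ∀ t, ∀ x ∈ Ioo 0 t \ s, ContinuousAt v x := fun t x hx ↦ by
    have hx0 : x ≠ 0 := hx.1.1.ne'
    have hp : 0 < x ^ α := Real.rpow_pos_of_pos hx.1.1 _
    refine ContinuousAt.mul (continuousAt_const.sub (continuousAt_const.div
      (continuousAt_const.add (Real.continuousAt_rpow_const x α (Or.inl hx0))) (by positivity)))
      (hcs x hx.1.1 hx.2)
  set V : ℝ → ℝ := fun t ↦ ∫ ρ in (0 : ℝ)..t, v ρ with hV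
  set Q : Ω → ℝ≥0∞ := fun ω ↦ expNeg (∑' i, ENNReal.ofReal (Real.log (1 + u / R i ω ^ α))) with hQ
  have hQm : Measurable Q := measurable_expNeg.comp (Measurable.tsum fun i ↦
    (Real.measurable_log.comp ((((h.measurable i).pow_const α).const_div u).const_add 1)).ennreal_ofReal)
  have hexpo : ∀ t, 0 ≤ t → (∫ ρ in (0 : ℝ)..t, w ρ) + ∫ ρ in Ioi t, u / (u + ρ ^ α) * w ρ = K + V t :=
    fun t ht ↦ integral_add_integral_Ioi hw hα hu ht
  -- The tail function of R 0 under the measure weighted by Q; its negative derivative will be the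
  -- density.
  have htail : ∀ t, 0 ≤ t →
      ∫⁻ ω, (Ioi t).indicator 1 (R 0 ω) * Q ω ∂μ = ENNReal.ofReal (Real.exp (-(K + V t))) := by
    intro t ht
    have hInt := (hw.integrableOn hα hu).mono_set (Ioi_subset_Ioi ht)
    have hnn : 0 ≤ ∫ ρ in (0 : ℝ)..t, w ρ := by
      rw [intervalIntegral.integral_of_le ht]
      exact setIntegral_nonneg measurableSet_Ioc fun x hx ↦ hw.nonneg x hx.1
    have hnn' : 0 ≤ ∫ ρ in Ioi t, u / (u + ρ ^ α) * w ρ :=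
      setIntegral_nonneg measurableSet_Ioi fun x hx ↦
        mul_nonneg (hfrac x (ht.trans_lt hx)).1 (hw.nonneg x (ht.trans_lt hx))
    rw [h.lintegral_indicator_mul_expNeg hRmono hu ht, ← hexpo t ht, ← expNeg_ofReal (by positivity),
      ENNReal.ofReal_add hnn hnn']
    congr 2
    · rw [withDensity_apply _ measurableSet_Iic, Measure.restrict_restrict measurableSet_Iic,
        Iic_inter_Ioi, intervalIntegral.integral_of_le ht, ofReal_integral_eq_lintegral_ofReal
        ((intervalIntegrable_iff_integrableOn_Ioc_of_le ht).1 (hw.intervalIntegrable le_rfl ht))]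
      rw [EventuallyLE, ae_restrict_iff' measurableSet_Ioc]
      exact ae_of_all _ fun x hx ↦ hw.nonneg x hx.1
    · rw [restrict_withDensity measurableSet_Ioi, Measure.restrict_restrict measurableSet_Ioi,
        inter_eq_left.2 (Ioi_subset_Ioi ht), lintegral_withDensity_eq_lintegral_mul _
        hw.measurable.ennreal_ofReal hmfrac.ennreal_ofReal, ofReal_integral_eq_lintegral_ofReal hInt]
      · refine setLIntegral_congr_fun measurableSet_Ioi fun x hx ↦ ?_
        rw [Pi.mul_apply, mul_comm, ENNReal.ofReal_mul (hfrac x (ht.trans_lt hx)).1]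
      · rw [EventuallyLE, ae_restrict_iff' measurableSet_Ioi]
        exact ae_of_all _ fun x hx ↦
          mul_nonneg (hfrac x (ht.trans_lt hx)).1 (hw.nonneg x (ht.trans_lt hx))
  -- The left side depends on F only through m. It remains to identify this finite measure, and
  -- half-lines suffice for that.
  let m : Measure ℝ := (μ.withDensity Q).map (R 0)
  let d : ℝ → ℝ≥0∞ := fun r ↦ ENNReal.ofReal (v r * Real.exp (-(K + V r)))
  -- Extended by 0 to the left, V is monotone on the whole line, hence measurable; d' is d with this
  -- extension.
  have hVm : Measurable fun r ↦ if 0 < r then V r else 0 := by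
    have hmon : Monotone fun r ↦ if 0 < r then V r else 0 := by
      intro a b hab
      by_cases ha : 0 < a
      · have hb := ha.trans_le hab
        simp only [if_pos ha, if_pos hb, hV]
        rw [← intervalIntegral.integral_add_adjacent_intervals (hvint a ha.le)
          ((hvint a ha.le).symm.trans (hvint b hb.le))]
        refine le_add_of_nonneg_right ?_
        rw [intervalIntegral.integral_of_le hab]
        exact setIntegral_nonneg measurableSet_Ioc fun x hx ↦ hv0 x (ha.trans hx.1)
      · simp only [if_neg ha]
        split_ifs with hb
        · simp only [hV]
          rw [intervalIntegral.integral_of_le hb.le]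
          exact setIntegral_nonneg measurableSet_Ioc fun x hx ↦ hv0 x hx.1
        · exact le_rfl
    exact hmon.measurable
  let d' : ℝ → ℝ≥0∞ := fun r ↦ ENNReal.ofReal (v r * Real.exp (-(K + if 0 < r then V r else 0)))
  have hdm : Measurable d' := (hvm.mul (Real.measurable_exp.comp (hVm.const_add K).neg)).ennreal_ofReal
  have hdd : ∀ r, 0 < r → d' r = d r := fun r hr ↦ by simp only [d', d, if_pos hr]
  have hm_apply : ∀ A, MeasurableSet A → m A = ∫⁻ ω, A.indicator 1 (R 0 ω) * Q ω ∂μ := fun A hA ↦ by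
    rw [Measure.map_apply (h.measurable 0) hA, withDensity_apply _ (h.measurable 0 hA),
      ← lintegral_indicator (h.measurable 0 hA)]
    refine lintegral_congr fun ω ↦ ?_
    by_cases hω : R 0 ω ∈ A
    · rw [indicator_of_mem (by exact hω), indicator_of_mem hω, Pi.one_apply, one_mul]
    · rw [indicator_of_notMem (by exact hω), indicator_of_notMem hω, zero_mul]
  have : IsFiniteMeasure (μ.withDensity Q) := by
    refine isFiniteMeasure_withDensity ?_
    refine ((lintegral_mono fun ω ↦ expNeg_le_one _).trans_lt ?_).ne
    simp
  have hmd : m = (volume.restrict (Ioi 0)).withDensity d' := by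
    refine Measure.ext_of_Iic m _ fun T ↦ ?_
    have hT' : ((volume.restrict (Ioi 0)).withDensity d') (Iic T) = ∫⁻ r in Ioc 0 T, d r := by
      rw [withDensity_apply _ measurableSet_Iic, Measure.restrict_restrict measurableSet_Iic,
        Iic_inter_Ioi]
      exact setLIntegral_congr_fun measurableSet_Ioc fun x hx ↦ hdd x hx.1
    rw [hT']
    rcases lt_or_ge T 0 with hT | hT
    · rw [Ioc_eq_empty (not_lt.2 hT.le), Measure.restrict_empty, lintegral_zero_measure,
        hm_apply _ measurableSet_Iic]
      refine (lintegral_congr_ae ?_).trans lintegral_zero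
      filter_upwards [hRpos] with ω hω
      rw [indicator_of_notMem (by simpa using hT.trans (hω 0)), zero_mul]
    · have hI := integral_mul_exp_neg_primitive (K := K) hT (hvint T hT) hs (hvc T) hvm
      have h1 : ∫⁻ r in Ioc 0 T, d r = ENNReal.ofReal (Real.exp (-K) - Real.exp (-(K + V T))) := by
        rw [← hI.2, intervalIntegral.integral_of_le hT, ofReal_integral_eq_lintegral_ofReal
          ((intervalIntegrable_iff_integrableOn_Ioc_of_le hT).1 hI.1)]
        rw [EventuallyLE, ae_restrict_iff' measurableSet_Ioc]
        exact ae_of_all _ fun x hx ↦ mul_nonneg (hv0 x hx.1) (Real.exp_nonneg _)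
      -- All points are almost surely positive, so m has no mass on (-∞, 0], and m(Iic T) is a
      -- difference of two known tails.
      have h2 : m (Iic T) + m (Ioi T) = m (Ioi 0) := by
        rw [← compl_Iic, measure_add_measure_compl measurableSet_Iic, hm_apply _ MeasurableSet.univ,
          hm_apply _ measurableSet_Ioi]
        refine lintegral_congr_ae ?_
        filter_upwards [hRpos] with ω hω
        rw [indicator_of_mem (mem_univ _), indicator_of_mem (by exact hω 0)]
      rw [hm_apply _ measurableSet_Ioi, hm_apply _ measurableSet_Ioi, htail T hT, htail 0 le_rfl] at h2
      have hV0 : V 0 = 0 := intervalIntegral.integral_same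
      rw [h1, ENNReal.ofReal_sub _ (Real.exp_nonneg _)]
      rw [hV0, add_zero] at h2
      exact ENNReal.eq_sub_of_add_eq ENNReal.ofReal_ne_top h2
  have hfin : ∫⁻ ω, F (R 0 ω) * Q ω ∂μ = ∫⁻ r, F r ∂m := by
    rw [lintegral_map hF (h.measurable 0), lintegral_withDensity_eq_lintegral_mul _ hQm
      (g := fun ω ↦ F (R 0 ω)) (hF.comp (h.measurable 0))]
    exact lintegral_congr fun ω ↦ mul_comm _ _
  rw [hfin, hmd, lintegral_withDensity_eq_lintegral_mul _ hdm hF]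
  refine setLIntegral_congr_fun measurableSet_Ioi fun r hr ↦ ?_
  rw [Pi.mul_apply, mul_comm, hdd r hr, hexpo r (le_of_lt hr)]

/-- The joint law of the distance to the nearest point and of the shot noise of the others. -/
theorem IsPoissonSeq.lintegral_nearest_mul_interference {w : ℝ → ℝ} (hw : IsRadialIntensity w)
    {R g : ℕ → Ω → ℝ}
    (h : IsPoissonSeq μ ((volume.restrict (Ioi 0)).withDensity fun r ↦ ENNReal.ofReal (w r)) R)
    (hRmono : ∀ᵐ ω ∂μ, Monotone fun i ↦ R i ω) (hRpos : ∀ᵐ ω ∂μ, ∀ i, 0 < R i ω) {α u : ℝ}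
    (hα : 2 < α) (hu : 0 ≤ u) (hg : ∀ i, Measurable (g i)) (hlaw : ∀ i, HasLaw (g i) (expMeasure 1) μ)
    (hind : iIndepFun g μ) (hRg : IndepFun (fun ω i ↦ R i ω) (fun ω i ↦ g i ω) μ)
    {F : ℝ → ℝ≥0∞} (hF : Measurable F) :
    ∫⁻ ω, F (R 0 ω) *
        expNeg (ENNReal.ofReal u * ∑' i, ENNReal.ofReal (g (i + 1) ω / R (i + 1) ω ^ α)) ∂μ
      = ∫⁻ r in Ioi 0, F r * ENNReal.ofReal (w r *
          Real.exp (-((∫ ρ in (0 : ℝ)..r, w ρ) + ∫ ρ in Ioi r, u / (u + ρ ^ α) * w ρ))) := by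
  have hH : Measurable fun r : ℝ ↦ ENNReal.ofReal (1 - u / (u + r ^ α)) :=
    (((measurable_id.pow_const α).const_add u).const_div u |>.const_sub 1).ennreal_ofReal
  have hpos : ∀ r : ℝ, 0 < r → 0 < 1 - u / (u + r ^ α) := fun r hr ↦ by
    have hp : 0 < r ^ α := Real.rpow_pos_of_pos hr _
    rw [sub_pos, div_lt_one (by positivity)]; linarith
  -- The weight of all points contains the factor 1 - u/(u + r^α) of the nearest one. Dividing F by
  -- this positive factor leaves the weight of the others.
  have key := h.lintegral_comp_mul_expNeg hw hRmono hRpos hα hu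
    (F := fun r ↦ F r * (ENNReal.ofReal (1 - u / (u + r ^ α)))⁻¹) (hF.mul hH.inv)
  rw [lintegral_mul_expNeg_interference hu hg hlaw hind h.measurable hRpos hRg hF 1]
  refine Eq.trans ?_ (key.trans ?_)
  · refine lintegral_congr_ae ?_
    filter_upwards [hRpos] with ω hω
    have h0 := hpos _ (hω 0)
    have he : expNeg (ENNReal.ofReal (Real.log (1 + u / R 0 ω ^ α)))
        = ENNReal.ofReal (1 - u / (u + R 0 ω ^ α)) := by
      have h1 := one_sub_expNeg_log (α := α) hu (hω 0)
      have hp : 0 < R 0 ω ^ α := Real.rpow_pos_of_pos (hω 0) _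
      rw [ENNReal.ofReal_sub _ (by positivity), ← h1, ENNReal.ofReal_one,
        ENNReal.sub_sub_cancel ENNReal.one_ne_top (expNeg_le_one _)]
    rw [tsum_eq_zero_add' (f := fun i ↦ ENNReal.ofReal (Real.log (1 + u / R i ω ^ α)))
      ENNReal.summable, expNeg_add, he, mul_assoc, ← mul_assoc _ (ENNReal.ofReal _) (expNeg _),
      ENNReal.inv_mul_cancel (by simpa using h0) ENNReal.ofReal_ne_top, one_mul]
  · refine setLIntegral_congr_fun measurableSet_Ioi fun r hr ↦ ?_
    have h0 := hpos r hr
    simp only [mul_assoc (1 - u / (u + r ^ α))]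
    rw [ENNReal.ofReal_mul h0.le, mul_assoc, ← mul_assoc _ (ENNReal.ofReal _) (ENNReal.ofReal _),
      ENNReal.inv_mul_cancel (by simpa using h0) ENNReal.ofReal_ne_top, one_mul]

end Nearest

/-! ### The distances to the stations outside the disc as a Poisson process on the line -/

/-- The distances from the UE to the ground BSs outside the disc. -/
noncomputable def ueDist {Ω : Type*} (r₀ : ℝ) (y : ℕ → Ω → EuclideanSpace ℝ (Fin 2)) (i : ℕ) (ω : Ω) : ℝ :=
  dist (y i ω) (uePos r₀)

/-- The part of the plane outside the disc whose distance to the UE is in `J`. -/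
def NetParams.shell (p : NetParams) (r₀ : ℝ) (J : Set ℝ) : Set (EuclideanSpace ℝ (Fin 2)) :=
  (fun x ↦ dist x (uePos r₀)) ⁻¹' J ∩ p.discᶜ

/-- The intensity measure of the distances from the UE to the ground BSs outside the disc. -/
noncomputable def NetParams.radialMeasure (p : NetParams) (r₀ : ℝ) : Measure ℝ :=
  ENNReal.ofReal p.lam • (volume.restrict p.discᶜ).map fun x ↦ dist x (uePos r₀)

namespace NetParams

variable (p : NetParams) (r₀ : ℝ)

lemma measurableSet_disc : MeasurableSet p.disc := Metric.isClosed_closedBall.measurableSet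

lemma measurable_dist_uePos : Measurable fun x : EuclideanSpace ℝ (Fin 2) ↦ dist x (uePos r₀) :=
  (continuous_id.dist continuous_const).measurable

lemma measurableSet_shell {J : Set ℝ} (hJ : MeasurableSet J) : MeasurableSet (p.shell r₀ J) :=
  (measurable_dist_uePos r₀ hJ).inter p.measurableSet_disc.compl

lemma isBounded_shell {J : Set ℝ} (hJ : BddAbove J) : Bornology.IsBounded (p.shell r₀ J) := by
  obtain ⟨T, hT⟩ := hJ
  exact (Metric.isBounded_closedBall (x := uePos r₀) (r := T)).subset fun x hx ↦ Metric.mem_closedBall.2 (hT hx.1)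

lemma radialMeasure_apply {J : Set ℝ} (hJ : MeasurableSet J) (hJb : BddAbove J) (hlam : 0 ≤ p.lam) :
    p.radialMeasure r₀ J = ((p.lam * volume.real (p.shell r₀ J)).toNNReal : ℝ≥0∞) := by
  rw [radialMeasure, Measure.smul_apply, Measure.map_apply (measurable_dist_uePos r₀) hJ,
    Measure.restrict_apply (measurable_dist_uePos r₀ hJ), smul_eq_mul]
  change _ = ENNReal.ofReal _
  rw [ENNReal.ofReal_mul hlam, Measure.real, ENNReal.ofReal_toReal
    (p.isBounded_shell r₀ hJb).measure_lt_top.ne]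
  rfl

end NetParams

section Counts

variable {Ω : Type*} [MeasurableSpace Ω] {μ : Measure Ω} {p : NetParams} {r₀ : ℝ}
  {Φ : Ω → Set (EuclideanSpace ℝ (Fin 2))} {y : ℕ → Ω → EuclideanSpace ℝ (Fin 2)}
  {g : ℕ → Ω → ℝ} {g0 : LinkState → Ω → ℝ} {S : Ω → LinkState}

/-- The sequence y enumerates the points outside the disc without repetition. Local finiteness is
essential: `ncard` of an infinite set would be 0. -/
lemma IsNetwork.pointCount_ueDist (h : IsNetwork μ p r₀ Φ y g g0 S) {J : Set ℝ} (hJ : BddAbove J) :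
    ∀ᵐ ω ∂μ, pointCount (ueDist r₀ y) J ω = ((Φ ω ∩ p.shell r₀ J).ncard : ℝ≥0∞) := by
  filter_upwards [h.injective_y, h.range_y, h.isHPPP.locallyFinite] with ω hinj hrange hfin
  set A : Set ℕ := {i | ueDist r₀ y i ω ∈ J} with hA
  have himg : Φ ω ∩ p.shell r₀ J = (fun i ↦ y i ω) '' A := by
    ext x
    constructor
    · rintro ⟨h1, h2, h3⟩
      have : x ∈ Set.range fun i ↦ y i ω := by rw [hrange]; exact ⟨h1, h3⟩
      obtain ⟨i, rfl⟩ := this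
      exact ⟨i, h2, rfl⟩
    · rintro ⟨i, hi, rfl⟩
      have : y i ω ∈ Φ ω \ p.disc := hrange ▸ mem_range_self i
      exact ⟨this.1, hi, this.2⟩
  have hAfin : A.Finite := by
    refine Finite.of_finite_image (f := fun i ↦ y i ω) ?_ hinj.injOn
    rw [← himg]
    exact hfin _ (p.isBounded_shell r₀ hJ)
  rw [himg, ncard_image_of_injective _ hinj, ncard_eq_toFinset_card A hAfin, pointCount,
    tsum_eq_sum (s := hAfin.toFinset)]
  · rw [Finset.cast_card]
    refine Finset.sum_congr rfl fun i hi ↦ ?_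
    have hi' : ueDist r₀ y i ω ∈ J := hAfin.mem_toFinset.1 hi
    rw [indicator_of_mem hi', Pi.one_apply]
  · intro i hi
    have hi' : ueDist r₀ y i ω ∉ J := fun hJ' ↦ hi (hAfin.mem_toFinset.2 hJ')
    exact indicator_of_notMem hi' _

/-- Disjoint sets of distances that are bounded above pull back to disjoint bounded shells of the
plane, where the counts of Φ are independent and Poisson. -/
lemma IsNetwork.isPoissonSeq (h : IsNetwork μ p r₀ Φ y g g0 S) (hlam : 0 ≤ p.lam) :
    IsPoissonSeq μ (p.radialMeasure r₀) (ueDist r₀ y) where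
  measurable i := (NetParams.measurable_dist_uePos r₀).comp (h.measurable_y i)
  laplace_count J hJ hJb c := by
    have hK := h.isHPPP.hasLaw_count _ (p.measurableSet_shell r₀ hJ) (p.isBounded_shell r₀ hJb)
    have hm : Measurable fun n : ℕ ↦ expNeg (c * n) := measurable_of_countable _
    rw [p.radialMeasure_apply r₀ hJ hJb hlam, ← lintegral_expNeg_mul_poissonMeasure, ← hK.map_eq,
      lintegral_map' hm.aemeasurable hK.aemeasurable]
    refine lintegral_congr_ae ?_
    filter_upwards [h.pointCount_ueDist hJb] with ω hω
    rw [hω]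
  indep_count n J hJ hJb hJd := by
    have h1 := h.isHPPP.indep_count n (fun k ↦ p.shell r₀ (J k))
      (fun k ↦ p.measurableSet_shell r₀ (hJ k)) (fun k ↦ p.isBounded_shell r₀ (hJb k))
      (fun k l hkl ↦ ((hJd hkl).preimage _).mono inter_subset_left inter_subset_left)
    refine (h1.comp (fun _ (n : ℕ) ↦ (n : ℝ≥0∞)) fun _ ↦ measurable_of_countable _).congr fun k ↦ ?_
    filter_upwards [h.pointCount_ueDist (hJb k)] with ω hω
    rw [hω]
    rfl

/-- The UE lies in the closed disc and the stations lie outside it. -/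
lemma IsNetwork.ueDist_pos (h : IsNetwork μ p r₀ Φ y g g0 S) (hr0 : 0 ≤ r₀) (hr0Rc : r₀ ≤ p.Rc) :
    ∀ᵐ ω ∂μ, ∀ i, 0 < ueDist r₀ y i ω := by
  filter_upwards [h.range_y] with ω hω i
  have hi : y i ω ∈ Φ ω \ p.disc := hω ▸ mem_range_self i
  refine dist_pos.2 fun heq ↦ hi.2 ?_
  rw [heq, NetParams.disc, Metric.mem_closedBall, dist_zero_right, uePos, EuclideanSpace.norm_eq]
  simp [Real.sqrt_sq hr0, hr0Rc]

end Counts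

/-! ### The radial intensity, by polar coordinates around the UE -/

section Polar

/-- No bound on c is needed: `Real.arccos` is π below -1 and 0 above 1, which keeps the equivalence
true. Circles entirely inside or outside the disc therefore need no separate treatment. -/
lemma lt_cos_iff_lt_arccos {a c : ℝ} (ha0 : 0 ≤ a) (ha : a < Real.pi) :
    c < Real.cos a ↔ a < Real.arccos c := by
  constructor
  · intro h
    rcases lt_or_ge c (-1) with hc | hc
    · rwa [Real.arccos_of_le_neg_one hc.le]
    · rw [← Real.arccos_cos ha0 ha.le]
      exact Real.strictAntiOn_arccos ⟨hc, h.le.trans (Real.cos_le_one a)⟩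
        ⟨Real.neg_one_le_cos a, Real.cos_le_one a⟩ h
  · intro h
    by_contra hc
    have := Real.antitone_arccos (not_lt.1 hc)
    rw [Real.arccos_cos ha0 ha.le] at this
    exact absurd h (not_lt.2 this)

namespace NetParams

variable (p : NetParams) (r₀ : ℝ)

/-- The points outside the disc, in polar coordinates around the UE. -/
def polarExterior : Set (ℝ × ℝ) := {q | p.Rc ^ 2 < q.1 ^ 2 + 2 * q.1 * r₀ * Real.cos q.2 + r₀ ^ 2}

lemma measurableSet_polarExterior : MeasurableSet (p.polarExterior r₀) :=
  measurableSet_lt measurable_const (by fun_prop)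

variable {p r₀}

/-- Completing the square, the defining inequality is s² < (ρ + r₀ cos θ)² with s² = R_c² - r₀² sin²
θ. Since r₀ ≤ R_c, s ≥ |r₀ cos θ|, so ρ + r₀ cos θ > -s and only the comparison with s matters. -/
lemma mem_polarExterior_iff (hr0 : 0 ≤ r₀) (hr0Rc : r₀ ≤ p.Rc) {ρ θ : ℝ} (hρ : 0 < ρ) :
    (ρ, θ) ∈ p.polarExterior r₀ ↔ p.boundaryDist r₀ θ < ρ := by
  have hsc := Real.sin_sq_add_cos_sq θ
  have hR : r₀ ^ 2 ≤ p.Rc ^ 2 := by gcongr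
  have hD : 0 ≤ p.Rc ^ 2 - r₀ ^ 2 * Real.sin θ ^ 2 := by
    nlinarith [mul_nonneg (sq_nonneg r₀) (sq_nonneg (Real.cos θ))]
  have hs := Real.sq_sqrt hD
  have hs0 := Real.sqrt_nonneg (p.Rc ^ 2 - r₀ ^ 2 * Real.sin θ ^ 2)
  have habs : -(r₀ * Real.cos θ) ≤ Real.sqrt (p.Rc ^ 2 - r₀ ^ 2 * Real.sin θ ^ 2) := by
    refine (neg_le_abs _).trans (Real.abs_le_sqrt ?_)
    nlinarith
  simp only [polarExterior, mem_ofPred_eq, boundaryDist]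
  set s := Real.sqrt (p.Rc ^ 2 - r₀ ^ 2 * Real.sin θ ^ 2)
  have hid : ρ ^ 2 + 2 * ρ * r₀ * Real.cos θ + r₀ ^ 2 - p.Rc ^ 2
      = (ρ + r₀ * Real.cos θ) ^ 2 - s ^ 2 := by rw [hs]; linear_combination (-r₀ ^ 2) * hsc
  have habs' : r₀ * Real.cos θ ≤ s := by
    refine (le_abs_self _).trans (Real.abs_le_sqrt ?_)
    nlinarith
  constructor
  · intro h
    by_contra hle
    have h1 : ρ + r₀ * Real.cos θ ≤ s := by linarith
    have h2 : -s ≤ ρ + r₀ * Real.cos θ := by linarith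
    nlinarith
  · intro h
    nlinarith

/-- Translation moves the UE to the origin, and polar coordinates follow. In them, the squared
distance to the centre of the disc is ρ² + 2ρr₀ cos θ + r₀² by the law of cosines. -/
lemma lintegral_exterior {F : ℝ → ℝ≥0∞} (hF : Measurable F) (hRc : 0 ≤ p.Rc) :
    ∫⁻ x in p.discᶜ, F (dist x (uePos r₀))
      = ∫⁻ q in Ioi (0 : ℝ) ×ˢ Ioo (-Real.pi) Real.pi,
          ENNReal.ofReal q.1 * (p.polarExterior r₀).indicator (fun q ↦ F q.1) q := by
  let E : Set (ℝ × ℝ) := {q | p.Rc ^ 2 < q.1 ^ 2 + q.2 ^ 2}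
  have hE : MeasurableSet E := measurableSet_lt measurable_const (by fun_prop)
  let G : ℝ × ℝ → ℝ≥0∞ := E.indicator fun q ↦ F (Real.sqrt ((q.1 - r₀) ^ 2 + q.2 ^ 2))
  have hG : Measurable G := (hF.comp (by fun_prop)).indicator hE
  have hmp : MeasurePreserving (fun x : EuclideanSpace ℝ (Fin 2) ↦ (x 0, x 1)) :=
    (volume_preserving_finTwoArrow ℝ).comp (PiLp.volume_preserving_ofLp (Fin 2))
  have h1 : ∫⁻ x in p.discᶜ, F (dist x (uePos r₀)) = ∫⁻ x : EuclideanSpace ℝ (Fin 2), G (x 0, x 1) := by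
    rw [← lintegral_indicator p.measurableSet_disc.compl]
    refine lintegral_congr fun x ↦ ?_
    have hx : x ∈ p.discᶜ ↔ (x 0, x 1) ∈ E := by
      simp only [NetParams.disc, mem_compl_iff, Metric.mem_closedBall, dist_zero_right, not_le, E,
        mem_ofPred_eq, EuclideanSpace.norm_eq, Fin.sum_univ_two, Real.norm_eq_abs, sq_abs]
      exact Real.lt_sqrt hRc
    have hd : dist x (uePos r₀) = Real.sqrt ((x 0 - r₀) ^ 2 + x 1 ^ 2) := by
      rw [EuclideanSpace.dist_eq]
      simp [uePos, Real.dist_eq, sq_abs]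
    simp only [G]
    by_cases hxE : (x 0, x 1) ∈ E
    · rw [indicator_of_mem (hx.2 hxE), indicator_of_mem hxE, hd]
    · rw [indicator_of_notMem (fun h ↦ hxE (hx.1 h)), indicator_of_notMem hxE]
  rw [h1, hmp.lintegral_comp hG, ← lintegral_add_right_eq_self G (r₀, 0),
    ← lintegral_comp_polarCoord_symm]
  have ht : polarCoord.target = Ioi (0 : ℝ) ×ˢ Ioo (-Real.pi) Real.pi := rfl
  rw [ht]
  refine setLIntegral_congr_fun (measurableSet_Ioi.prod measurableSet_Ioo) fun q hq ↦ ?_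
  have hq0 : 0 < q.1 := hq.1
  simp only [polarCoord_symm_apply, smul_eq_mul, G]
  congr 1
  have hsc := Real.sin_sq_add_cos_sq q.2
  have hid : (q.1 * Real.cos q.2 + r₀) ^ 2 + (q.1 * Real.sin q.2 + 0) ^ 2
      = q.1 ^ 2 + 2 * q.1 * r₀ * Real.cos q.2 + r₀ ^ 2 := by linear_combination (q.1 ^ 2) * hsc
  have hmem : ((q.1 * Real.cos q.2, q.1 * Real.sin q.2) + (r₀, 0) : ℝ × ℝ) ∈ E
      ↔ q ∈ p.polarExterior r₀ := by
    simp only [E, Prod.mk_add_mk, mem_ofPred_eq, hid, polarExterior]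
  by_cases hqE : q ∈ p.polarExterior r₀
  · rw [indicator_of_mem hqE, indicator_of_mem (hmem.2 hqE)]
    congr 1
    rw [Real.sqrt_eq_iff_mul_self_eq_of_pos hq0]
    simp only [Prod.mk_add_mk]
    linear_combination -(q.1 ^ 2) * hsc
  · rw [indicator_of_notMem hqE, indicator_of_notMem (fun h ↦ hqE (hmem.1 h))]

/-- The density of the intensity measure of the distances from the UE to the ground BSs. -/
noncomputable def radialDensity (p : NetParams) (r₀ r : ℝ) : ℝ :=
  if r₀ = 0 then (if r ≤ p.Rc then 0 else 2 * Real.pi * p.lam * r)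
  else p.lam * (2 * r * (Real.pi - p.theta2 r₀ r))

/-- For r₀ > 0 the directions leaving the disc are those with cos θ > c, an arc of half-angle arccos
c = π - θ₂(ρ). For r₀ = 0 the quotient in θ₂ has denominator 0, and the arc is empty or the whole
circle. -/
lemma volume_polarExterior_slice (hRc : 0 < p.Rc) (hr0 : 0 ≤ r₀) (hlam : 0 < p.lam)
    {ρ : ℝ} (hρ : 0 < ρ) :
    ENNReal.ofReal p.lam * (ENNReal.ofReal ρ *
      volume {θ ∈ Ioo (-Real.pi) Real.pi | (ρ, θ) ∈ p.polarExterior r₀})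
      = ENNReal.ofReal (p.radialDensity r₀ ρ) := by
  have hpi := Real.pi_pos
  rcases eq_or_lt_of_le hr0 with h0 | h0
  · subst h0
    by_cases hρR : ρ ≤ p.Rc
    · have : {θ ∈ Ioo (-Real.pi) Real.pi | (ρ, θ) ∈ p.polarExterior 0} = ∅ := by
        refine eq_empty_of_forall_notMem fun θ hθ ↦ ?_
        have := hθ.2
        simp only [polarExterior, mem_ofPred_eq] at this
        nlinarith
      rw [this]
      simp [radialDensity, hρR]
    · have : {θ ∈ Ioo (-Real.pi) Real.pi | (ρ, θ) ∈ p.polarExterior 0} = Ioo (-Real.pi) Real.pi := by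
        refine Subset.antisymm (fun θ hθ ↦ hθ.1) fun θ hθ ↦ ⟨hθ, ?_⟩
        simp only [polarExterior, mem_ofPred_eq]
        nlinarith
      rw [this, Real.volume_Ioo, ← ENNReal.ofReal_mul hρ.le, ← ENNReal.ofReal_mul hlam.le]
      simp only [radialDensity, if_true, if_neg hρR]
      congr 1; ring
  · set c := (p.Rc ^ 2 - r₀ ^ 2 - ρ ^ 2) / (2 * r₀ * ρ) with hc
    have hth : Real.pi - p.theta2 r₀ ρ = Real.arccos c := by
      rw [theta2, ← Real.arccos_neg, hc]
      congr 1; ring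
    have hset : {θ ∈ Ioo (-Real.pi) Real.pi | (ρ, θ) ∈ p.polarExterior r₀}
        = Ioo (-Real.arccos c) (Real.arccos c) := by
      ext θ
      have hmem : (ρ, θ) ∈ p.polarExterior r₀ ↔ c < Real.cos |θ| := by
        rw [Real.cos_abs, hc, div_lt_iff₀ (by positivity)]
        simp only [polarExterior, mem_ofPred_eq]
        constructor <;> intro h <;> linarith
      simp only [mem_ofPred_eq, hmem, mem_Ioo, ← abs_lt]
      constructor
      · rintro ⟨h1, h2⟩
        exact (lt_cos_iff_lt_arccos (abs_nonneg θ) h1).1 h2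
      · intro h
        have h1 := h.trans_le (Real.arccos_le_pi c)
        exact ⟨h1, (lt_cos_iff_lt_arccos (abs_nonneg θ) h1).2 h⟩
    rw [hset, Real.volume_Ioo, ← ENNReal.ofReal_mul hρ.le, ← ENNReal.ofReal_mul hlam.le]
    simp only [radialDensity, if_neg h0.ne', hth]
    congr 1; ring

lemma measurable_radialDensity : Measurable (p.radialDensity r₀) := by
  unfold radialDensity
  split_ifs
  · exact Measurable.ite measurableSet_Iic measurable_const (by fun_prop)
  · unfold theta2
    have : Measurable fun r : ℝ ↦ Real.arccos ((r₀ ^ 2 + r ^ 2 - p.Rc ^ 2) / (2 * r₀ * r)) :=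
      Real.continuous_arccos.measurable.comp (by fun_prop)
    fun_prop

lemma isRadialIntensity (hlam : 0 < p.lam) :
    IsRadialIntensity (p.radialDensity r₀) where
  measurable := measurable_radialDensity
  nonneg x hx := by
    have hpi := Real.pi_pos
    unfold radialDensity
    split_ifs
    · exact le_rfl
    · positivity
    · have : p.theta2 r₀ x ≤ Real.pi := Real.arccos_le_pi _
      exact mul_nonneg hlam.le (mul_nonneg (by positivity) (by linarith))
  le_linear := by
    have hpi := Real.pi_pos
    refine ⟨2 * Real.pi * p.lam, by positivity, fun x hx ↦ ?_⟩
    unfold radialDensity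
    split_ifs
    · positivity
    · exact le_rfl
    · have : 0 ≤ p.theta2 r₀ x := Real.arccos_nonneg _
      nlinarith [mul_nonneg (mul_nonneg hlam.le hx.le) this]
  continuousAt := by
    -- The only discontinuity on (0, ∞) is the jump at R_c in the case r₀ = 0.
    refine ⟨{p.Rc}, countable_singleton _, fun x hx hxs ↦ ?_⟩
    by_cases h0 : r₀ = 0
    · rcases lt_or_gt_of_ne (show x ≠ p.Rc from hxs) with h | h
      · refine (continuousAt_const (y := (0 : ℝ))).congr ?_
        filter_upwards [Iio_mem_nhds h] with z hz
        simp [radialDensity, h0, le_of_lt (show z < p.Rc from hz)]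
      · have hc : ContinuousAt (fun z ↦ 2 * Real.pi * p.lam * z) x := by fun_prop
        refine hc.congr ?_
        filter_upwards [Ioi_mem_nhds h] with z hz
        simp [radialDensity, h0, not_le.2 (show p.Rc < z from hz)]
    · have hd : (2 * r₀ * x) ≠ 0 := by simp [h0, hx.ne']
      have hc : ContinuousAt (fun z ↦ p.lam * (2 * z * (Real.pi - p.theta2 r₀ z))) x := by
        unfold theta2
        refine continuousAt_const.mul (ContinuousAt.mul (by fun_prop) (continuousAt_const.sub ?_))
        exact Real.continuous_arccos.continuousAt.comp
          (ContinuousAt.div (by fun_prop) (by fun_prop) hd)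
      refine hc.congr (Eventually.of_forall fun z ↦ ?_)
      simp [radialDensity, h0]

/-- By Tonelli the angle is integrated first: at a fixed distance the integrand is constant on the
exterior arc. -/
lemma lintegral_exterior_eq_radialDensity (hRc : 0 < p.Rc) (hr0 : 0 ≤ r₀) (hlam : 0 < p.lam)
    {F : ℝ → ℝ≥0∞} (hF : Measurable F) :
    ENNReal.ofReal p.lam * ∫⁻ x in p.discᶜ, F (dist x (uePos r₀))
      = ∫⁻ r in Ioi 0, ENNReal.ofReal (p.radialDensity r₀ r) * F r := by
  have hm : Measurable fun q : ℝ × ℝ ↦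
      ENNReal.ofReal q.1 * (p.polarExterior r₀).indicator (fun q ↦ F q.1) q :=
    measurable_fst.ennreal_ofReal.mul ((hF.comp measurable_fst).indicator
      (p.measurableSet_polarExterior r₀))
  rw [lintegral_exterior hF hRc.le, Measure.volume_eq_prod, ← Measure.prod_restrict,
    lintegral_prod _ hm.aemeasurable, ← lintegral_const_mul _ hm.lintegral_prod_right']
  refine setLIntegral_congr_fun measurableSet_Ioi fun ρ hρ ↦ ?_
  have hsl : MeasurableSet {θ | (ρ, θ) ∈ p.polarExterior r₀} :=
    measurable_prodMk_left (p.measurableSet_polarExterior r₀)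
  have h1 : ∀ θ, ENNReal.ofReal ρ * (p.polarExterior r₀).indicator (fun q ↦ F q.1) (ρ, θ)
      = ({θ | (ρ, θ) ∈ p.polarExterior r₀}).indicator (fun _ ↦ ENNReal.ofReal ρ * F ρ) θ := fun θ ↦ by
    by_cases hq : (ρ, θ) ∈ p.polarExterior r₀
    · rw [indicator_of_mem hq, indicator_of_mem (by exact hq)]
    · rw [indicator_of_notMem hq, indicator_of_notMem (by exact hq), mul_zero]
  simp only [h1]
  rw [lintegral_indicator hsl, lintegral_const, Measure.restrict_apply_univ,
    Measure.restrict_apply hsl, ← volume_polarExterior_slice hRc hr0 hlam hρ]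
  have h2 : {θ | (ρ, θ) ∈ p.polarExterior r₀} ∩ Ioo (-Real.pi) Real.pi
      = {θ ∈ Ioo (-Real.pi) Real.pi | (ρ, θ) ∈ p.polarExterior r₀} := inter_comm _ _
  rw [h2]
  ring

theorem radialMeasure_eq_withDensity (hRc : 0 < p.Rc) (hr0 : 0 ≤ r₀) (hlam : 0 < p.lam) :
    p.radialMeasure r₀
      = (volume.restrict (Ioi 0)).withDensity fun r ↦ ENNReal.ofReal (p.radialDensity r₀ r) := by
  ext J hJ
  have h := lintegral_exterior_eq_radialDensity (p := p) (r₀ := r₀) hRc hr0 hlam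
    (measurable_one.indicator hJ)
  rw [radialMeasure, Measure.smul_apply, smul_eq_mul, withDensity_apply _ hJ,
    ← lintegral_indicator_one hJ, lintegral_map (measurable_one.indicator hJ)
    (measurable_dist_uePos r₀), h, ← lintegral_indicator hJ]
  refine lintegral_congr fun r ↦ ?_
  by_cases hr : r ∈ J <;> simp [hr]

end NetParams

end Polar

/-! ### The density f of the nearest distance: ζ₁ as an arc length and ζ₂ as an area -/

lemma hasDerivAt_arccos_sub_sin_mul_cos {x : ℝ} (h1 : x ≠ -1) (h2 : x ≠ 1) :
    HasDerivAt (fun x ↦ Real.arccos x - Real.sin (Real.arccos x) * Real.cos (Real.arccos x))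
      (-2 * Real.sin (Real.arccos x)) x := by
  have ha := Real.hasDerivAt_arccos h1 h2
  have := ha.sub (ha.sin.mul ha.cos)
  convert! this using 1
  have hsc := Real.sin_sq_add_cos_sq (Real.arccos x)
  rw [← Real.sin_arccos]
  set t := Real.arccos x
  -- With x = cos t, the derivative 2 sin² t in t times dt/dx = -1/sin t is the claim. The case sin
  -- t = 0 is |x| > 1, where `Real.arccos` is locally constant and both sides vanish.
  by_cases hs : Real.sin t = 0
  · simp [hs]
  · field_simp
    linear_combination -hsc

namespace NetParams

variable {p : NetParams} {r₀ : ℝ}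

/-- The two square roots have the same radicand and cancel. What remains is the length of the arc
outside the disc. -/
lemma zeta1_eq (r : ℝ) : p.zeta1 r₀ r = 2 * r * (Real.pi - p.theta2 r₀ r) := by
  have h1 : -((r - r₀ - p.Rc) * (r + r₀ - p.Rc) * (r - r₀ + p.Rc) * (r + r₀ + p.Rc)) / r₀ ^ 2
      = -((-r + r₀ - p.Rc) * (r + r₀ - p.Rc) * (-r + r₀ + p.Rc) * (r + r₀ + p.Rc)) / r₀ ^ 2 := by
    congr 1; ring
  have h2 : (2 * r * r₀ / (r ^ 2 + r₀ ^ 2 - p.Rc ^ 2))⁻¹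
      = (r₀ ^ 2 + r ^ 2 - p.Rc ^ 2) / (2 * r₀ * r) := by
    rw [inv_div]; congr 1 <;> ring
  rw [zeta1, theta2, h1, h2]
  ring

lemma theta2_of_le (hr0 : 0 < r₀) {r : ℝ} (hr : 0 < r) (h : r ≤ p.Rc - r₀) :
    p.theta2 r₀ r = Real.pi := by
  refine Real.arccos_of_le_neg_one ?_
  rw [div_le_iff₀ (by positivity)]
  nlinarith

lemma theta2_of_ge (hr0 : 0 < r₀) (hRc : 0 < p.Rc) {r : ℝ} (h : p.Rc + r₀ ≤ r) :
    p.theta2 r₀ r = 0 := by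
  have hr : 0 < r := by linarith
  refine Real.arccos_of_one_le ?_
  rw [le_div_iff₀ (by positivity)]
  nlinarith

lemma theta1_of_ge (hr0 : 0 < r₀) (hRc : 0 < p.Rc) {r : ℝ} (h : p.Rc + r₀ ≤ r) :
    p.theta1 r₀ r = Real.pi := by
  refine Real.arccos_of_le_neg_one ?_
  rw [div_le_iff₀ (by positivity)]
  nlinarith

lemma zeta2_zero (hr0 : 0 < r₀) (hRc : 0 < p.Rc) : p.zeta2 r₀ 0 = 0 := by
  have : p.theta1 r₀ 0 = 0 := by
    refine Real.arccos_of_one_le ?_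
    rw [le_div_iff₀ (by positivity)]
    nlinarith [sq_nonneg (p.Rc - r₀)]
  simp [zeta2, this]

/-- ζ₂(r) is the area of the part of the ball of radius r around the UE that is outside the disc, so
its derivative is the length of the exterior arc. The two excluded radii are those of tangency,
where the arguments of arccos reach ±1. -/
lemma hasDerivAt_zeta2 (hr0 : 0 < r₀) (hr0Rc : r₀ ≤ p.Rc) {r : ℝ} (hr : 0 < r)
    (h1 : r ≠ p.Rc - r₀) (h2 : r ≠ p.Rc + r₀) :
    HasDerivAt (p.zeta2 r₀) (2 * r * (Real.pi - p.theta2 r₀ r)) r := by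
  have hRc : 0 < p.Rc := hr0.trans_le hr0Rc
  set x1 : ℝ → ℝ := fun r ↦ (p.Rc ^ 2 + r₀ ^ 2 - r ^ 2) / (2 * p.Rc * r₀) with hx1
  set x2 : ℝ → ℝ := fun r ↦ (r₀ ^ 2 + r ^ 2 - p.Rc ^ 2) / (2 * r₀ * r) with hx2
  have hne : (r - (p.Rc - r₀)) * (r + (p.Rc - r₀)) ≠ 0 := by
    refine mul_ne_zero (sub_ne_zero.2 h1) ?_
    have : 0 < r + (p.Rc - r₀) := by linarith
    exact this.ne'
  have hne' : (r - (p.Rc + r₀)) * (r + (p.Rc + r₀)) ≠ 0 :=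
    mul_ne_zero (sub_ne_zero.2 h2) (by positivity)
  have a1 : x1 r ≠ 1 := fun h ↦ hne (by
    rw [hx1] at h; simp only [div_eq_one_iff_eq (show 2 * p.Rc * r₀ ≠ 0 by positivity)] at h; linarith)
  have a2 : x1 r ≠ -1 := fun h ↦ hne' (by
    rw [hx1] at h; simp only [div_eq_iff (show 2 * p.Rc * r₀ ≠ 0 by positivity)] at h; linarith)
  have b1 : x2 r ≠ 1 := fun h ↦ by
    rw [hx2] at h; simp only [div_eq_one_iff_eq (show 2 * r₀ * r ≠ 0 by positivity)] at h
    have : (r - r₀ - p.Rc) * (r - r₀ + p.Rc) = 0 := by linarith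
    rcases mul_eq_zero.1 this with h | h
    · exact h2 (by linarith)
    · have h3 : r₀ - p.Rc = r := by linarith
      linarith
  have b2 : x2 r ≠ -1 := fun h ↦ by
    rw [hx2] at h; simp only [div_eq_iff (show 2 * r₀ * r ≠ 0 by positivity)] at h
    have : (r + r₀ - p.Rc) * (r + r₀ + p.Rc) = 0 := by linarith
    rcases mul_eq_zero.1 this with h | h
    · exact h1 (by linarith)
    · have : 0 < r + r₀ + p.Rc := by positivity
      linarith
  have d1 : HasDerivAt x1 (-r / (p.Rc * r₀)) r := by
    have := (((hasDerivAt_pow 2 r).const_sub (p.Rc ^ 2 + r₀ ^ 2)).div_const (2 * p.Rc * r₀))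
    convert! this using 1
    field_simp
    simp [mul_comm]
  have d2 : HasDerivAt x2 ((2 * r * (2 * r₀ * r) - (r₀ ^ 2 + r ^ 2 - p.Rc ^ 2) * (2 * r₀))
      / (2 * r₀ * r) ^ 2) r := by
    have n1 : HasDerivAt (fun r ↦ r₀ ^ 2 + r ^ 2 - p.Rc ^ 2) (2 * r) r := by
      simpa using ((hasDerivAt_pow 2 r).const_add (r₀ ^ 2)).sub_const (p.Rc ^ 2)
    have n2 : HasDerivAt (fun r ↦ 2 * r₀ * r) (2 * r₀) r := by
      simpa using (hasDerivAt_id r).const_mul (2 * r₀)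
    exact n1.div n2 (by positivity)
  have e1 := (hasDerivAt_arccos_sub_sin_mul_cos a2 a1).comp r d1
  have e2 := (hasDerivAt_arccos_sub_sin_mul_cos b2 b1).comp r d2
  have e3 : HasDerivAt (fun r : ℝ ↦ r ^ 2) (2 * r) r := by simpa using hasDerivAt_pow 2 r
  have key := ((e3.const_mul Real.pi).sub (e1.const_mul (p.Rc ^ 2))).sub (e3.mul e2)
  have hfun : p.zeta2 r₀ = fun r ↦ Real.pi * r ^ 2 - p.Rc ^ 2 * ((fun x ↦ Real.arccos x -
      Real.sin (Real.arccos x) * Real.cos (Real.arccos x)) ∘ x1) r - r ^ 2 * ((fun x ↦ Real.arccos x -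
      Real.sin (Real.arccos x) * Real.cos (Real.arccos x)) ∘ x2) r := by
    funext r
    simp only [zeta2, theta1, theta2, Function.comp, hx1, hx2]
    ring
  rw [hfun]
  convert! key using 1
  simp only [Function.comp, theta2]
  change _ = Real.pi * (2 * r) - p.Rc ^ 2 * (-2 * Real.sin (Real.arccos (x1 r)) * (-r / (p.Rc * r₀))) -
    (2 * r * (Real.arccos (x2 r) - Real.sin (Real.arccos (x2 r)) * Real.cos (Real.arccos (x2 r))) +
      r ^ 2 * (-2 * Real.sin (Real.arccos (x2 r)) * ((2 * r * (2 * r₀ * r) -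
        (r₀ ^ 2 + r ^ 2 - p.Rc ^ 2) * (2 * r₀)) / (2 * r₀ * r) ^ 2)))
  change 2 * r * (Real.pi - Real.arccos (x2 r)) = _
  -- Outside [-1, 1] the cosine of `Real.arccos` is not its argument, but there the sine vanishes.
  have hsc : Real.sin (Real.arccos (x2 r)) * Real.cos (Real.arccos (x2 r))
      = Real.sin (Real.arccos (x2 r)) * x2 r := by
    by_cases hle : x2 r < -1
    · simp [Real.arccos_of_le_neg_one hle.le]
    by_cases hge : 1 < x2 r
    · simp [Real.arccos_of_one_le hge.le]
    rw [Real.cos_arccos (not_lt.1 hle) (not_lt.1 hge)]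
  -- Both sides are half the common chord of the two circles, or 0 if the circles do not meet. This
  -- identity cancels the contributions of the moving angles.
  have hsine : p.Rc * Real.sin (Real.arccos (x1 r)) = r * Real.sin (Real.arccos (x2 r)) := by
    have aux : ∀ a b : ℝ, 0 ≤ a → a * Real.sqrt b = Real.sqrt (a ^ 2 * b) := fun a b ha ↦ by
      rw [Real.sqrt_mul (sq_nonneg _), Real.sqrt_sq ha]
    rw [Real.sin_arccos, Real.sin_arccos, aux _ _ hRc.le, aux _ _ hr.le]
    congr 1
    simp only [hx1, hx2]
    field_simp
    ring
  rw [hsc]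
  have hx2r : x2 r * (2 * r₀ * r) = r₀ ^ 2 + r ^ 2 - p.Rc ^ 2 := by
    simp only [hx2]; field_simp
  rw [← hx2r]
  generalize Real.sin (Real.arccos (x1 r)) = s1 at *
  generalize Real.sin (Real.arccos (x2 r)) = s2 at *
  have hx2' : 2 * r₀ * r * x2 r = r₀ ^ 2 + r ^ 2 - p.Rc ^ 2 := by linarith
  field_simp
  linear_combination hsine

lemma continuousOn_zeta2 (hr0 : 0 < r₀) {T : ℝ} : ContinuousOn (p.zeta2 r₀) (Icc 0 T) := by
  intro r hr
  refine ContinuousAt.continuousWithinAt ?_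
  have h1 : Continuous (p.theta1 r₀) := by
    unfold theta1
    exact Real.continuous_arccos.comp (by fun_prop)
  have hA : ContinuousAt (fun r ↦ Real.pi * r ^ 2 - p.theta1 r₀ r * p.Rc ^ 2
    + p.Rc ^ 2 * Real.sin (p.theta1 r₀ r) * Real.cos (p.theta1 r₀ r)) r :=
    Continuous.continuousAt (by fun_prop)
  have hB : ContinuousAt (fun r ↦ r ^ 2 * (Real.sin (p.theta2 r₀ r) * Real.cos (p.theta2 r₀ r)
      - p.theta2 r₀ r)) r := by
    rcases eq_or_lt_of_le hr.1 with h0 | h0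
    -- At r = 0 the quotient in θ₂ has denominator 0 and θ₂ need not be continuous; the prefactor r²
    -- and the boundedness of the rest suffice.
    · rw [← h0, ContinuousAt]
      have : Tendsto (fun r : ℝ ↦ r ^ 2 * (1 + Real.pi)) (𝓝 0) (𝓝 0) := by
        have hc : Continuous fun r : ℝ ↦ r ^ 2 * (1 + Real.pi) := by fun_prop
        simpa using hc.tendsto 0
      rw [show (0 : ℝ) ^ 2 * (Real.sin (p.theta2 r₀ 0) * Real.cos (p.theta2 r₀ 0)
        - p.theta2 r₀ 0) = 0 by ring]
      refine squeeze_zero_norm (fun r ↦ ?_) this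
      rw [norm_mul, Real.norm_of_nonneg (sq_nonneg r)]
      refine mul_le_mul_of_nonneg_left ?_ (sq_nonneg r)
      refine (norm_sub_le _ _).trans (add_le_add ?_ ?_)
      · rw [norm_mul]
        exact mul_le_one₀ (Real.abs_sin_le_one _) (norm_nonneg _) (Real.abs_cos_le_one _)
      · rw [Real.norm_of_nonneg (show 0 ≤ p.theta2 r₀ r from Real.arccos_nonneg _)]
        exact Real.arccos_le_pi _
    · have h2 : ContinuousAt (p.theta2 r₀) r := by
        unfold theta2
        exact Real.continuous_arccos.continuousAt.comp
          (ContinuousAt.div (by fun_prop) (by fun_prop) (by positivity))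
      fun_prop
  refine (hA.add hB).congr (Eventually.of_forall fun r ↦ ?_)
  simp only [zeta2, Pi.add_apply]
  ring

lemma integral_radialDensity (hr0 : 0 < r₀) (hr0Rc : r₀ ≤ p.Rc) (hlam : 0 < p.lam) {r : ℝ}
    (hr : 0 ≤ r) : ∫ ρ in (0 : ℝ)..r, p.radialDensity r₀ ρ = p.lam * p.zeta2 r₀ r := by
  rw [integral_eq_of_hasDerivAt_off_countable_of_le (fun ρ ↦ p.lam * p.zeta2 r₀ ρ) _ hr
    (s := {p.Rc - r₀, p.Rc + r₀}) (by simp) (continuousOn_const.mul (continuousOn_zeta2 hr0)) ?_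
    ((isRadialIntensity hlam).intervalIntegrable le_rfl hr)]
  · simp [zeta2_zero hr0 (hr0.trans_le hr0Rc)]
  · intro x hx
    have hxs := hx.2
    simp only [mem_insert_iff, mem_singleton_iff, not_or] at hxs
    simp only [radialDensity, if_neg hr0.ne']
    exact (hasDerivAt_zeta2 hr0 hr0Rc hx.1.1 hxs.1 hxs.2).const_mul _

lemma integral_radialDensity_zero (hRc : 0 < p.Rc) (hlam : 0 < p.lam) {r : ℝ} (hr : p.Rc ≤ r) :
    ∫ ρ in (0 : ℝ)..r, p.radialDensity 0 ρ = p.lam * (Real.pi * r ^ 2 - Real.pi * p.Rc ^ 2) := by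
  have hI := isRadialIntensity (p := p) (r₀ := 0) hlam
  have hr' : 0 ≤ r := hRc.le.trans hr
  rw [← intervalIntegral.integral_add_adjacent_intervals (hI.intervalIntegrable le_rfl hRc.le)
    (hI.intervalIntegrable hRc.le hr')]
  have h1 : ∫ ρ in (0 : ℝ)..p.Rc, p.radialDensity 0 ρ = 0 := by
    rw [intervalIntegral.integral_of_le hRc.le,
      setIntegral_congr_fun measurableSet_Ioc (g := fun _ ↦ (0 : ℝ))]
    · simp
    · intro x hx
      simp [radialDensity, hx.2]
  have h2 : ∫ ρ in p.Rc..r, p.radialDensity 0 ρ = ∫ ρ in p.Rc..r, 2 * Real.pi * p.lam * ρ := by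
    rw [intervalIntegral.integral_of_le hr, intervalIntegral.integral_of_le hr]
    refine setIntegral_congr_fun measurableSet_Ioc fun x hx ↦ ?_
    simp [radialDensity, not_le.2 hx.1]
  rw [h1, h2, intervalIntegral.integral_const_mul, integral_id]
  ring

/-- The density `f` in terms of the radial intensity. -/
theorem pdf_eq (hr0 : 0 ≤ r₀) (hr0Rc : r₀ ≤ p.Rc) (hRc : 0 < p.Rc) (hlam : 0 < p.lam) {r : ℝ}
    (hr : 0 < r) :
    p.pdf r₀ r = p.radialDensity r₀ r * Real.exp (-∫ ρ in (0 : ℝ)..r, p.radialDensity r₀ ρ) := by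
  rcases eq_or_lt_of_le hr0 with h0 | h0
  · subst h0
    rw [pdf]
    by_cases h : r ≤ p.Rc
    · simp [h, radialDensity]
    · rw [if_neg (by simpa using h), if_neg (by simpa using (not_le.1 h).le),
        integral_radialDensity_zero hRc hlam (not_le.1 h).le]
      simp only [radialDensity, if_true, if_neg h]
      congr 2; ring
  · rw [integral_radialDensity h0 hr0Rc hlam hr.le, radialDensity, if_neg h0.ne', pdf]
    split_ifs with h1 h2
    · rw [theta2_of_le h0 hr h1]; simp
    · rw [zeta1_eq]; congr 2; ring
    · rw [not_lt] at h2
      rw [theta2_of_ge h0 hRc h2, zeta2, theta1_of_ge h0 hRc h2, theta2_of_ge h0 hRc h2]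
      simp only [Real.sin_pi, Real.sin_zero]
      have : p.lam * (2 * r * (Real.pi - 0)) = 2 * Real.pi * p.lam * r := by ring
      rw [this]
      congr 2; ring

end NetParams

/-! ### The exponent η: the kernel integrated over each direction -/

lemma isRadialIntensity_id : IsRadialIntensity fun x ↦ x where
  measurable := measurable_id
  nonneg _ hx := hx.le
  le_linear := ⟨1, zero_le_one, fun x _ ↦ (one_mul x).ge⟩
  continuousAt := ⟨∅, countable_empty, fun _ _ _ ↦ continuousAt_id⟩

/-- The interference kernel integrated over the distances beyond `ρ` in one direction. -/
noncomputable def kernelTail (α u ρ : ℝ) : ℝ := ∫ t in Ioi ρ, u / (u + t ^ α) * t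

section KernelTail

variable {α u : ℝ}

/-- The range of the substitution z = t^α/(t^α + u), which is increasing with inverse t = (uz/(1 -
z))^(1/α). -/
lemma image_rpow_div_Ioi (hα : 0 < α) (hu : 0 < u) {ρ : ℝ} (hρ : 0 < ρ) :
    (fun t : ℝ ↦ t ^ α / (t ^ α + u)) '' Ioi ρ = Ioo (1 / (1 + u * ρ ^ (-α))) 1 := by
  have hρα : 0 < ρ ^ α := Real.rpow_pos_of_pos hρ _
  have hx : 1 / (1 + u * ρ ^ (-α)) = ρ ^ α / (ρ ^ α + u) := by
    rw [Real.rpow_neg hρ.le]; field_simp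
  rw [hx]
  ext z
  constructor
  · rintro ⟨t, ht, rfl⟩
    have ht0 : 0 < t := hρ.trans ht
    have hlt : ρ ^ α < t ^ α := Real.rpow_lt_rpow hρ.le ht hα
    constructor
    · simp only
      rw [div_lt_div_iff₀ (by positivity) (by positivity)]
      nlinarith
    · simp only
      rw [div_lt_one (by positivity)]
      linarith
  · rintro ⟨h1, h2⟩
    have hz0 : 0 < z := lt_trans (by positivity) h1
    have h1z : 0 < 1 - z := by linarith
    have hb : 0 < u * z / (1 - z) := by positivity
    refine ⟨(u * z / (1 - z)) ^ (1 / α), ?_, ?_⟩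
    · have : ρ ^ α < u * z / (1 - z) := by
        rw [lt_div_iff₀ h1z]
        rw [div_lt_iff₀ (by positivity)] at h1
        linarith
      have h3 := Real.rpow_lt_rpow hρα.le this (by positivity : 0 < 1 / α)
      rwa [← Real.rpow_mul hρ.le, mul_one_div_cancel hα.ne', Real.rpow_one] at h3
    · simp only
      rw [← Real.rpow_mul hb.le, one_div_mul_cancel hα.ne', Real.rpow_one]
      field_simp
      ring

/-- The integral of the interference kernel is an upper incomplete beta function. -/
lemma kernelTail_eq (hα : 0 < α) (hu : 0 < u) {ρ : ℝ} (hρ : 0 < ρ) :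
    kernelTail α u ρ = u ^ (2 / α) / α * NetParams.upperBeta (1 / (1 + u * ρ ^ (-α))) (2 / α) (1 - 2 / α) := by
  have hle : 1 / (1 + u * ρ ^ (-α)) ≤ 1 := by
    have : 0 < ρ ^ (-α) := Real.rpow_pos_of_pos hρ _
    rw [div_le_one (by positivity)]
    nlinarith
  have hderiv : ∀ t ∈ Ioi ρ, HasDerivWithinAt (fun t : ℝ ↦ t ^ α / (t ^ α + u))
      (α * t ^ (α - 1) * u / (t ^ α + u) ^ 2) (Ioi ρ) t := fun t ht ↦ by
    have ht0 : 0 < t := hρ.trans ht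
    have htα : 0 < t ^ α := Real.rpow_pos_of_pos ht0 _
    have h1 := Real.hasDerivAt_rpow_const (p := α) (Or.inl ht0.ne')
    have h2 := h1.div (h1.add_const u) (by positivity)
    refine HasDerivAt.hasDerivWithinAt ?_
    convert! h2 using 1
    ring
  have hinj : InjOn (fun t : ℝ ↦ t ^ α / (t ^ α + u)) (Ioi ρ) := by
    intro a ha b hb hab
    have ha0 : 0 < a := hρ.trans ha
    have hb0 : 0 < b := hρ.trans hb
    have haα : 0 < a ^ α := Real.rpow_pos_of_pos ha0 _
    have hbα : 0 < b ^ α := Real.rpow_pos_of_pos hb0 _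
    simp only at hab
    rw [div_eq_div_iff (by positivity) (by positivity)] at hab
    have : a ^ α = b ^ α := by
      have : u * a ^ α = u * b ^ α := by linarith
      exact mul_left_cancel₀ hu.ne' this
    exact (Real.rpow_left_inj ha0.le hb0.le hα.ne').1 this
  rw [NetParams.upperBeta, intervalIntegral.integral_of_le hle, integral_Ioc_eq_integral_Ioo,
    ← image_rpow_div_Ioi hα hu hρ, integral_image_eq_integral_abs_deriv_smul measurableSet_Ioi hderiv hinj,
    kernelTail, ← integral_const_mul]
  refine setIntegral_congr_fun measurableSet_Ioi fun t ht ↦ ?_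
  have ht0 : 0 < t := hρ.trans ht
  have htα : 0 < t ^ α := Real.rpow_pos_of_pos ht0 _
  have hD : 0 < t ^ α + u := by positivity
  -- With D = t^α + u, the beta integrand times the Jacobian αt^(α-1)u/D² has total exponent -1 in
  -- D, and equals αu^(1-2/α) t/D.
  have h1 : 1 - t ^ α / (t ^ α + u) = u / (t ^ α + u) := by field_simp; ring
  simp only [smul_eq_mul]
  rw [h1, abs_of_pos (by positivity), Real.div_rpow htα.le hD.le, Real.div_rpow hu.le hD.le,
    ← Real.rpow_mul ht0.le, show (1 - 2 / α - 1 : ℝ) = -(2 / α) by ring, Real.rpow_neg hu.le,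
    Real.rpow_neg hD.le, Real.rpow_sub hD, Real.rpow_one, mul_sub, mul_div_cancel₀ _ hα.ne', mul_one,
    Real.rpow_sub ht0, Real.rpow_sub ht0, Real.rpow_one, Real.rpow_two]
  have hu' : 0 < u ^ (2 / α) := Real.rpow_pos_of_pos hu _
  have hD' : 0 < (t ^ α + u) ^ (2 / α) := Real.rpow_pos_of_pos hD _
  field_simp
  ring

lemma integrableOn_kernel (hα : 2 < α) (hu : 0 ≤ u) {ρ : ℝ} (hρ : 0 ≤ ρ) :
    IntegrableOn (fun t ↦ u / (u + t ^ α) * t) (Ioi ρ) :=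
  (isRadialIntensity_id.integrableOn hα hu).mono_set (Ioi_subset_Ioi hρ)

lemma kernel_nonneg (hu : 0 ≤ u) {t : ℝ} (ht : 0 < t) : 0 ≤ u / (u + t ^ α) * t := by
  have : 0 < t ^ α := Real.rpow_pos_of_pos ht _
  positivity

lemma kernelTail_nonneg (hu : 0 ≤ u) {ρ : ℝ} (hρ : 0 ≤ ρ) : 0 ≤ kernelTail α u ρ :=
  setIntegral_nonneg measurableSet_Ioi fun _ ht ↦ kernel_nonneg hu (hρ.trans_lt ht)

lemma kernelTail_le (hα : 2 < α) (hu : 0 ≤ u) {a b : ℝ} (ha : 0 ≤ a) (hab : a ≤ b) :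
    kernelTail α u b ≤ kernelTail α u a :=
  setIntegral_mono_set (integrableOn_kernel hα hu ha)
    ((ae_restrict_iff' measurableSet_Ioi).2 (ae_of_all _ fun _ ht ↦ kernel_nonneg hu (ha.trans_lt ht)))
    (Ioi_subset_Ioi hab).eventuallyLE

lemma ofReal_kernelTail (hα : 2 < α) (hu : 0 ≤ u) {ρ : ℝ} (hρ : 0 ≤ ρ) :
    ENNReal.ofReal (kernelTail α u ρ) = ∫⁻ t in Ioi ρ, ENNReal.ofReal (u / (u + t ^ α) * t) :=
  ofReal_integral_eq_lintegral_ofReal (integrableOn_kernel hα hu hρ)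
    ((ae_restrict_iff' measurableSet_Ioi).2 (ae_of_all _ fun _ ht ↦ kernel_nonneg hu (hρ.trans_lt ht)))

end KernelTail

namespace NetParams

variable {p : NetParams} {r₀ : ℝ}

/-- Both sides say that the point at distance r in direction θ from the UE is outside the disc. -/
lemma boundaryDist_lt_iff (hr0 : 0 < r₀) (hr0Rc : r₀ ≤ p.Rc) {r θ : ℝ} (hr : 0 < r) (hθ0 : 0 ≤ θ)
    (hθ : θ < Real.pi) : p.boundaryDist r₀ θ < r ↔ θ < Real.pi - p.theta2 r₀ r := by
  rw [← mem_polarExterior_iff hr0.le hr0Rc hr, theta2, ← Real.arccos_neg, ← lt_cos_iff_lt_arccos hθ0 hθ,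
    ← neg_div, div_lt_iff₀ (by positivity)]
  simp only [polarExterior, mem_ofPred_eq]
  constructor <;> intro h <;> linarith

lemma continuous_boundaryDist : Continuous (p.boundaryDist r₀) := by
  unfold boundaryDist
  fun_prop

lemma integrable_kernelTail_boundaryDist {r α u : ℝ} (hr : 0 ≤ r) (hα : 2 < α) (hu : 0 ≤ u) (a b : ℝ) :
    IntervalIntegrable (fun θ ↦ kernelTail α u (max r (p.boundaryDist r₀ θ))) volume a b := by
  have hm : Measurable fun x ↦ kernelTail α u (max r x) := by
    have : Antitone fun x ↦ kernelTail α u (max r x) := fun x y hxy ↦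
      kernelTail_le hα hu (hr.trans (le_max_left _ _)) (max_le_max_left r hxy)
    exact this.measurable
  refine (intervalIntegrable_const (c := kernelTail α u 0)).mono_fun
    (hm.comp continuous_boundaryDist.measurable).aestronglyMeasurable (ae_of_all _ fun θ ↦ ?_)
  have h0 : 0 ≤ max r (p.boundaryDist r₀ θ) := hr.trans (le_max_left _ _)
  simp only
  rw [Real.norm_of_nonneg (kernelTail_nonneg hu h0), Real.norm_of_nonneg (kernelTail_nonneg hu le_rfl)]
  exact kernelTail_le hα hu le_rfl h0

/-- The exponent of the Laplace transform as an integral over the directions. -/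
lemma integral_kernel_mul_radialDensity (hRc : 0 < p.Rc) (hr0 : 0 ≤ r₀) (hr0Rc : r₀ ≤ p.Rc)
    (hlam : 0 < p.lam) {r α u : ℝ} (hr : 0 ≤ r) (hα : 2 < α) (hu : 0 ≤ u) :
    ∫ ρ in Ioi r, u / (u + ρ ^ α) * p.radialDensity r₀ ρ
      = 2 * p.lam * ∫ θ in (0 : ℝ)..Real.pi, kernelTail α u (max r (p.boundaryDist r₀ θ)) := by
  have hpi := Real.pi_pos
  have hI := isRadialIntensity (p := p) (r₀ := r₀) hlam
  have hfrac : ∀ ρ : ℝ, 0 < ρ → 0 ≤ u / (u + ρ ^ α) := fun ρ hρ ↦ by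
    have hp : 0 < ρ ^ α := Real.rpow_pos_of_pos hρ _
    positivity
  have hmfrac : Measurable fun ρ : ℝ ↦ ENNReal.ofReal (u / (u + ρ ^ α)) :=
    (((measurable_id.pow_const α).const_add u).const_div u).ennreal_ofReal
  -- The boundary distance z is even in θ, by symmetry about the axis through the UE.
  have hsymm : ∫ θ in (-Real.pi)..Real.pi, kernelTail α u (max r (p.boundaryDist r₀ θ))
      = 2 * ∫ θ in (0 : ℝ)..Real.pi, kernelTail α u (max r (p.boundaryDist r₀ θ)) := by
    rw [← intervalIntegral.integral_add_adjacent_intervals (b := 0)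
      (integrable_kernelTail_boundaryDist hr hα hu _ _) (integrable_kernelTail_boundaryDist hr hα hu _ _),
      two_mul]
    congr 1
    have := intervalIntegral.integral_comp_neg (a := 0) (b := Real.pi)
      (fun θ ↦ kernelTail α u (max r (p.boundaryDist r₀ θ)))
    rw [neg_zero] at this
    rw [← this]
    simp [boundaryDist]
  have hnn : 0 ≤ ∫ θ in (-Real.pi)..Real.pi, kernelTail α u (max r (p.boundaryDist r₀ θ)) :=
    intervalIntegral.integral_nonneg (by linarith) fun θ _ ↦
      kernelTail_nonneg hu (hr.trans (le_max_left _ _))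
  have hL : 0 ≤ ∫ ρ in Ioi r, u / (u + ρ ^ α) * p.radialDensity r₀ ρ :=
    setIntegral_nonneg measurableSet_Ioi fun x hx ↦
      mul_nonneg (hfrac x (hr.trans_lt hx)) (hI.nonneg x (hr.trans_lt hx))
  rw [show 2 * p.lam * ∫ θ in (0 : ℝ)..Real.pi, kernelTail α u (max r (p.boundaryDist r₀ θ))
    = p.lam * ∫ θ in (-Real.pi)..Real.pi, kernelTail α u (max r (p.boundaryDist r₀ θ)) by
    rw [hsymm]; ring]
  -- Both sides are nonnegative, so they can be compared in [0, ∞], where Tonelli needs no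
  -- integrability.
  rw [← ENNReal.ofReal_eq_ofReal_iff hL (mul_nonneg hlam.le hnn), ENNReal.ofReal_mul hlam.le]
  have h1 : ENNReal.ofReal (∫ ρ in Ioi r, u / (u + ρ ^ α) * p.radialDensity r₀ ρ)
      = ∫⁻ ρ in Ioi 0, ENNReal.ofReal (p.radialDensity r₀ ρ) *
        (Ioi r).indicator (fun ρ ↦ ENNReal.ofReal (u / (u + ρ ^ α))) ρ := by
    rw [ofReal_integral_eq_lintegral_ofReal ((hI.integrableOn hα hu).mono_set (Ioi_subset_Ioi hr))
      ((ae_restrict_iff' measurableSet_Ioi).2 (ae_of_all _ fun x hx ↦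
        mul_nonneg (hfrac x (hr.trans_lt hx)) (hI.nonneg x (hr.trans_lt hx)))),
      ← lintegral_indicator measurableSet_Ioi, ← lintegral_indicator measurableSet_Ioi]
    refine lintegral_congr fun x ↦ ?_
    by_cases hx : r < x
    · have hx0 : 0 < x := hr.trans_lt hx
      rw [indicator_of_mem (by exact hx), indicator_of_mem (by exact hx0), indicator_of_mem (by exact hx),
        ENNReal.ofReal_mul (hfrac x hx0), mul_comm]
    · rw [indicator_of_notMem (show x ∉ Ioi r from hx)]
      by_cases hx0 : 0 < x
      · rw [indicator_of_mem (by exact hx0), indicator_of_notMem (by exact hx), mul_zero]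
      · rw [indicator_of_notMem (by exact hx0)]
  -- Back to an integral over the plane, now to be integrated along each direction first. The
  -- conditions ρ > r and ρ > z(θ) combine into ρ > max(r, z(θ)).
  rw [h1, ← lintegral_exterior_eq_radialDensity hRc hr0 hlam (hmfrac.indicator measurableSet_Ioi)]
  congr 1
  have hm : Measurable fun q : ℝ × ℝ ↦ ENNReal.ofReal q.1 * (p.polarExterior r₀).indicator
      (fun q ↦ (Ioi r).indicator (fun ρ ↦ ENNReal.ofReal (u / (u + ρ ^ α))) q.1) q :=
    measurable_fst.ennreal_ofReal.mul (((hmfrac.indicator measurableSet_Ioi).comp measurable_fst).indicator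
      (p.measurableSet_polarExterior r₀))
  rw [lintegral_exterior (hmfrac.indicator measurableSet_Ioi) hRc.le, Measure.volume_eq_prod,
    ← Measure.prod_restrict, lintegral_prod_symm _ hm.aemeasurable,
    intervalIntegral.integral_of_le (by linarith), ofReal_integral_eq_lintegral_ofReal
    ((intervalIntegrable_iff_integrableOn_Ioc_of_le (by linarith)).1
      (integrable_kernelTail_boundaryDist hr hα hu _ _))
    (ae_of_all _ fun θ ↦ kernelTail_nonneg hu (hr.trans (le_max_left _ _))),
    ← restrict_Ioo_eq_restrict_Ioc]
  refine lintegral_congr fun θ ↦ ?_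
  rw [ofReal_kernelTail hα hu (hr.trans (le_max_left _ _)), ← lintegral_indicator measurableSet_Ioi,
    ← lintegral_indicator measurableSet_Ioi]
  refine lintegral_congr fun ρ ↦ ?_
  by_cases hρ0 : 0 < ρ
  · rw [indicator_of_mem (by exact hρ0)]
    by_cases h1 : r < ρ
    · by_cases h2 : p.boundaryDist r₀ θ < ρ
      · rw [indicator_of_mem ((mem_polarExterior_iff hr0 hr0Rc hρ0).2 h2), indicator_of_mem (by exact h1),
          indicator_of_mem (show ρ ∈ Ioi _ from max_lt h1 h2), ENNReal.ofReal_mul (hfrac ρ hρ0), mul_comm]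
      · rw [indicator_of_notMem (fun h ↦ h2 ((mem_polarExterior_iff hr0 hr0Rc hρ0).1 h)), mul_zero,
          indicator_of_notMem (show ρ ∉ Ioi _ from fun h ↦ h2 ((le_max_right _ _).trans_lt h))]
    · rw [indicator_of_notMem (show ρ ∉ Ioi (max r _) from fun h ↦ h1 ((le_max_left _ _).trans_lt h))]
      refine mul_eq_zero.2 (Or.inr ?_)
      rw [indicator_apply_eq_zero]
      exact fun _ ↦ indicator_of_notMem (by exact h1) _
  · rw [indicator_of_notMem (by exact hρ0), indicator_of_notMem (show ρ ∉ Ioi (max r _) from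
      fun h ↦ hρ0 (hr.trans_lt ((le_max_left _ _).trans_lt h)))]

/-- The exponent `η` is the exponent of the Laplace functional of the points beyond `r`. -/
theorem eta_eq (hRc : 0 < p.Rc) (hr0 : 0 ≤ r₀) (hr0Rc : r₀ ≤ p.Rc) (hlam : 0 < p.lam)
    (hα : 2 < p.alphaN) {r u : ℝ} (hr : 0 < r) (hrR : p.Rc - r₀ < r) (hu : 0 < u) :
    p.eta r₀ r u = -∫ ρ in Ioi r, u / (u + ρ ^ p.alphaN) * p.radialDensity r₀ ρ := by
  have hpi := Real.pi_pos
  have hα0 : 0 < p.alphaN := by linarith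
  rw [integral_kernel_mul_radialDensity hRc hr0 hr0Rc hlam hr.le hα hu.le, eta]
  rcases eq_or_lt_of_le hr0 with h0 | h0
  · subst h0
    -- At the centre z(θ) = R_c < r, and only the second formula for η occurs.
    have h1 : ∀ θ, max r (p.boundaryDist 0 θ) = r := fun θ ↦ by
      refine max_eq_left ?_
      simp only [boundaryDist]
      simp only [ne_eq, OfNat.ofNat_ne_zero, not_false_eq_true, zero_pow, zero_mul, sub_zero,
        Real.sqrt_sq hRc.le]
      simpa using hrR.le
    simp only [h1, if_neg (not_lt.2 (show p.Rc + 0 ≤ r by linarith)), kernelTail_eq hα0 hu hr,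
      intervalIntegral.integral_const, smul_eq_mul]
    ring
  · have hΘ0 : 0 ≤ p.theta2 r₀ r := Real.arccos_nonneg _
    have hΘ : p.theta2 r₀ r ≤ Real.pi := Real.arccos_le_pi _
    have hI := integrable_kernelTail_boundaryDist (p := p) (r₀ := r₀) hr.le hα hu.le
    -- For θ < π - Θ the disc ends before distance r, so the maximum is r; for larger θ it is z(θ).
    have h1 : ∫ θ in (0 : ℝ)..(Real.pi - p.theta2 r₀ r),
        kernelTail p.alphaN u (max r (p.boundaryDist r₀ θ))
        = (Real.pi - p.theta2 r₀ r) * kernelTail p.alphaN u r := by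
      rw [intervalIntegral.integral_of_le (by linarith), integral_Ioc_eq_integral_Ioo,
        setIntegral_congr_fun measurableSet_Ioo (g := fun _ ↦ kernelTail p.alphaN u r)]
      · simp [hΘ]
      · intro θ hθ
        simp only
        rw [max_eq_left]
        exact ((boundaryDist_lt_iff h0 hr0Rc hr hθ.1.le (by linarith [hθ.2])).2 hθ.2).le
    have h2 : ∫ θ in (Real.pi - p.theta2 r₀ r)..Real.pi,
        kernelTail p.alphaN u (max r (p.boundaryDist r₀ θ))
        = u ^ (2 / p.alphaN) / p.alphaN * ∫ θ in (Real.pi - p.theta2 r₀ r)..Real.pi,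
            upperBeta (1 / (1 + u * p.boundaryDist r₀ θ ^ (-p.alphaN)))
              (2 / p.alphaN) (1 - 2 / p.alphaN) := by
      rw [← intervalIntegral.integral_const_mul, intervalIntegral.integral_of_le (by linarith),
        intervalIntegral.integral_of_le (by linarith), integral_Ioc_eq_integral_Ioo,
        integral_Ioc_eq_integral_Ioo]
      refine setIntegral_congr_fun measurableSet_Ioo fun θ hθ ↦ ?_
      have h3 : r ≤ p.boundaryDist r₀ θ := by
        by_contra h
        exact absurd ((boundaryDist_lt_iff h0 hr0Rc hr (by linarith [hθ.1]) hθ.2).1 (not_le.1 h))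
          (not_lt.2 hθ.1.le)
      rw [max_eq_right h3, kernelTail_eq hα0 hu (hr.trans_le h3)]
    rw [← intervalIntegral.integral_add_adjacent_intervals (hI 0 (Real.pi - p.theta2 r₀ r)) (hI _ _), h1,
      h2, kernelTail_eq hα0 hu hr]
    split_ifs with h
    · ring
    -- For r ≥ R_c + r₀ the angle Θ is 0 and the second range of directions is empty.
    · rw [theta2_of_ge h0 hRc (not_lt.1 h)]
      simp only [sub_zero, intervalIntegral.integral_same]
      ring

end NetParams

/-! ### The law of the nearest distance and the conditional Laplace transform -/

namespace NetParams

/-- The exponent of the Laplace transform of the interference beyond the distance `r`. -/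
noncomputable def tailExponent (p : NetParams) (r₀ r u : ℝ) : ℝ :=
  ∫ ρ in Ioi (max r 0), u / (u + ρ ^ p.alphaN) * p.radialDensity r₀ ρ

/-- The law of the distance from the UE to the nearest ground BS outside the disc. -/
noncomputable def nearestLaw (p : NetParams) (r₀ : ℝ) : Measure ℝ :=
  (volume.restrict (Ioi 0)).withDensity fun r ↦ ENNReal.ofReal (p.pdf r₀ r)

variable {p : NetParams} {r₀ : ℝ}

lemma measurable_pdf : Measurable (p.pdf r₀) := by
  have h1 : Measurable (p.theta1 r₀) := by
    unfold theta1
    exact Real.continuous_arccos.measurable.comp (by fun_prop)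
  have h2 : Measurable (p.theta2 r₀) := by
    unfold theta2
    exact Real.continuous_arccos.measurable.comp (by fun_prop)
  have h3 : Measurable (p.zeta1 r₀) := by
    have : p.zeta1 r₀ = fun r ↦ 2 * r * (Real.pi - p.theta2 r₀ r) := funext zeta1_eq
    rw [this]
    fun_prop
  have h4 : Measurable (p.zeta2 r₀) := by
    unfold zeta2
    fun_prop
  unfold pdf
  exact Measurable.ite measurableSet_Iic measurable_const
    (Measurable.ite measurableSet_Iio (by fun_prop) (by fun_prop))

lemma integrableOn_tailExponent (hlam : 0 < p.lam) (hα : 2 < p.alphaN) (r : ℝ) {u : ℝ} (hu : 0 ≤ u) :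
    IntegrableOn (fun ρ ↦ u / (u + ρ ^ p.alphaN) * p.radialDensity r₀ ρ) (Ioi (max r 0)) :=
  ((isRadialIntensity hlam).integrableOn hα hu).mono_set (Ioi_subset_Ioi (le_max_right _ _))

lemma measurable_tailExponent (hlam : 0 < p.lam) (hα : 2 < p.alphaN) {u : ℝ} (hu : 0 ≤ u) :
    Measurable fun r ↦ p.tailExponent r₀ r u := by
  -- The lower limit max r 0 makes the exponent monotone on the whole line, which gives
  -- measurability.
  have : Antitone fun r ↦ p.tailExponent r₀ r u := fun r r' h ↦ by
    refine setIntegral_mono_set (integrableOn_tailExponent hlam hα r hu) ?_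
      (Ioi_subset_Ioi (max_le_max_right 0 h)).eventuallyLE
    refine (ae_restrict_iff' measurableSet_Ioi).2 (ae_of_all _ fun x hx ↦ ?_)
    have hx0 : 0 < x := (le_max_right _ _).trans_lt hx
    have hp : 0 < x ^ p.alphaN := Real.rpow_pos_of_pos hx0 _
    exact mul_nonneg (by positivity) ((isRadialIntensity hlam).nonneg x hx0)
  exact this.measurable

lemma tailExponent_mono (hlam : 0 < p.lam) (hα : 2 < p.alphaN) (r : ℝ) {u v : ℝ} (hu : 0 ≤ u)
    (huv : u ≤ v) : p.tailExponent r₀ r u ≤ p.tailExponent r₀ r v := by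
  refine setIntegral_mono_on (integrableOn_tailExponent hlam hα r hu)
    (integrableOn_tailExponent hlam hα r (hu.trans huv)) measurableSet_Ioi fun x hx ↦ ?_
  have hx0 : 0 < x := (le_max_right _ _).trans_lt hx
  have hp : 0 < x ^ p.alphaN := Real.rpow_pos_of_pos hx0 _
  refine mul_le_mul_of_nonneg_right ?_ ((isRadialIntensity hlam).nonneg x hx0)
  rw [div_le_div_iff₀ (by positivity) (by linarith)]
  nlinarith

lemma pdf_nonneg (hr0 : 0 ≤ r₀) (hr0Rc : r₀ ≤ p.Rc) (hRc : 0 < p.Rc) (hlam : 0 < p.lam) {r : ℝ}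
    (hr : 0 < r) : 0 ≤ p.pdf r₀ r := by
  rw [pdf_eq hr0 hr0Rc hRc hlam hr]
  exact mul_nonneg ((isRadialIntensity hlam).nonneg r hr) (Real.exp_nonneg _)

/-- The density vanishes up to R_c - r₀, so almost every r is in the domain of the formula for η. -/
lemma ae_nearestLaw : ∀ᵐ r ∂p.nearestLaw r₀, 0 < r ∧ p.Rc - r₀ < r := by
  rw [nearestLaw, ae_withDensity_iff measurable_pdf.ennreal_ofReal, ae_restrict_iff' measurableSet_Ioi]
  refine ae_of_all _ fun r hr h ↦ ⟨hr, ?_⟩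
  by_contra hle
  exact h (by rw [pdf, if_pos (not_lt.1 hle), ENNReal.ofReal_zero])

lemma lap_eq (hRc : 0 < p.Rc) (hr0 : 0 ≤ r₀) (hr0Rc : r₀ ≤ p.Rc) (hlam : 0 < p.lam)
    (hα : 2 < p.alphaN) {r u : ℝ} (hr : 0 < r) (hrR : p.Rc - r₀ < r) (hu : 0 < u) :
    p.lap r₀ r u = Real.exp (-p.tailExponent r₀ r u) := by
  rw [lap, eta_eq hRc hr0 hr0Rc hlam hα hr hrR hu, tailExponent, max_eq_left hr.le]

end NetParams

section Kernel

variable {Ω : Type*} [MeasurableSpace Ω] {μ : Measure Ω} {p : NetParams} {r₀ : ℝ}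
  {Φ : Ω → Set (EuclideanSpace ℝ (Fin 2))} {y : ℕ → Ω → EuclideanSpace ℝ (Fin 2)}
  {g : ℕ → Ω → ℝ} {g0 : LinkState → Ω → ℝ} {S : Ω → LinkState}

lemma IsNetwork.measurable_groundGain (h : IsNetwork μ p r₀ Φ y g g0 S) (i : ℕ) :
    Measurable (groundGain p r₀ y g i) :=
  ((h.measurable_g i).div (((NetParams.measurable_dist_uePos r₀).comp
    (h.measurable_y i)).pow_const _)).ennreal_ofReal

lemma IsNetwork.measurable_farInterference (h : IsNetwork μ p r₀ Φ y g g0 S) :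
    Measurable (farInterference p r₀ y g) :=
  Measurable.tsum fun _ ↦ h.measurable_groundGain _

lemma IsNetwork.measurable_ueDist (h : IsNetwork μ p r₀ Φ y g g0 S) (i : ℕ) :
    Measurable (ueDist r₀ y i) :=
  (NetParams.measurable_dist_uePos r₀).comp (h.measurable_y i)

lemma IsNetwork.indepFun_ueDist (h : IsNetwork μ p r₀ Φ y g g0 S) :
    IndepFun (fun ω i ↦ ueDist r₀ y i ω) (fun ω i ↦ g i ω) μ := by
  let φ : (ℕ → EuclideanSpace ℝ (Fin 2)) → ℕ → ℝ := fun f i ↦ dist (f i) (uePos r₀)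
  have hφ : Measurable φ :=
    measurable_pi_lambda _ fun i ↦ (NetParams.measurable_dist_uePos r₀).comp (measurable_pi_apply i)
  let ψ : (ℕ → ℝ) × (LinkState → ℝ) × LinkState → ℕ → ℝ := fun z ↦ z.1
  have hψ : Measurable ψ := measurable_fst
  exact h.indep_y.comp hφ hψ

lemma IsNetwork.lintegral_ueDist_mul_expNeg [IsProbabilityMeasure μ] (h : IsNetwork μ p r₀ Φ y g g0 S) (hRc : 0 < p.Rc)
    (hr0 : 0 ≤ r₀) (hr0Rc : r₀ ≤ p.Rc) (hlam : 0 < p.lam) (hα : 2 < p.alphaN) {u : ℝ} (hu : 0 ≤ u)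
    {F : ℝ → ℝ≥0∞} (hF : Measurable F) :
    ∫⁻ ω, F (ueDist r₀ y 0 ω) * expNeg (ENNReal.ofReal u * farInterference p r₀ y g ω) ∂μ
      = ∫⁻ r, F r * ENNReal.ofReal (Real.exp (-p.tailExponent r₀ r u)) ∂p.nearestLaw r₀ := by
  have hP := h.isPoissonSeq hlam.le
  rw [NetParams.radialMeasure_eq_withDensity hRc hr0 hlam] at hP
  have hind := h.indepFun_ueDist
  have key := hP.lintegral_nearest_mul_interference (NetParams.isRadialIntensity hlam) h.monotone_y
    (h.ueDist_pos hr0 hr0Rc) hα hu h.measurable_g h.hasLaw_g h.iIndepFun_g hind hF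
  refine Eq.trans key ?_
  have hm : Measurable fun r ↦ F r * ENNReal.ofReal (Real.exp (-p.tailExponent r₀ r u)) :=
    hF.mul (Real.measurable_exp.comp (NetParams.measurable_tailExponent hlam hα hu).neg).ennreal_ofReal
  rw [NetParams.nearestLaw,
    lintegral_withDensity_eq_lintegral_mul _ NetParams.measurable_pdf.ennreal_ofReal hm]
  refine setLIntegral_congr_fun measurableSet_Ioi fun r hr ↦ ?_
  have hr' : 0 < r := hr
  simp only [Pi.mul_apply]
  rw [mul_left_comm, ← ENNReal.ofReal_mul (NetParams.pdf_nonneg hr0 hr0Rc hRc hlam hr),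
    NetParams.pdf_eq hr0 hr0Rc hRc hlam hr, mul_assoc, ← Real.exp_add, NetParams.tailExponent,
    max_eq_left hr'.le, neg_add]

variable [IsProbabilityMeasure μ]

/-- The case u = 0 of `IsNetwork.lintegral_ueDist_mul_expNeg`, where the exponent vanishes. -/
lemma IsNetwork.map_ueDist (h : IsNetwork μ p r₀ Φ y g g0 S) (hRc : 0 < p.Rc)
    (hr0 : 0 ≤ r₀) (hr0Rc : r₀ ≤ p.Rc) (hlam : 0 < p.lam) (hα : 2 < p.alphaN) :
    μ.map (ueDist r₀ y 0) = p.nearestLaw r₀ := by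
  ext A hA
  have := h.lintegral_ueDist_mul_expNeg hRc hr0 hr0Rc hlam hα le_rfl (measurable_one.indicator hA)
  simp only [ENNReal.ofReal_zero, zero_mul, expNeg_zero, mul_one, NetParams.tailExponent, zero_div,
    integral_zero, neg_zero, Real.exp_zero, ENNReal.ofReal_one] at this
  rw [lintegral_indicator_one hA] at this
  rw [← this, ← lintegral_indicator_one hA, lintegral_map (measurable_one.indicator hA)
    (h.measurable_ueDist 0)]

/-- Continuity may fail at u = 0, where 0 · ∞ = 0 makes a mass at ∞ count, while for u > 0 it does
not. -/
lemma tendsto_lintegral_expNeg_mul (κ : Measure ℝ≥0∞) [IsProbabilityMeasure κ] {v : ℕ → ℝ} {u : ℝ}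
    (hu : 0 < u) (hv : Tendsto v atTop (𝓝 u)) :
    Tendsto (fun n ↦ ∫⁻ z, expNeg (ENNReal.ofReal (v n) * z) ∂κ) atTop
      (𝓝 (∫⁻ z, expNeg (ENNReal.ofReal u * z) ∂κ)) := by
  refine tendsto_lintegral_of_dominated_convergence (fun _ ↦ 1)
    (fun n ↦ measurable_expNeg.comp (measurable_id.const_mul _))
    (fun n ↦ ae_of_all _ fun ω ↦ expNeg_le_one _) (by simp)
    (ae_of_all _ fun z ↦ (continuous_expNeg.tendsto _).comp ?_)
  exact ENNReal.Tendsto.mul_const ((ENNReal.continuous_ofReal.tendsto _).comp hv)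
    (Or.inl (by simpa using hu))

/-- The conditional law of the far interference given the distance to the nearest ground BS has the
Laplace transform `lap`. -/
theorem IsNetwork.lintegral_condDistrib (h : IsNetwork μ p r₀ Φ y g g0 S) (hRc : 0 < p.Rc)
    (hr0 : 0 ≤ r₀) (hr0Rc : r₀ ≤ p.Rc) (hlam : 0 < p.lam) (hα : 2 < p.alphaN) :
    ∀ᵐ r ∂p.nearestLaw r₀, ∀ u, 0 < u →
      ∫⁻ z, expNeg (ENNReal.ofReal u * z) ∂condDistrib (farInterference p r₀ y g) (ueDist r₀ y 0) μ r
        = ENNReal.ofReal (p.lap r₀ r u) := by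
  set κ := condDistrib (farInterference p r₀ y g) (ueDist r₀ y 0) μ with hκ
  have hlaw := h.map_ueDist hRc hr0 hr0Rc hlam hα
  have hprob : IsProbabilityMeasure (p.nearestLaw r₀) := by
    rw [← hlaw]; exact Measure.isProbabilityMeasure_map (h.measurable_ueDist 0).aemeasurable
  have hcomp : p.nearestLaw r₀ ⊗ₘ κ
      = μ.map fun ω ↦ (ueDist r₀ y 0 ω, farInterference p r₀ y g ω) := by
    rw [← hlaw, hκ]
    exact compProd_map_condDistrib h.measurable_farInterference.aemeasurable
  -- For each u the two sides have equal integrals over every measurable set of radii. The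
  -- exceptional null set depends on u, hence the restriction to rational u.
  have hrat : ∀ q : ℚ, 0 < q → ∀ᵐ r ∂p.nearestLaw r₀,
      ∫⁻ z, expNeg (ENNReal.ofReal q * z) ∂κ r
        = ENNReal.ofReal (Real.exp (-p.tailExponent r₀ r q)) := fun q hq ↦ by
    have hq' : (0 : ℝ) ≤ q := by exact_mod_cast hq.le
    have hm : Measurable fun z : ℝ≥0∞ ↦ expNeg (ENNReal.ofReal q * z) :=
      measurable_expNeg.comp (measurable_id.const_mul _)
    refine ae_eq_of_forall_setLIntegral_eq_of_sigmaFinite hm.lintegral_kernel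
      (Real.measurable_exp.comp (NetParams.measurable_tailExponent hlam hα hq').neg).ennreal_ofReal
      fun A hA _ ↦ ?_
    have h1 := h.lintegral_ueDist_mul_expNeg hRc hr0 hr0Rc hlam hα hq' (measurable_one.indicator hA)
    have hm2 : Measurable fun x : ℝ × ℝ≥0∞ ↦ A.indicator 1 x.1 * expNeg (ENNReal.ofReal q * x.2) :=
      ((measurable_one.indicator hA).comp measurable_fst).mul (hm.comp measurable_snd)
    have h2 : ∀ F : ℝ → ℝ≥0∞, ∫⁻ r in A, F r ∂p.nearestLaw r₀
        = ∫⁻ r, A.indicator 1 r * F r ∂p.nearestLaw r₀ := fun F ↦ by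
      rw [← lintegral_indicator hA]
      refine lintegral_congr fun r ↦ ?_
      by_cases hr : r ∈ A <;> simp [hr]
    rw [h2, h2]
    refine Eq.trans ?_ h1
    rw [← lintegral_map hm2 ((h.measurable_ueDist 0).prodMk h.measurable_farInterference), ← hcomp,
      Measure.lintegral_compProd hm2]
    refine lintegral_congr fun r ↦ ?_
    exact (lintegral_const_mul _ hm).symm
  have hall : ∀ᵐ r ∂p.nearestLaw r₀, ∀ q : ℚ, 0 < q →
      ∫⁻ z, expNeg (ENNReal.ofReal q * z) ∂κ r
        = ENNReal.ofReal (Real.exp (-p.tailExponent r₀ r q)) := by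
    rw [ae_all_iff]
    intro q
    by_cases hq : 0 < q
    · filter_upwards [hrat q hq] with r hr _ using hr
    · exact ae_of_all _ fun r h' ↦ absurd h' hq
  filter_upwards [hall, NetParams.ae_nearestLaw] with r hr hrpos u hu
  rw [NetParams.lap_eq hRc hr0 hr0Rc hlam hα hrpos.1 hrpos.2 hu]
  -- Rational u from above give one inequality and from below the other. Continuity is used on the
  -- left and monotonicity on the right.
  refine le_antisymm ?_ ?_
  · obtain ⟨v, -, hv, htend⟩ := Real.exists_seq_rat_strictAnti_tendsto u
    have hc := tendsto_lintegral_expNeg_mul (κ r) hu htend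
    refine le_of_tendsto hc (Eventually.of_forall fun n ↦ ?_)
    have hvn : 0 < v n := by exact_mod_cast hu.trans (hv n)
    rw [hr _ hvn]
    exact ENNReal.ofReal_le_ofReal (Real.exp_le_exp.2 (neg_le_neg
      (NetParams.tailExponent_mono hlam hα r hu.le (hv n).le)))
  · obtain ⟨v, -, hv, htend⟩ := Real.exists_seq_rat_strictMono_tendsto u
    have hc := tendsto_lintegral_expNeg_mul (κ r) hu htend
    refine ge_of_tendsto hc ?_
    filter_upwards [htend.eventually (lt_mem_nhds hu)] with n hn
    rw [hr _ (by exact_mod_cast hn)]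
    exact ENNReal.ofReal_le_ofReal (Real.exp_le_exp.2 (neg_le_neg
      (NetParams.tailExponent_mono hlam hα r hn.le (hv n).le)))

end Kernel

/-! ### Tails of Erlang laws and of their convolution with an exponential law -/

open scoped Nat

/-- The tail `∑_{l < k} xˡ / l! e⁻ˣ` of the Erlang distribution with shape `k` and rate `1`. -/
noncomputable def erlangTail (k : ℕ) (x : ℝ) : ℝ := ∑ l ∈ Finset.range k, x ^ l / l ! * Real.exp (-x)

lemma erlangTail_succ (k : ℕ) (x : ℝ) :
    erlangTail (k + 1) x = erlangTail k x + x ^ k / k ! * Real.exp (-x) := by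
  rw [erlangTail, Finset.sum_range_succ, erlangTail]

lemma erlangTail_succ_zero (k : ℕ) : erlangTail (k + 1) 0 = 1 := by
  rw [erlangTail, Finset.sum_eq_single 0]
  · simp
  · intro l _ hl
    simp [hl]
  · simp

/-- The derivatives of the terms telescope, leaving minus the Erlang density. -/
lemma hasDerivAt_erlangTail_succ (k : ℕ) (x : ℝ) :
    HasDerivAt (erlangTail (k + 1)) (-(x ^ k / k ! * Real.exp (-x))) x := by
  have hexp : HasDerivAt (fun x : ℝ ↦ Real.exp (-x)) (-Real.exp (-x)) x := by
    simpa using (hasDerivAt_neg x).exp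
  induction k with
  | zero =>
    have : erlangTail (0 + 1) = fun x ↦ Real.exp (-x) := by
      funext x; simp [erlangTail]
    rw [this]
    simpa using hexp
  | succ k ih =>
    have h1 : erlangTail (k + 1 + 1)
        = fun x ↦ erlangTail (k + 1) x + x ^ (k + 1) / (k + 1)! * Real.exp (-x) :=
      funext fun x ↦ erlangTail_succ (k + 1) x
    rw [h1]
    have h2 := ih.add (((hasDerivAt_pow (k + 1) x).div_const ((k + 1)! : ℝ)).mul hexp)
    convert! h2 using 1
    have h3 : ((k + 1)! : ℝ) = (k + 1) * k ! := by push_cast [Nat.factorial_succ]; ring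
    have h4 : (k ! : ℝ) ≠ 0 := by positivity
    rw [h3]
    push_cast
    field_simp
    simp

/-- The tail of the sum of two independent variables, one Erlang with shape `k` and rate `ρ₀`, the
other exponential with rate `ρ₁`. -/
noncomputable def erlangMix (k : ℕ) (ρ₀ ρ₁ y : ℝ) : ℝ :=
  (ρ₀ / (ρ₀ - ρ₁)) ^ k * Real.exp (-(ρ₁ * y))
    - ∑ i ∈ Finset.Icc 1 k, ρ₁ / (ρ₀ - ρ₁) * (ρ₀ / (ρ₀ - ρ₁)) ^ (k - i) * erlangTail i (ρ₀ * y)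

/-- The recursion in the shape on which the inductions for the initial value and for the derivative
rest. -/
lemma erlangMix_succ (k : ℕ) (ρ₀ ρ₁ y : ℝ) :
    erlangMix (k + 1) ρ₀ ρ₁ y
      = ρ₀ / (ρ₀ - ρ₁) * erlangMix k ρ₀ ρ₁ y - ρ₁ / (ρ₀ - ρ₁) * erlangTail (k + 1) (ρ₀ * y) := by
  rw [erlangMix, Finset.sum_Icc_succ_top (by omega), erlangMix, mul_sub, Finset.mul_sum]
  have : ∀ i ∈ Finset.Icc 1 k,
      ρ₁ / (ρ₀ - ρ₁) * (ρ₀ / (ρ₀ - ρ₁)) ^ (k + 1 - i) * erlangTail i (ρ₀ * y)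
      = ρ₀ / (ρ₀ - ρ₁) * (ρ₁ / (ρ₀ - ρ₁) * (ρ₀ / (ρ₀ - ρ₁)) ^ (k - i) * erlangTail i (ρ₀ * y)) :=
    fun i hi ↦ by
      rw [Nat.sub_add_comm (Finset.mem_Icc.1 hi).2, pow_succ]; ring
  rw [Finset.sum_congr rfl this, Nat.sub_self, pow_zero, pow_succ]
  ring

lemma erlangMix_zero (k : ℕ) {ρ₀ ρ₁ : ℝ} (hρ : ρ₀ ≠ ρ₁) : erlangMix k ρ₀ ρ₁ 0 = 1 := by
  have h : ρ₀ - ρ₁ ≠ 0 := sub_ne_zero.2 hρ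
  induction k with
  | zero => simp [erlangMix]
  | succ k ih =>
    rw [erlangMix_succ, ih, mul_zero, erlangTail_succ_zero]
    field_simp

/-- This linear equation, M' = -ρ₁(M - E) with E the Erlang tail, is the one satisfied by the tail
of the sum: it loses mass at rate ρ₁ while the Erlang part is already below y. -/
lemma hasDerivAt_erlangMix (k : ℕ) {ρ₀ ρ₁ : ℝ} (hρ : ρ₀ ≠ ρ₁) (y : ℝ) :
    HasDerivAt (erlangMix k ρ₀ ρ₁) (-(ρ₁ * erlangMix k ρ₀ ρ₁ y) + ρ₁ * erlangTail k (ρ₀ * y)) y := by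
  have h : ρ₀ - ρ₁ ≠ 0 := sub_ne_zero.2 hρ
  induction k with
  | zero =>
    have h1 : erlangMix 0 ρ₀ ρ₁ = fun y ↦ Real.exp (-(ρ₁ * y)) := by
      funext y; simp [erlangMix]
    have h0 : HasDerivAt (fun y ↦ ρ₁ * y) ρ₁ y := by simpa using (hasDerivAt_id y).const_mul ρ₁
    have h2 : HasDerivAt (fun y ↦ -(ρ₁ * y)) (-ρ₁) y := h0.neg
    rw [h1]
    convert! h2.exp using 1
    simp [erlangTail]
    ring
  | succ k ih =>
    have h1 : erlangMix (k + 1) ρ₀ ρ₁ = fun y ↦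
        ρ₀ / (ρ₀ - ρ₁) * erlangMix k ρ₀ ρ₁ y - ρ₁ / (ρ₀ - ρ₁) * erlangTail (k + 1) (ρ₀ * y) :=
      funext fun y ↦ erlangMix_succ k ρ₀ ρ₁ y
    have h2 : HasDerivAt (fun y ↦ ρ₀ * y) ρ₀ y := by simpa using (hasDerivAt_id y).const_mul ρ₀
    have h3 := (hasDerivAt_erlangTail_succ k (ρ₀ * y)).comp y h2
    have h4 := (ih.const_mul (ρ₀ / (ρ₀ - ρ₁))).sub (h3.const_mul (ρ₁ / (ρ₀ - ρ₁)))
    rw [h1]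
    convert! h4 using 1
    simp only [erlangTail_succ]
    field_simp
    ring

/-- The probability that the Erlang variable is at most y but the sum exceeds y. By variation of
constants, e^(ρ₁x) times the difference of the two tails has derivative e^(ρ₁x) times the Erlang
density, and it vanishes at 0. -/
lemma integral_erlang_mul_exp (n : ℕ) {ρ₀ ρ₁ : ℝ} (hρ : ρ₀ ≠ ρ₁) (y : ℝ) :
    ∫ h in (0 : ℝ)..y, ρ₀ ^ (n + 1) / n ! * h ^ n * Real.exp (-(ρ₀ * h)) * Real.exp (-(ρ₁ * (y - h)))
      = erlangMix (n + 1) ρ₀ ρ₁ y - erlangTail (n + 1) (ρ₀ * y) := by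
  have hd : ∀ x ∈ uIcc 0 y, HasDerivAt (fun x ↦ Real.exp (-(ρ₁ * (y - x))) *
      (erlangMix (n + 1) ρ₀ ρ₁ x - erlangTail (n + 1) (ρ₀ * x)))
      (ρ₀ ^ (n + 1) / n ! * x ^ n * Real.exp (-(ρ₀ * x)) * Real.exp (-(ρ₁ * (y - x)))) x := by
    intro x _
    have h0 : HasDerivAt (fun x ↦ ρ₁ * (y - x)) (-ρ₁) x := by
      simpa using ((hasDerivAt_id x).const_sub y).const_mul ρ₁
    have h1 : HasDerivAt (fun x ↦ -(ρ₁ * (y - x))) ρ₁ x := by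
      rw [← neg_neg ρ₁]
      simpa only [neg_neg] using! h0.neg
    have h2 : HasDerivAt (fun y ↦ ρ₀ * y) ρ₀ x := by simpa using (hasDerivAt_id x).const_mul ρ₀
    have h3 := (hasDerivAt_erlangTail_succ n (ρ₀ * x)).comp x h2
    have h4 := h1.exp.mul ((hasDerivAt_erlangMix (n + 1) hρ x).sub h3)
    convert! h4 using 1
    simp only [Pi.sub_apply, Function.comp]
    rw [mul_pow]
    ring
  rw [intervalIntegral.integral_eq_sub_of_hasDerivAt hd (Continuous.intervalIntegrable (by fun_prop) _ _)]
  simp [erlangMix_zero _ hρ, erlangTail_succ_zero]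

lemma integral_erlang (n : ℕ) (ρ y : ℝ) :
    ∫ h in (0 : ℝ)..y, ρ ^ (n + 1) / n ! * h ^ n * Real.exp (-(ρ * h)) = 1 - erlangTail (n + 1) (ρ * y) := by
  have hd : ∀ x ∈ uIcc 0 y, HasDerivAt (fun x ↦ -erlangTail (n + 1) (ρ * x))
      (ρ ^ (n + 1) / n ! * x ^ n * Real.exp (-(ρ * x))) x := by
    intro x _
    have h2 : HasDerivAt (fun y ↦ ρ * y) ρ x := by simpa using (hasDerivAt_id x).const_mul ρ
    have h3 := ((hasDerivAt_erlangTail_succ n (ρ * x)).comp x h2).neg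
    convert! h3 using 1
    rw [mul_pow]
    ring
  rw [intervalIntegral.integral_eq_sub_of_hasDerivAt hd (Continuous.intervalIntegrable (by fun_prop) _ _)]
  simp [erlangTail_succ_zero]
  ring

section Gamma

variable (n : ℕ) {ρ : ℝ}

lemma gammaPDF_natCast_succ {x : ℝ} (hx : 0 ≤ x) :
    gammaPDF ((n + 1 : ℕ) : ℝ) ρ x
      = ENNReal.ofReal (ρ ^ (n + 1) / n ! * x ^ n * Real.exp (-(ρ * x))) := by
  rw [gammaPDF_of_nonneg hx, Nat.cast_succ, Real.Gamma_nat_eq_factorial, add_sub_cancel_right,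
    Real.rpow_natCast]
  congr 4
  exact_mod_cast Real.rpow_natCast ρ (n + 1)

lemma setLIntegral_Ioc_gammaMeasure (hρ : 0 < ρ) {y : ℝ} (hy : 0 ≤ y) {f : ℝ → ℝ} (hf : Continuous f)
    (hf0 : ∀ x, 0 ≤ f x) :
    ∫⁻ h in Ioc 0 y, ENNReal.ofReal (f h) ∂gammaMeasure ((n + 1 : ℕ) : ℝ) ρ
      = ENNReal.ofReal (∫ h in (0 : ℝ)..y, ρ ^ (n + 1) / n ! * h ^ n * Real.exp (-(ρ * h)) * f h) := by
  have hc : Continuous fun h : ℝ ↦ ρ ^ (n + 1) / n ! * h ^ n * Real.exp (-(ρ * h)) * f h := by fun_prop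
  rw [gammaMeasure, restrict_withDensity measurableSet_Ioc,
    lintegral_withDensity_eq_lintegral_mul _ (measurable_gammaPDF _ _) hf.measurable.ennreal_ofReal,
    intervalIntegral.integral_of_le hy, ofReal_integral_eq_lintegral_ofReal
      ((intervalIntegrable_iff_integrableOn_Ioc_of_le hy).1 (hc.intervalIntegrable 0 y))]
  · refine setLIntegral_congr_fun measurableSet_Ioc fun x hx ↦ ?_
    have hx0 : 0 < x := hx.1
    rw [Pi.mul_apply, gammaPDF_natCast_succ n hx.1.le, ← ENNReal.ofReal_mul (by positivity)]
  · rw [EventuallyLE, ae_restrict_iff' measurableSet_Ioc]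
    refine ae_of_all _ fun x hx ↦ ?_
    have hx0 : 0 < x := hx.1
    exact mul_nonneg (by positivity) (hf0 x)

lemma gammaMeasure_Iic_zero (k ρ : ℝ) : gammaMeasure k ρ (Iic 0) = 0 := by
  rw [gammaMeasure, withDensity_apply _ measurableSet_Iic,
    setLIntegral_congr Iio_ae_eq_Iic.symm, lintegral_gammaPDF_of_nonpos le_rfl]

lemma gammaMeasure_Ioi (hρ : 0 < ρ) {y : ℝ} (hy : 0 ≤ y) :
    gammaMeasure ((n + 1 : ℕ) : ℝ) ρ (Ioi y) = ENNReal.ofReal (erlangTail (n + 1) (ρ * y)) := by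
  have hn : (0 : ℝ) < ((n + 1 : ℕ) : ℝ) := by positivity
  have := isProbabilityMeasure_gammaMeasure hn hρ
  have h1 := setLIntegral_Ioc_gammaMeasure n hρ hy (f := fun _ ↦ 1) continuous_const
    (fun _ ↦ zero_le_one)
  simp only [ENNReal.ofReal_one, setLIntegral_one, mul_one, integral_erlang] at h1
  have h2 : gammaMeasure ((n + 1 : ℕ) : ℝ) ρ (Iic y)
      = ENNReal.ofReal (1 - erlangTail (n + 1) (ρ * y)) := by
    rw [← h1, ← Iic_union_Ioc_eq_Iic hy, measure_union (Iic_disjoint_Ioc le_rfl) measurableSet_Ioc,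
      gammaMeasure_Iic_zero, zero_add]
  have hnn : 0 ≤ erlangTail (n + 1) (ρ * y) :=
    Finset.sum_nonneg fun l _ ↦ by positivity
  rw [← compl_Iic, prob_compl_eq_one_sub measurableSet_Iic, h2]
  by_cases h : erlangTail (n + 1) (ρ * y) ≤ 1
  · rw [← ENNReal.ofReal_one, ← ENNReal.ofReal_sub _ (by linarith)]
    congr 1; ring
  -- `ENNReal.ofReal` truncates at 0, so the tail must be shown to be at most 1: its complement is
  -- the integral of a nonnegative density.
  · exfalso
    have hint : 0 ≤ ∫ h in (0 : ℝ)..y, ρ ^ (n + 1) / n ! * h ^ n * Real.exp (-(ρ * h)) :=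
      intervalIntegral.integral_nonneg hy fun x hx ↦ by have := hx.1; positivity
    rw [integral_erlang] at hint
    linarith

end Gamma

/-! ### The functions zˡe^(-uz) and derivatives of a Laplace transform -/

/-- The function `z ↦ zˡ e^(-u z)` on `[0, ∞]`, with the value `0` at `∞`. -/
noncomputable def powMulExp (l : ℕ) (u : ℝ) (z : ℝ≥0∞) : ℝ :=
  ({⊤}ᶜ : Set ℝ≥0∞).indicator (fun z ↦ z.toReal ^ l * Real.exp (-(u * z.toReal))) z

lemma powMulExp_top (l : ℕ) (u : ℝ) : powMulExp l u ⊤ = 0 := by simp [powMulExp]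

lemma powMulExp_of_ne_top (l : ℕ) (u : ℝ) {z : ℝ≥0∞} (hz : z ≠ ⊤) :
    powMulExp l u z = z.toReal ^ l * Real.exp (-(u * z.toReal)) := by
  rw [powMulExp, indicator_of_mem]; exact hz

lemma powMulExp_nonneg (l : ℕ) (u : ℝ) (z : ℝ≥0∞) : 0 ≤ powMulExp l u z :=
  indicator_nonneg (fun z _ ↦ by positivity) z

lemma powMulExp_mul (l : ℕ) (u : ℝ) {c : ℝ} (hc : 0 < c) (z : ℝ≥0∞) :
    powMulExp l u (ENNReal.ofReal c * z) = c ^ l * powMulExp l (u * c) z := by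
  by_cases hz : z = ⊤
  · rw [hz, ENNReal.mul_top (by simpa using hc), powMulExp_top, powMulExp_top, mul_zero]
  · rw [powMulExp_of_ne_top _ _ hz, powMulExp_of_ne_top _ _ (ENNReal.mul_ne_top ENNReal.ofReal_ne_top hz),
      ENNReal.toReal_mul, ENNReal.toReal_ofReal hc.le, mul_pow, mul_assoc, mul_assoc]

/-- The binomial theorem separates the gain x of one channel from the interference z; after
averaging it becomes the Leibniz sum in P³. -/
lemma powMulExp_ofReal_add (l : ℕ) (u : ℝ) {x : ℝ} (hx : 0 ≤ x) (z : ℝ≥0∞) :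
    powMulExp l u (ENNReal.ofReal x + z)
      = ∑ q ∈ Finset.range (l + 1), (l.choose q : ℝ) * powMulExp q u z *
          (x ^ (l - q) * Real.exp (-(u * x))) := by
  by_cases hz : z = ⊤
  · simp [hz, powMulExp_top]
  · simp only [powMulExp_of_ne_top _ _ hz]
    rw [powMulExp_of_ne_top _ _ (ENNReal.add_ne_top.2 ⟨ENNReal.ofReal_ne_top, hz⟩),
      ENNReal.toReal_add ENNReal.ofReal_ne_top hz, ENNReal.toReal_ofReal hx, add_comm x, add_pow,
      Finset.sum_mul]
    refine Finset.sum_congr rfl fun q _ ↦ ?_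
    rw [mul_add, neg_add, Real.exp_add]
    ring

/-- The tail of a scaled gamma distribution with integer shape. -/
lemma gammaMeasure_lt_ofReal_div (n : ℕ) {ρ L : ℝ} (hρ : 0 < ρ) (hL : 0 < L) (s : ℝ≥0∞) :
    gammaMeasure ((n + 1 : ℕ) : ℝ) ρ {h | s < ENNReal.ofReal (h / L)}
      = ENNReal.ofReal (∑ l ∈ Finset.range (n + 1), (ρ * L) ^ l / l ! * powMulExp l (ρ * L) s) := by
  by_cases hs : s = ⊤
  · simp [hs, powMulExp_top]
  · have hset : {h | s < ENNReal.ofReal (h / L)} = Ioi (L * s.toReal) := by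
      ext h
      rw [mem_ofPred_eq, ENNReal.lt_ofReal_iff_toReal_lt hs, lt_div_iff₀ hL, mul_comm, mem_Ioi]
    rw [hset, gammaMeasure_Ioi n hρ (mul_nonneg hL.le ENNReal.toReal_nonneg), erlangTail]
    congr 1
    refine Finset.sum_congr rfl fun l _ ↦ ?_
    rw [powMulExp_of_ne_top _ _ hs, ← mul_assoc ρ, mul_pow]
    ring

/-- The derivatives of the Laplace transform of a law on `[0, ∞]`. -/
lemma integrable_powMulExp_and_integral {κ : Measure ℝ≥0∞} [IsProbabilityMeasure κ] {Lap : ℝ → ℝ}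
    (hLap0 : ∀ u, 0 ≤ Lap u)
    (hLap : ∀ u, 0 < u → ∫⁻ z, expNeg (ENNReal.ofReal u * z) ∂κ = ENNReal.ofReal (Lap u))
    (l : ℕ) {u : ℝ} (hu : 0 < u) :
    Integrable (powMulExp l u) κ ∧ ∫ z, powMulExp l u z ∂κ = (-1) ^ l * iteratedDeriv l Lap u := by
  have hms : MeasurableSet ({⊤}ᶜ : Set ℝ≥0∞) := (measurableSet_singleton _).compl
  -- For u > 0 a mass at ∞ has weight 0, so the transform is the moment generating function at -u of
  -- the finite part.
  set κ' := κ.restrict {⊤}ᶜ with hκ'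
  have hset : Iic 0 ⊆ integrableExpSet ENNReal.toReal κ' := fun t ht ↦ by
    refine Integrable.mono' (integrable_const (1 : ℝ)) (by fun_prop) (ae_of_all _ fun z ↦ ?_)
    rw [Real.norm_of_nonneg (Real.exp_nonneg _), Real.exp_le_one_iff]
    exact mul_nonpos_of_nonpos_of_nonneg ht ENNReal.toReal_nonneg
  -- The moment generating function is finite on (-∞, 0], so it can be differentiated under the
  -- integral at every interior point, in particular at -u.
  have hint : -u ∈ interior (integrableExpSet ENNReal.toReal κ') :=
    interior_mono hset (by rw [interior_Iic]; simpa using hu)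
  have hmgf : ∀ v, 0 < v → Lap v = mgf ENNReal.toReal κ' (-v) := fun v hv ↦ by
    have h1 : Integrable (fun z : ℝ≥0∞ ↦ Real.exp (-v * z.toReal)) κ' := hset (by simpa using hv.le)
    have h2 : ENNReal.ofReal (mgf ENNReal.toReal κ' (-v)) = ENNReal.ofReal (Lap v) := by
      rw [mgf, ofReal_integral_eq_lintegral_ofReal h1 (ae_of_all _ fun z ↦ Real.exp_nonneg _),
        ← hLap v hv, hκ', ← lintegral_indicator hms]
      refine lintegral_congr fun z ↦ ?_
      by_cases hz : z = ⊤
      · rw [indicator_of_notMem (by simp [hz]), hz, ENNReal.mul_top (by simpa using hv), expNeg_top]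
      · rw [indicator_of_mem (show z ∈ ({⊤}ᶜ : Set ℝ≥0∞) from hz)]
        nth_rewrite 2 [← ENNReal.ofReal_toReal hz]
        rw [← ENNReal.ofReal_mul hv.le, expNeg_ofReal (mul_nonneg hv.le ENNReal.toReal_nonneg), neg_mul]
    exact ((ENNReal.ofReal_eq_ofReal_iff mgf_nonneg (hLap0 v)).1 h2).symm
  have hev : Lap =ᶠ[𝓝 u] fun v ↦ mgf ENNReal.toReal κ' (-v) := by
    filter_upwards [lt_mem_nhds hu] with v hv using hmgf v hv
  constructor
  · refine (integrable_indicator_iff hms).2 ?_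
    have := integrable_pow_mul_exp_of_mem_interior_integrableExpSet hint l
    simp only [neg_mul] at this
    exact this
  · rw [hev.iteratedDeriv_eq l, iteratedDeriv_comp_neg, iteratedDeriv_mgf hint, smul_eq_mul, ← mul_assoc,
      ← mul_pow]
    simp only [powMulExp, integral_indicator hms, neg_mul, neg_neg, one_pow, one_mul, hκ']

/-- The `t`-th moment of an exponential variable under an exponential tilt. -/
lemma integral_expMeasure_pow_mul_exp {a : ℝ} (ha : 0 ≤ a) (t : ℕ) :
    Integrable (fun v ↦ v ^ t * Real.exp (-(a * v))) (expMeasure 1) ∧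
      ∫ v, v ^ t * Real.exp (-(a * v)) ∂expMeasure 1 = t ! / (1 + a) ^ (t + 1) := by
  have hl := lintegral_gammaMeasure_pow_mul_exp one_pos one_pos ha t
  have hval : (1 : ℝ) ^ (1 : ℝ) * Real.Gamma (1 + t) / (Real.Gamma 1 * (1 + a) ^ ((1 : ℝ) + t))
      = t ! / (1 + a) ^ (t + 1) := by
    rw [add_comm (1 : ℝ) t, Real.Gamma_nat_eq_factorial, Real.one_rpow, Real.Gamma_one, one_mul, one_mul]
    congr 1
    exact_mod_cast Real.rpow_natCast (1 + a) (t + 1)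
  rw [hval] at hl
  have hnn : 0 ≤ᵐ[expMeasure 1] fun v ↦ v ^ t * Real.exp (-(a * v)) := by
    filter_upwards [ae_gammaMeasure_nonneg 1 1] with v hv
    exact mul_nonneg (pow_nonneg hv t) (Real.exp_nonneg _)
  have hm : AEStronglyMeasurable (fun v : ℝ ↦ v ^ t * Real.exp (-(a * v))) (expMeasure 1) := by
    fun_prop
  have hint : Integrable (fun v ↦ v ^ t * Real.exp (-(a * v))) (expMeasure 1) := by
    refine ⟨hm, ?_⟩
    rw [hasFiniteIntegral_iff_ofReal hnn]
    exact hl.trans_lt ENNReal.ofReal_lt_top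
  refine ⟨hint, ?_⟩
  rw [integral_eq_lintegral_of_nonneg_ae hnn hm]
  exact (congrArg ENNReal.toReal hl).trans (ENNReal.toReal_ofReal (by positivity))

lemma expMeasure_lt_ofReal_div {b : ℝ} (hb : 0 < b) (s : ℝ≥0∞) :
    expMeasure 1 {v | s < ENNReal.ofReal (v / b)} = ENNReal.ofReal (powMulExp 0 b s) := by
  have := gammaMeasure_lt_ofReal_div 0 one_pos hb s
  simpa [expMeasure] using this

/-! ### Coverage probabilities for given interference, and their means -/

section Coverage

variable (n : ℕ) {L b e : ℝ}

/-- The probability that the exponential channel beats the gamma channel and the interference. -/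
lemma prod_bs (hL : 0 < L) (hb : 0 < b) (he : 0 < e) (z : ℝ≥0∞) :
    ((expMeasure 1).prod (gammaMeasure ((n + 1 : ℕ) : ℝ) ((n + 1 : ℕ) : ℝ)))
      {q | ENNReal.ofReal e * (ENNReal.ofReal (q.2 / L) + z) < ENNReal.ofReal (q.1 / b)}
      = ENNReal.ofReal (powMulExp 0 (b * e) z / (1 + b * e / (L * (n + 1 : ℕ))) ^ (n + 1)) := by
  have hn : (0 : ℝ) < ((n + 1 : ℕ) : ℝ) := by positivity
  have := isProbabilityMeasure_gammaMeasure hn hn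
  have := isProbabilityMeasure_expMeasure one_pos
  have hms : MeasurableSet {q : ℝ × ℝ |
      ENNReal.ofReal e * (ENNReal.ofReal (q.2 / L) + z) < ENNReal.ofReal (q.1 / b)} :=
    measurableSet_lt (by fun_prop) (by fun_prop)
  have hc : 0 ≤ b * e / L := by positivity
  rw [Measure.prod_apply_symm hms]
  -- Given the gamma power h, the exponential tail at e(h/L + z) factors into a function of z and
  -- one of h, whose mean is the gamma Laplace transform.
  have h1 : ∀ᵐ h ∂gammaMeasure ((n + 1 : ℕ) : ℝ) ((n + 1 : ℕ) : ℝ),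
      expMeasure 1 ((fun x ↦ (x, h)) ⁻¹' {q : ℝ × ℝ |
        ENNReal.ofReal e * (ENNReal.ofReal (q.2 / L) + z) < ENNReal.ofReal (q.1 / b)})
      = ENNReal.ofReal (powMulExp 0 (b * e) z)
        * ENNReal.ofReal (h ^ 0 * Real.exp (-(b * e / L * h))) := by
    filter_upwards [ae_gammaMeasure_nonneg _ _] with h hh
    have := expMeasure_lt_ofReal_div hb (ENNReal.ofReal e * (ENNReal.ofReal (h / L) + z))
    refine this.trans ?_
    rw [powMulExp_mul _ _ he, powMulExp_ofReal_add _ _ (by positivity),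
      ← ENNReal.ofReal_mul (powMulExp_nonneg _ _ _)]
    congr 1
    simp only [pow_zero, zero_add, Finset.sum_range_one, Nat.choose_self, Nat.cast_one, one_mul,
      Nat.sub_self]
    congr 3
    ring
  rw [lintegral_congr_ae h1, lintegral_const_mul _ (by fun_prop),
    lintegral_gammaMeasure_pow_mul_exp hn hn hc 0, ← ENNReal.ofReal_mul (powMulExp_nonneg _ _ _)]
  congr 1
  have hG : Real.Gamma ((n + 1 : ℕ) : ℝ) ≠ 0 := (Real.Gamma_pos_of_pos hn).ne'
  rw [Nat.cast_zero, add_zero, Real.rpow_natCast, Real.rpow_natCast, div_eq_mul_inv (powMulExp _ _ _)]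
  congr 1
  rw [mul_comm, mul_div_mul_left _ _ hG, ← div_pow, ← inv_pow]
  congr 1
  field_simp

/-- The probability that the gamma channel beats the exponential channel and the interference. -/
lemma prod_uav (hL : 0 < L) (hb : 0 < b) (he : 0 < e) (z : ℝ≥0∞) :
    ((expMeasure 1).prod (gammaMeasure ((n + 1 : ℕ) : ℝ) ((n + 1 : ℕ) : ℝ)))
      {q | ENNReal.ofReal e * (ENNReal.ofReal (q.1 / b) + z) < ENNReal.ofReal (q.2 / L)}
      = ENNReal.ofReal (∑ l ∈ Finset.range (n + 1), ((n + 1 : ℕ) * L * e) ^ l / l ! *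
          ∑ q ∈ Finset.range (l + 1), (l.choose q : ℝ) * powMulExp q ((n + 1 : ℕ) * L * e) z *
            (b * (l - q)! / ((n + 1 : ℕ) * L * e + b) ^ (l - q + 1))) := by
  have hn : (0 : ℝ) < ((n + 1 : ℕ) : ℝ) := by positivity
  have := isProbabilityMeasure_gammaMeasure hn hn
  have := isProbabilityMeasure_expMeasure one_pos
  have hms : MeasurableSet {q : ℝ × ℝ |
      ENNReal.ofReal e * (ENNReal.ofReal (q.1 / b) + z) < ENNReal.ofReal (q.2 / L)} :=
    measurableSet_lt (by fun_prop) (by fun_prop)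
  set u : ℝ := (n + 1 : ℕ) * L * e with hu
  have hu0 : 0 < u := by positivity
  set F : ℝ → ℝ := fun v ↦ ∑ l ∈ Finset.range (n + 1), u ^ l / l ! *
    ∑ q ∈ Finset.range (l + 1), (l.choose q : ℝ) * powMulExp q u z * (1 / b) ^ (l - q) *
      (v ^ (l - q) * Real.exp (-(u / b * v))) with hF
  -- Given the exponential power v, the Erlang tail at e(v/b + z) expands by the binomial theorem
  -- into tilted moments of v.
  have h1 : ∀ᵐ v ∂expMeasure 1, gammaMeasure ((n + 1 : ℕ) : ℝ) ((n + 1 : ℕ) : ℝ)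
      (Prod.mk v ⁻¹' {q : ℝ × ℝ |
        ENNReal.ofReal e * (ENNReal.ofReal (q.1 / b) + z) < ENNReal.ofReal (q.2 / L)})
      = ENNReal.ofReal (F v) := by
    filter_upwards [ae_gammaMeasure_nonneg 1 1] with v hv
    refine (gammaMeasure_lt_ofReal_div n hn hL
      (ENNReal.ofReal e * (ENNReal.ofReal (v / b) + z))).trans ?_
    congr 1
    refine Finset.sum_congr rfl fun l _ ↦ ?_
    rw [powMulExp_mul _ _ he, powMulExp_ofReal_add _ _ (by positivity), hu, mul_pow _ e]
    rw [← mul_assoc, div_mul_eq_mul_div]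
    congr 1
    refine Finset.sum_congr rfl fun q _ ↦ ?_
    have : (n + 1 : ℕ) * L * e * (v / b) = (n + 1 : ℕ) * L * e / b * v := by ring
    rw [this, div_pow, one_div, inv_pow]
    ring
  have hFnn : 0 ≤ᵐ[expMeasure 1] F := by
    filter_upwards [ae_gammaMeasure_nonneg 1 1] with v hv
    refine Finset.sum_nonneg fun l _ ↦ mul_nonneg (by positivity) (Finset.sum_nonneg fun q _ ↦ ?_)
    have := powMulExp_nonneg q u z
    positivity
  have hub : 0 ≤ u / b := by positivity
  have hFi : ∀ l, ∀ q, Integrable (fun v ↦ (l.choose q : ℝ) * powMulExp q u z * (1 / b) ^ (l - q) *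
      (v ^ (l - q) * Real.exp (-(u / b * v)))) (expMeasure 1) := fun l q ↦
    (integral_expMeasure_pow_mul_exp hub (l - q)).1.const_mul _
  have hFs : ∀ l, Integrable (fun v ↦ u ^ l / l ! *
      ∑ q ∈ Finset.range (l + 1), (l.choose q : ℝ) * powMulExp q u z * (1 / b) ^ (l - q) *
        (v ^ (l - q) * Real.exp (-(u / b * v)))) (expMeasure 1) := fun l ↦
    (integrable_finsetSum _ fun q _ ↦ hFi l q).const_mul _
  rw [Measure.prod_apply hms, lintegral_congr_ae h1, ← ofReal_integral_eq_lintegral_ofReal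
    (integrable_finsetSum _ fun l _ ↦ hFs l) hFnn]
  congr 1
  rw [integral_finsetSum _ fun l _ ↦ hFs l]
  refine Finset.sum_congr rfl fun l _ ↦ ?_
  rw [integral_const_mul, integral_finsetSum _ fun q _ ↦ hFi l q]
  congr 1
  refine Finset.sum_congr rfl fun q _ ↦ ?_
  rw [integral_const_mul, (integral_expMeasure_pow_mul_exp hub (l - q)).2, mul_assoc (_ * _)]
  congr 1
  have : 1 + u / b = (u + b) / b := by field_simp; ring
  rw [this, div_pow (u + b), one_div, inv_pow, pow_succ b]
  field_simp

/-- The probability that the sum of the gamma and the exponential channels beats the interference. -/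
lemma prod_coop (hL : 0 < L) (hb : 0 < b) (he : 0 < e) (hne : (n + 1 : ℕ) * L ≠ b) (z : ℝ≥0∞) :
    ((expMeasure 1).prod (gammaMeasure ((n + 1 : ℕ) : ℝ) ((n + 1 : ℕ) : ℝ)))
      {q | ENNReal.ofReal e * z < ENNReal.ofReal (q.2 / L) + ENNReal.ofReal (q.1 / b)}
      = ENNReal.ofReal (({⊤}ᶜ : Set ℝ≥0∞).indicator (fun z ↦ erlangMix (n + 1) ((n + 1 : ℕ) : ℝ) (b / L)
          (L * (e * z.toReal))) z) := by
  have hn : (0 : ℝ) < ((n + 1 : ℕ) : ℝ) := by positivity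
  have := isProbabilityMeasure_gammaMeasure hn hn
  have := isProbabilityMeasure_expMeasure one_pos
  by_cases hz : z = ⊤
  · simp [hz, ENNReal.mul_top, he]
  have hms : MeasurableSet {q : ℝ × ℝ |
      ENNReal.ofReal e * z < ENNReal.ofReal (q.2 / L) + ENNReal.ofReal (q.1 / b)} :=
    measurableSet_lt (by fun_prop) (by fun_prop)
  rw [indicator_of_mem (show z ∈ ({⊤}ᶜ : Set ℝ≥0∞) from hz), Measure.prod_apply_symm hms]
  set ρ : ℝ := ((n + 1 : ℕ) : ℝ) with hρ
  set x : ℝ := e * z.toReal with hx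
  have hx0 : 0 ≤ x := mul_nonneg he.le ENNReal.toReal_nonneg
  have hxz : ENNReal.ofReal e * z = ENNReal.ofReal x := by
    rw [hx, ENNReal.ofReal_mul he.le, ENNReal.ofReal_toReal hz]
  have hLx : 0 ≤ L * x := by positivity
  have hne' : ρ ≠ b / L := fun h ↦ hne (by rw [h]; field_simp)
  rw [hxz]
  set G : ℝ → ℝ≥0∞ := fun h ↦ expMeasure 1 ((fun x ↦ (x, h)) ⁻¹' {q : ℝ × ℝ |
    ENNReal.ofReal x < ENNReal.ofReal (q.2 / L) + ENNReal.ofReal (q.1 / b)}) with hG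
  -- If h ≤ Lx, the exponential channel has to supply the missing x - h/L; if h > Lx, the gamma
  -- channel suffices alone. In the scale of h the exponential rate is b/L.
  have h1 : ∫⁻ h in Ioc 0 (L * x), G h ∂gammaMeasure ρ ρ
      = ENNReal.ofReal (erlangMix (n + 1) ρ (b / L) (L * x) - erlangTail (n + 1) (ρ * (L * x))) := by
    rw [← integral_erlang_mul_exp n hne', ← setLIntegral_Ioc_gammaMeasure n hn hLx
      (f := fun h ↦ Real.exp (-(b / L * (L * x - h)))) (by fun_prop) fun _ ↦ Real.exp_nonneg _]
    refine setLIntegral_congr_fun measurableSet_Ioc fun h hh ↦ ?_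
    have hh0 : 0 ≤ h / L := div_nonneg hh.1.le hL.le
    have hhx : 0 ≤ x - h / L := sub_nonneg.2 ((div_le_iff₀ hL).2 (by linarith [hh.2]))
    have hset : (fun x ↦ (x, h)) ⁻¹' {q : ℝ × ℝ |
        ENNReal.ofReal x < ENNReal.ofReal (q.2 / L) + ENNReal.ofReal (q.1 / b)}
        = {v | ENNReal.ofReal (x - h / L) < ENNReal.ofReal (v / b)} := by
      ext v
      simp only [mem_preimage, mem_ofPred_eq]
      have : ENNReal.ofReal x = ENNReal.ofReal (h / L) + ENNReal.ofReal (x - h / L) := by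
        rw [← ENNReal.ofReal_add hh0 hhx]; congr 1; ring
      rw [this]
      exact ENNReal.add_lt_add_iff_left ENNReal.ofReal_ne_top
    simp only [hG]
    rw [hset, expMeasure_lt_ofReal_div hb, powMulExp_of_ne_top _ _ ENNReal.ofReal_ne_top,
      ENNReal.toReal_ofReal hhx, pow_zero, one_mul]
    congr 3
    field_simp
  have h2 : ∫⁻ h in Ioi (L * x), G h ∂gammaMeasure ρ ρ
      = ENNReal.ofReal (erlangTail (n + 1) (ρ * (L * x))) := by
    rw [← gammaMeasure_Ioi n hn hLx, ← setLIntegral_one]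
    refine setLIntegral_congr_fun measurableSet_Ioi fun h hh ↦ ?_
    have hxh : x < h / L := (lt_div_iff₀ hL).2 (by linarith [mem_Ioi.1 hh])
    have hset : (fun x ↦ (x, h)) ⁻¹' {q : ℝ × ℝ |
        ENNReal.ofReal x < ENNReal.ofReal (q.2 / L) + ENNReal.ofReal (q.1 / b)} = univ := by
      refine eq_univ_of_forall fun v ↦ ?_
      exact ((ENNReal.ofReal_lt_ofReal_iff (hx0.trans_lt hxh)).2 hxh).trans_le le_self_add
    simp only [hG]
    rw [hset, measure_univ]
  have h3 : ∫⁻ h, G h ∂gammaMeasure ρ ρ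
      = ∫⁻ h in Ioc 0 (L * x), G h ∂gammaMeasure ρ ρ + ∫⁻ h in Ioi (L * x), G h ∂gammaMeasure ρ ρ := by
    rw [← lintegral_union measurableSet_Ioi (Ioc_disjoint_Ioi le_rfl), Ioc_union_Ioi_eq_Ioi hLx,
      ← lintegral_add_compl G measurableSet_Ioi (A := Ioi (0 : ℝ)), compl_Ioi,
      setLIntegral_measure_zero _ _ (gammaMeasure_Iic_zero ρ ρ), add_zero]
  have hnn : 0 ≤ erlangMix (n + 1) ρ (b / L) (L * x) - erlangTail (n + 1) (ρ * (L * x)) := by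
    rw [← integral_erlang_mul_exp n hne']
    exact intervalIntegral.integral_nonneg hLx fun h hh ↦ by have := hh.1; positivity
  have htail : 0 ≤ erlangTail (n + 1) (ρ * (L * x)) := Finset.sum_nonneg fun l _ ↦ by positivity
  rw [h3, h1, h2, ← ENNReal.ofReal_add hnn htail]
  congr 1
  ring

variable {κ : Measure ℝ≥0∞} [IsProbabilityMeasure κ] {Lap : ℝ → ℝ}

/-- The mean of the coverage probability of a user of type `bs` over the interference. -/
lemma integral_prod_bs (hL : 0 < L) (hb : 0 < b) (he : 0 < e) (hLap0 : ∀ u, 0 ≤ Lap u)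
    (hLap : ∀ u, 0 < u → ∫⁻ z, expNeg (ENNReal.ofReal u * z) ∂κ = ENNReal.ofReal (Lap u)) :
    ∫ z, ((expMeasure 1).prod (gammaMeasure ((n + 1 : ℕ) : ℝ) ((n + 1 : ℕ) : ℝ))).real
      {q | ENNReal.ofReal e * (ENNReal.ofReal (q.2 / L) + z) < ENNReal.ofReal (q.1 / b)} ∂κ
      = Lap (b * e) / (1 + b * e / (L * (n + 1 : ℕ))) ^ (n + 1) := by
  obtain ⟨hi, hv⟩ := integrable_powMulExp_and_integral hLap0 hLap 0 (mul_pos hb he)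
  have hnn : ∀ z, 0 ≤ powMulExp 0 (b * e) z / (1 + b * e / (L * (n + 1 : ℕ))) ^ (n + 1) := fun z ↦
    div_nonneg (powMulExp_nonneg _ _ _) (by positivity)
  simp only [measureReal_def, prod_bs n hL hb he, ENNReal.toReal_ofReal (hnn _)]
  rw [integral_div, hv]
  simp

/-- The mean of the coverage probability of a user of type `uav` over the interference. -/
lemma integral_prod_uav (hL : 0 < L) (hb : 0 < b) (he : 0 < e) (hLap0 : ∀ u, 0 ≤ Lap u)
    (hLap : ∀ u, 0 < u → ∫⁻ z, expNeg (ENNReal.ofReal u * z) ∂κ = ENNReal.ofReal (Lap u)) :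
    ∫ z, ((expMeasure 1).prod (gammaMeasure ((n + 1 : ℕ) : ℝ) ((n + 1 : ℕ) : ℝ))).real
      {q | ENNReal.ofReal e * (ENNReal.ofReal (q.1 / b) + z) < ENNReal.ofReal (q.2 / L)} ∂κ
      = ∑ l ∈ Finset.range (n + 1), (-((n + 1 : ℕ) * L * e)) ^ l / l ! *
          ∑ q ∈ Finset.range (l + 1), (l.choose q : ℝ) * iteratedDeriv q Lap ((n + 1 : ℕ) * L * e) *
            (b * (l - q)! * (-1) ^ (l - q) / ((n + 1 : ℕ) * L * e + b) ^ (l - q + 1)) := by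
  have hu0 : 0 < (n + 1 : ℕ) * L * e := by positivity
  have hnn : ∀ z, 0 ≤ ∑ l ∈ Finset.range (n + 1), ((n + 1 : ℕ) * L * e) ^ l / l ! *
      ∑ q ∈ Finset.range (l + 1), (l.choose q : ℝ) * powMulExp q ((n + 1 : ℕ) * L * e) z *
      (b * (l - q)! / ((n + 1 : ℕ) * L * e + b) ^ (l - q + 1)) := fun z ↦
    Finset.sum_nonneg fun l _ ↦ mul_nonneg (by positivity)
      (Finset.sum_nonneg fun q _ ↦ mul_nonneg (mul_nonneg (by positivity) (powMulExp_nonneg _ _ _))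
        (by positivity))
  simp only [measureReal_def, prod_uav n hL hb he, ENNReal.toReal_ofReal (hnn _)]
  have hi : ∀ l q, Integrable (fun z ↦ (l.choose q : ℝ) * powMulExp q ((n + 1 : ℕ) * L * e) z *
      (b * (l - q)! / ((n + 1 : ℕ) * L * e + b) ^ (l - q + 1))) κ := fun l q ↦
    ((integrable_powMulExp_and_integral hLap0 hLap q hu0).1.const_mul _).mul_const _
  have hs : ∀ l, Integrable (fun z ↦ ((n + 1 : ℕ) * L * e) ^ l / l ! *
      ∑ q ∈ Finset.range (l + 1), (l.choose q : ℝ) * powMulExp q ((n + 1 : ℕ) * L * e) z *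
      (b * (l - q)! / ((n + 1 : ℕ) * L * e + b) ^ (l - q + 1))) κ := fun l ↦
    (integrable_finsetSum _ fun q _ ↦ hi l q).const_mul _
  rw [integral_finsetSum _ fun l _ ↦ hs l]
  refine Finset.sum_congr rfl fun l _ ↦ ?_
  rw [integral_const_mul, integral_finsetSum _ fun q _ ↦ hi l q, neg_pow, mul_div_assoc, mul_comm ((-1) ^ l),
    mul_assoc (_ / _), Finset.mul_sum (Finset.range (l + 1)) _ ((-1 : ℝ) ^ l)]
  congr 1
  refine Finset.sum_congr rfl fun q hq ↦ ?_
  rw [integral_mul_const, integral_const_mul, (integrable_powMulExp_and_integral hLap0 hLap q hu0).2]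
  -- The signs of (-u)ˡ and of the derivatives of the transform of h₁ combine to the sign that ℒ⁽q⁾
  -- requires.
  have h1 : ((-1 : ℝ)) ^ l * (-1) ^ (l - q) = (-1) ^ q := by
    have hql : q ≤ l := Nat.lt_succ_iff.1 (Finset.mem_range.1 hq)
    obtain ⟨k, rfl⟩ := Nat.exists_eq_add_of_le hql
    rw [Nat.add_sub_cancel_left, pow_add, mul_assoc, ← mul_pow]
    simp
  rw [← h1]
  ring

/-- The mean of the coverage probability of a user of type `coop` over the interference. -/
lemma integral_prod_coop (hL : 0 < L) (hb : 0 < b) (he : 0 < e) (hne : (n + 1 : ℕ) * L ≠ b)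
    (hLap0 : ∀ u, 0 ≤ Lap u)
    (hLap : ∀ u, 0 < u → ∫⁻ z, expNeg (ENNReal.ofReal u * z) ∂κ = ENNReal.ofReal (Lap u)) :
    ∫ z, ((expMeasure 1).prod (gammaMeasure ((n + 1 : ℕ) : ℝ) ((n + 1 : ℕ) : ℝ))).real
      {q | ENNReal.ofReal e * z < ENNReal.ofReal (q.2 / L) + ENNReal.ofReal (q.1 / b)} ∂κ
      = ((n + 1 : ℕ) * L / ((n + 1 : ℕ) * L - b)) ^ (n + 1) * Lap (b * e)
        - ∑ i ∈ Finset.Icc 1 (n + 1), b / ((n + 1 : ℕ) * L - b) *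
          ((n + 1 : ℕ) * L / ((n + 1 : ℕ) * L - b)) ^ (n + 1 - i) *
          ∑ l ∈ Finset.range i, (-((n + 1 : ℕ) * L * e)) ^ l / l ! *
            iteratedDeriv l Lap ((n + 1 : ℕ) * L * e) := by
  have hn : (0 : ℝ) < ((n + 1 : ℕ) : ℝ) := by positivity
  have hu0 : 0 < (n + 1 : ℕ) * L * e := by positivity
  have hsub : (n + 1 : ℕ) * L - b ≠ 0 := sub_ne_zero.2 hne
  set β : ℝ := (n + 1 : ℕ) * L with hβ
  -- The coefficients depend only on the ratio of the rates, so the rates n + 1 and b/L may be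
  -- scaled by L to β₀ and β₁.
  have hR : ((n + 1 : ℕ) : ℝ) / (((n + 1 : ℕ) : ℝ) - b / L) = β / (β - b) := by
    have : ((n + 1 : ℕ) : ℝ) - b / L = (β - b) / L := by rw [hβ]; field_simp
    rw [this, div_div_eq_mul_div]
  have hC : b / L / (((n + 1 : ℕ) : ℝ) - b / L) = b / (β - b) := by
    have : ((n + 1 : ℕ) : ℝ) - b / L = (β - b) / L := by rw [hβ]; field_simp
    rw [this, div_div_div_cancel_right₀ hL.ne']
  set F : ℝ≥0∞ → ℝ := fun z ↦ (β / (β - b)) ^ (n + 1) * powMulExp 0 (b * e) z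
    - ∑ i ∈ Finset.Icc 1 (n + 1), b / (β - b) * (β / (β - b)) ^ (n + 1 - i) *
      ∑ l ∈ Finset.range i, (β * e) ^ l / l ! * powMulExp l (β * e) z with hF
  have hind : ∀ z, ({⊤}ᶜ : Set ℝ≥0∞).indicator (fun z ↦ erlangMix (n + 1) ((n + 1 : ℕ) : ℝ) (b / L)
      (L * (e * z.toReal))) z = F z := fun z ↦ by
    by_cases hz : z = ⊤
    · rw [indicator_of_notMem (by simp [hz]), hF]
      simp [hz, powMulExp_top]
    · rw [indicator_of_mem (show z ∈ ({⊤}ᶜ : Set ℝ≥0∞) from hz)]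
      simp only [hF, erlangMix, hR, hC, powMulExp_of_ne_top _ _ hz, erlangTail]
      congr 1
      · rw [pow_zero, one_mul]
        congr 3
        field_simp
      · refine Finset.sum_congr rfl fun i _ ↦ ?_
        congr 1
        refine Finset.sum_congr rfl fun l _ ↦ ?_
        have : ((n + 1 : ℕ) : ℝ) * (L * (e * z.toReal)) = β * e * z.toReal := by rw [hβ]; ring
        rw [this, mul_pow _ z.toReal]
        ring
  -- F has terms of both signs. It is nonnegative as an Erlang tail plus the integral of a
  -- nonnegative function.
  have hFnn : ∀ z, 0 ≤ F z := fun z ↦ by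
    rw [← hind]
    refine indicator_nonneg (fun z _ ↦ ?_) z
    have hy : 0 ≤ L * (e * z.toReal) := mul_nonneg hL.le (mul_nonneg he.le ENNReal.toReal_nonneg)
    have hne' : ((n + 1 : ℕ) : ℝ) ≠ b / L := fun h ↦ hne (by rw [hβ, h]; field_simp)
    have h1 := integral_erlang_mul_exp n hne' (L * (e * z.toReal))
    have h2 : 0 ≤ erlangTail (n + 1) (((n + 1 : ℕ) : ℝ) * (L * (e * z.toReal))) :=
      Finset.sum_nonneg fun l _ ↦ by positivity
    have h3 : 0 ≤ erlangMix (n + 1) ((n + 1 : ℕ) : ℝ) (b / L) (L * (e * z.toReal))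
        - erlangTail (n + 1) (((n + 1 : ℕ) : ℝ) * (L * (e * z.toReal))) := by
      rw [← h1]
      exact intervalIntegral.integral_nonneg hy fun h hh ↦ by have := hh.1; positivity
    linarith
  have hi : ∀ l, Integrable (fun z ↦ (β * e) ^ l / l ! * powMulExp l (β * e) z) κ := fun l ↦
    (integrable_powMulExp_and_integral hLap0 hLap l hu0).1.const_mul _
  have hs : ∀ i, Integrable (fun z ↦ b / (β - b) * (β / (β - b)) ^ (n + 1 - i) *
      ∑ l ∈ Finset.range i, (β * e) ^ l / l ! * powMulExp l (β * e) z) κ := fun i ↦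
    (integrable_finsetSum _ fun l _ ↦ hi l).const_mul _
  obtain ⟨h0, hv0⟩ := integrable_powMulExp_and_integral hLap0 hLap 0 (mul_pos hb he)
  simp only [measureReal_def, prod_coop n hL hb he hne, hind, ENNReal.toReal_ofReal (hFnn _)]
  rw [hF, integral_sub (h0.const_mul _) (integrable_finsetSum _ fun i _ ↦ hs i), integral_const_mul, hv0,
    integral_finsetSum _ fun i _ ↦ hs i]
  congr 1
  · simp
  · refine Finset.sum_congr rfl fun i _ ↦ ?_
    rw [integral_const_mul, integral_finsetSum _ fun l _ ↦ hi l]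
    congr 1
    refine Finset.sum_congr rfl fun l _ ↦ ?_
    rw [integral_const_mul, (integrable_powMulExp_and_integral hLap0 hLap l hu0).2, neg_pow (β * e)]
    ring

end Coverage

/-! ### Matching with the formulas for P¹, P², P³ and with the ranges of r₁ -/

/-- The coverage event of a user of each type in terms of the interference and of the fading powers
of the nearest ground BS and of the UAV, for path losses `L` and `b` and threshold `e`. -/
def coverSet (L b e : ℝ) : Region → Set (ℝ≥0∞ × ℝ × ℝ)
  | .bs => {x | ENNReal.ofReal e * (ENNReal.ofReal (x.2.2 / L) + x.1) < ENNReal.ofReal (x.2.1 / b)}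
  | .coop => {x | ENNReal.ofReal e * x.1 < ENNReal.ofReal (x.2.2 / L) + ENNReal.ofReal (x.2.1 / b)}
  | .uav => {x | ENNReal.ofReal e * (ENNReal.ofReal (x.2.1 / b) + x.1) < ENNReal.ofReal (x.2.2 / L)}

namespace NetParams

variable {p : NetParams} {r₀ : ℝ} {s : LinkState}

lemma airLoss_pos (hH : 0 < p.H) : 0 < p.airLoss r₀ s :=
  Real.rpow_pos_of_pos (Real.sqrt_pos.2 (by positivity)) _

lemma rpow_half_eq_airLoss : (p.H ^ 2 + r₀ ^ 2) ^ (p.alpha s / 2) = p.airLoss r₀ s := by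
  rw [airLoss, Real.sqrt_eq_rpow, ← Real.rpow_mul (by positivity)]
  congr 1
  ring

lemma one_le_m (hmL : 1 ≤ p.mL) (s : LinkState) : 1 ≤ p.m s := by
  cases s
  · exact hmL
  · exact le_rfl

/-- Since the second shape is 1, the factorials in A_{jk} cancel and the coefficients are powers of
β₀/(β₀ - β₁), as in the Erlang convolution. -/
lemma cov2_eq {n : ℕ} (hm : p.m s = n + 1) {r : ℝ} (hb : 0 < r ^ p.alphaN) (hL : 0 < p.airLoss r₀ s)
    (hne : (n + 1 : ℕ) * p.airLoss r₀ s ≠ r ^ p.alphaN) :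
    p.cov2 r₀ s r = ((n + 1 : ℕ) * p.airLoss r₀ s / ((n + 1 : ℕ) * p.airLoss r₀ s - r ^ p.alphaN)) ^ (n + 1)
        * p.lap r₀ r (r ^ p.alphaN * p.eps)
      - ∑ i ∈ Finset.Icc 1 (n + 1), r ^ p.alphaN / ((n + 1 : ℕ) * p.airLoss r₀ s - r ^ p.alphaN) *
        ((n + 1 : ℕ) * p.airLoss r₀ s / ((n + 1 : ℕ) * p.airLoss r₀ s - r ^ p.alphaN)) ^ (n + 1 - i) *
        ∑ l ∈ Finset.range i, (-((n + 1 : ℕ) * p.airLoss r₀ s * p.eps)) ^ l / l ! *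
          iteratedDeriv l (p.lap r₀ r) ((n + 1 : ℕ) * p.airLoss r₀ s * p.eps) := by
  have hr0 : p.rate r₀ s r 0 = (n + 1 : ℕ) * p.airLoss r₀ s := by
    simp [rate, hm, rpow_half_eq_airLoss]
  have hr1 : p.rate r₀ s r 1 = r ^ p.alphaN := by simp [rate]
  have hs0 : p.shape s 0 = n + 1 := by simp [shape, hm]
  have hs1 : p.shape s 1 = 1 := by simp [shape]
  have hβ : 0 < (n + 1 : ℕ) * p.airLoss r₀ s := by positivity
  set β := (n + 1 : ℕ) * p.airLoss r₀ s
  set b := r ^ p.alphaN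
  have hsub : β - b ≠ 0 := sub_ne_zero.2 hne
  -- With d = n + 1 - k, the explicit sign (-1)ᵈ meets (-1)^(d+1) from (b - β)^(-(d+1)), which
  -- leaves a single minus.
  have hf0 : ∀ k ∈ Finset.Icc 1 (n + 1), p.fracCoeff r₀ s r 0 k / β ^ k
      = -(b / (β - b) * (β / (β - b)) ^ (n + 1 - k)) := fun k hk ↦ by
    obtain ⟨hk1, hk2⟩ := Finset.mem_Icc.1 hk
    obtain ⟨d, hd⟩ := Nat.exists_eq_add_of_le hk2
    simp only [fracCoeff, hr0, hs0, sub_zero, hr1, hs1, hd]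
    have e1 : k + d - k = d := by omega
    have e2 : 1 + (k + d) - k - 1 = d := by omega
    have e3 : (-((1 : ℕ) : ℤ) - ((k + d : ℕ) : ℤ) + (k : ℤ)) = -((d + 1 : ℕ) : ℤ) := by
      push_cast; ring
    have e4 : b - β = -(β - b) := by ring
    rw [e1, e2, e3, zpow_neg, zpow_natCast, e4, neg_pow (β - b), pow_add, div_pow]
    have h1 : ((-1 : ℝ) ^ (d + 1))⁻¹ = (-1) ^ (d + 1) := by
      rw [← inv_pow]; norm_num
    rw [mul_inv, h1]
    have h2 : (-1 : ℝ) ^ d * (-1) ^ d = 1 := by rw [← mul_pow]; simp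
    have h3 : (d ! : ℝ) ≠ 0 := by positivity
    simp only [Nat.sub_self, Nat.factorial_zero, Nat.cast_one, mul_one, pow_one]
    rw [mul_div_cancel_right₀ _ h3]
    have h4 : β ^ k / β ^ k = 1 := div_self (by positivity)
    rw [pow_succ (β - b), mul_inv ((β - b) ^ d)]
    calc _ = -((-1) ^ d * (-1) ^ d) * (β ^ k / β ^ k) * (b / (β - b) * (β ^ d / (β - b) ^ d)) := by ring
      _ = _ := by rw [h2, h4]; ring
  have hf1 : p.fracCoeff r₀ s r 1 1 / b ^ 1 = (β / (β - b)) ^ (n + 1) := by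
    simp only [fracCoeff, hr0, hs0, sub_self, hr1, hs1]
    have e2 : n + 1 + 1 - 1 - 1 = n := by omega
    have e3 : (-((n + 1 : ℕ) : ℤ) - ((1 : ℕ) : ℤ) + ((1 : ℕ) : ℤ)) = -((n + 1 : ℕ) : ℤ) := by
      push_cast; ring
    rw [e2, e3, zpow_neg, zpow_natCast, div_pow]
    have h3 : (n ! : ℝ) ≠ 0 := by positivity
    simp only [Nat.sub_self, Nat.factorial_zero, Nat.cast_one, one_mul, pow_one, pow_zero,
      Nat.add_sub_cancel]
    rw [mul_div_cancel_right₀ _ h3]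
    field_simp
  rw [cov2, Fin.sum_univ_two, hs0, hs1, Finset.Icc_self, Finset.sum_singleton, hr0, hr1, hf1,
    Finset.sum_congr rfl fun k hk ↦ by rw [hf0 k hk]]
  simp only [neg_mul, Finset.sum_neg_distrib]
  simp
  ring

/-- The conditional coverage probability given `r₁` is `cov`. -/
lemma integral_coverSet (hH : 0 < p.H) (hmL : 1 ≤ p.mL) (heps : 0 < p.eps) {r : ℝ} (hr : 0 < r)
    {κ : Measure ℝ≥0∞} [IsProbabilityMeasure κ]
    (hκ : ∀ u, 0 < u → ∫⁻ z, expNeg (ENNReal.ofReal u * z) ∂κ = ENNReal.ofReal (p.lap r₀ r u))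
    (hne : p.m s * p.airLoss r₀ s ≠ r ^ p.alphaN) (i : Region) :
    ∫ z, ((expMeasure 1).prod (gammaMeasure (p.m s) (p.m s))).real
      (Prod.mk z ⁻¹' coverSet (p.airLoss r₀ s) (r ^ p.alphaN) p.eps i) ∂κ = p.cov r₀ s i r := by
  obtain ⟨n, hn⟩ := Nat.exists_eq_add_of_le' (one_le_m hmL s)
  rw [hn] at hne ⊢
  have hL : 0 < p.airLoss r₀ s := airLoss_pos hH
  have hb : 0 < r ^ p.alphaN := Real.rpow_pos_of_pos hr _
  have hLap0 : ∀ u, 0 ≤ p.lap r₀ r u := fun u ↦ Real.exp_nonneg _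
  cases i with
  | bs =>
    refine (integral_prod_bs n hL hb heps hLap0 hκ).trans ?_
    rw [cov, cov1, rpow_half_eq_airLoss, hn]
  | coop =>
    refine (integral_prod_coop n hL hb heps hne hLap0 hκ).trans ?_
    rw [cov, cov2_eq hn hb hL hne]
  | uav =>
    refine (integral_prod_uav n hL hb heps hLap0 hκ).trans ?_
    simp only [cov, cov3, rpow_half_eq_airLoss, hn, lapTotalDeriv, lapNearestDeriv]

lemma thresholdA_nonneg (hH : 0 < p.H) (hdelta0 : 0 ≤ p.delta) : 0 ≤ p.thresholdA r₀ s :=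
  Real.rpow_nonneg (mul_nonneg hdelta0 (airLoss_pos hH).le) _

lemma rpow_le_iff_le_thresholdA (hH : 0 < p.H) (hα : 2 < p.alphaN) (hdelta0 : 0 ≤ p.delta) {r : ℝ}
    (hr : 0 < r) : r ^ p.alphaN ≤ p.delta * p.airLoss r₀ s ↔ r ≤ p.thresholdA r₀ s := by
  rw [thresholdA, one_div, Real.le_rpow_inv_iff_of_pos hr.le (mul_nonneg hdelta0 (airLoss_pos hH).le)
    (by linarith)]

lemma rpow_le_iff_le_thresholdB (hα : 2 < p.alphaN) {r : ℝ} (hr : 0 < r) :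
    ENNReal.ofReal (r ^ p.alphaN) ≤ p.upperLevel r₀ s ↔ ENNReal.ofReal r ≤ p.thresholdB r₀ s := by
  rw [thresholdB, one_div, ENNReal.le_rpow_inv_iff (by linarith), ENNReal.ofReal_rpow_of_pos hr]

/-- For δ ≤ 1 the lower level δ d^α_s is at most d^α_s, and hence at most the upper level; the three
ranges are therefore disjoint. -/
lemma rpow_le_upperLevel (hH : 0 < p.H) (hdelta1 : p.delta ≤ 1) {x : ℝ}
    (hx : x ≤ p.delta * p.airLoss r₀ s) : ENNReal.ofReal x ≤ p.upperLevel r₀ s := by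
  have hL : 0 < p.airLoss r₀ s := airLoss_pos hH
  have h1 : x ≤ p.airLoss r₀ s := hx.trans (mul_le_of_le_one_left hL.le hdelta1)
  calc ENNReal.ofReal x ≤ 1 * ENNReal.ofReal (p.airLoss r₀ s) := by
        rw [one_mul]; exact ENNReal.ofReal_le_ofReal h1
    _ ≤ _ := by
        rw [upperLevel]
        gcongr
        exact ENNReal.one_le_inv.2 (ENNReal.ofReal_le_one.2 hdelta1)

/-- The type of a user is decided by the range of `r₁`. -/
lemma regionOf_eq_iff (hH : 0 < p.H) (hα : 2 < p.alphaN) (hdelta0 : 0 ≤ p.delta)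
    (hdelta1 : p.delta ≤ 1) {r : ℝ} (hr : 0 < r) (i : Region) :
    p.regionOf r₀ s r = i ↔ r ∈ p.range r₀ s i := by
  have hA := rpow_le_iff_le_thresholdA (r₀ := r₀) (s := s) hH hα hdelta0 hr
  have hB := rpow_le_iff_le_thresholdB (r₀ := r₀) (s := s) hα hr
  have hAB : r ≤ p.thresholdA r₀ s → ENNReal.ofReal r ≤ p.thresholdB r₀ s := fun h ↦
    hB.1 (rpow_le_upperLevel hH hdelta1 (hA.2 h))
  simp only [regionOf, hA, hB]
  by_cases h1 : r ≤ p.thresholdA r₀ s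
  · have h2 := hAB h1
    cases i <;> simp [range, h1, hr, h2]
  · by_cases h2 : ENNReal.ofReal r ≤ p.thresholdB r₀ s
    · cases i <;> simp [range, h1, h2, not_le.1 h1]
    · cases i <;> simp [range, h1, h2, not_le.1 h2]

lemma range_subset (hH : 0 < p.H) (hdelta0 : 0 ≤ p.delta) (i : Region) : p.range r₀ s i ⊆ Ioi 0 := by
  intro r hr
  cases i with
  | bs => exact hr.1
  | coop => exact (thresholdA_nonneg hH hdelta0).trans_lt hr.1
  | uav => exact ENNReal.ofReal_pos.1 (bot_le.trans_lt hr)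

lemma measurableSet_range (i : Region) : MeasurableSet (p.range r₀ s i) := by
  cases i with
  | bs => exact measurableSet_Ioc
  | coop =>
    exact (measurableSet_lt measurable_const measurable_id).inter
      (measurableSet_le ENNReal.measurable_ofReal measurable_const)
  | uav => exact measurableSet_lt measurable_const ENNReal.measurable_ofReal

end NetParams

/-! ### Regrouping independent variables, and the law of the network given the link state -/

section Independence

variable {Ω α β γ : Type*} [MeasurableSpace Ω] [MeasurableSpace α] [MeasurableSpace β]
  [MeasurableSpace γ] {μ : Measure Ω} {X : Ω → α} {Y : Ω → β} {Z : Ω → γ}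

/-- Under either bracketing the joint law is the product of the three marginals, by associativity of
product measures. -/
lemma ProbabilityTheory.IndepFun.prodMk_left_of_prodMk_right [IsProbabilityMeasure μ] (hX : Measurable X) (hY : Measurable Y)
    (hZ : Measurable Z) (h1 : IndepFun X (fun ω ↦ (Y ω, Z ω)) μ) (h2 : IndepFun Y Z μ) :
    IndepFun (fun ω ↦ (X ω, Y ω)) Z μ := by
  have := Measure.isProbabilityMeasure_map (μ := μ) hX.aemeasurable
  have := Measure.isProbabilityMeasure_map (μ := μ) hY.aemeasurable
  have := Measure.isProbabilityMeasure_map (μ := μ) hZ.aemeasurable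
  have h3 : IndepFun X Y μ := h1.comp measurable_id measurable_fst
  rw [indepFun_iff_map_prod_eq_prod_map_map (by fun_prop) (by fun_prop)] at h1 h2 h3 ⊢
  have h4 : (μ.map fun ω ↦ ((X ω, Y ω), Z ω)).map MeasurableEquiv.prodAssoc
      = (((μ.map X).prod (μ.map Y)).prod (μ.map Z)).map MeasurableEquiv.prodAssoc := by
    rw [Measure.prodAssoc_prod, Measure.map_map (MeasurableEquiv.measurable _) (by fun_prop), ← h2, ← h1]
    rfl
  rw [h3]
  exact (MeasurableEquiv.prodAssoc.map_measurableEquiv_injective) h4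

lemma ProbabilityTheory.IndepFun.prodMk_right_of_prodMk_left [IsProbabilityMeasure μ] (hX : Measurable X) (hY : Measurable Y)
    (hZ : Measurable Z) (h1 : IndepFun (fun ω ↦ (X ω, Y ω)) Z μ) (h2 : IndepFun X Y μ) :
    IndepFun X (fun ω ↦ (Y ω, Z ω)) μ := by
  have h3 : IndepFun Z (fun ω ↦ (Y ω, X ω)) μ := h1.symm.comp measurable_id measurable_swap
  exact (h3.prodMk_left_of_prodMk_right hZ hY hX h2.symm).symm.comp measurable_id measurable_swap

/-- Disjoint sets of indices, here {0} and its complement, generate independent σ-algebras. -/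
lemma ProbabilityTheory.iIndepFun.indepFun_tail {g : ℕ → Ω → α} (hg : ∀ i, Measurable (g i))
    (h : iIndepFun g μ) : IndepFun (fun ω i ↦ g (i + 1) ω) (g 0) μ := by
  rw [IndepFun_iff_Indep]
  have h1 := indep_iSup_of_disjoint (fun i ↦ (hg i).comap_le) h
    (S := {0}ᶜ) (T := {0}) disjoint_compl_left
  refine indep_of_indep_of_le_left (indep_of_indep_of_le_right h1 ?_) ?_
  · exact le_iSup₂_of_le 0 rfl le_rfl
  · refine Measurable.comap_le ?_
    refine @measurable_pi_lambda _ _ _ (_) _ _ fun i ↦ ?_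
    exact (comap_measurable (g (i + 1))).mono (le_iSup₂_of_le (i + 1) (by simp) le_rfl) le_rfl

end Independence

section Network

variable {Ω : Type*} [MeasurableSpace Ω] {μ : Measure Ω} {p : NetParams} {r₀ : ℝ}
  {Φ : Ω → Set (EuclideanSpace ℝ (Fin 2))} {y : ℕ → Ω → EuclideanSpace ℝ (Fin 2)}
  {g : ℕ → Ω → ℝ} {g0 : LinkState → Ω → ℝ} {S : Ω → LinkState} [IsProbabilityMeasure μ]

lemma IsNetwork.indepFun_fading (h : IsNetwork μ p r₀ Φ y g g0 S) (s : LinkState) :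
    IndepFun (fun ω ↦ (g 0 ω, g0 s ω)) S μ := by
  have hg := h.measurable_g
  have hg0 := h.measurable_g0
  have hS := h.measurable_S
  let F : (ℕ → ℝ) → ℝ := fun f ↦ f 0
  have hF : Measurable F := measurable_pi_apply 0
  let G : (LinkState → ℝ) × LinkState → ℝ × LinkState := fun x ↦ (x.1 s, x.2)
  have hG : Measurable G := by fun_prop
  have h1 : IndepFun (g 0) (fun ω ↦ (g0 s ω, S ω)) μ := h.indep_g.comp hF hG
  have h2 : IndepFun (g0 s) S μ := h.indep_g0.comp (measurable_pi_apply s) measurable_id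
  exact h1.prodMk_left_of_prodMk_right (hg 0) (hg0 s) hS h2

/-- The left pair is a function of the stations and of the fading powers of index at least 1. The
regrouping moves g 0 to the side of the air-to-ground variables. -/
lemma IsNetwork.indepFun_interference (h : IsNetwork μ p r₀ Φ y g g0 S) (s : LinkState) :
    IndepFun (fun ω ↦ (ueDist r₀ y 0 ω, farInterference p r₀ y g ω))
      (fun ω ↦ ((g 0 ω, g0 s ω), S ω)) μ := by
  have hg := h.measurable_g
  have hg0 := h.measurable_g0
  have hS := h.measurable_S
  have hy := h.measurable_y
  have hgt : Measurable fun ω i ↦ g (i + 1) ω := measurable_pi_lambda _ fun i ↦ hg _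
  have hyy : Measurable fun ω i ↦ y i ω := measurable_pi_lambda _ hy
  have hgg : Measurable fun ω s ↦ g0 s ω := measurable_pi_lambda _ hg0
  let σ : (ℕ → ℝ) → (ℕ → ℝ) × ℝ := fun f ↦ (fun i ↦ f (i + 1), f 0)
  have hσ : Measurable σ := by fun_prop
  have h1 : IndepFun (fun ω ↦ ((fun i ↦ g (i + 1) ω), g 0 ω)) (fun ω ↦ ((fun s ↦ g0 s ω), S ω)) μ :=
    h.indep_g.comp hσ measurable_id
  have h2 := h1.prodMk_right_of_prodMk_left hgt (hg 0) (hgg.prodMk hS)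
    (h.iIndepFun_g.indepFun_tail hg)
  let τ : (ℕ → ℝ) × (LinkState → ℝ) × LinkState → (ℕ → ℝ) × ℝ × (LinkState → ℝ) × LinkState :=
    fun x ↦ (fun i ↦ x.1 (i + 1), x.1 0, x.2)
  have hτ : Measurable τ := by fun_prop
  have h3 : IndepFun (fun ω i ↦ y i ω)
      (fun ω ↦ ((fun i ↦ g (i + 1) ω), g 0 ω, (fun s ↦ g0 s ω), S ω)) μ :=
    h.indep_y.comp measurable_id hτ
  have h4 := h3.prodMk_left_of_prodMk_right hyy hgt ((hg 0).prodMk (hgg.prodMk hS)) h2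
  let F : (ℕ → EuclideanSpace ℝ (Fin 2)) × (ℕ → ℝ) → ℝ × ℝ≥0∞ := fun x ↦
    (dist (x.1 0) (uePos r₀),
      ∑' i, ENNReal.ofReal (x.2 i / dist (x.1 (i + 1)) (uePos r₀) ^ p.alphaN))
  have hF : Measurable F := by
    refine Measurable.prodMk ((NetParams.measurable_dist_uePos r₀).comp (by fun_prop))
      (Measurable.tsum fun i ↦ Measurable.ennreal_ofReal ?_)
    exact Measurable.div (by fun_prop)
      (((NetParams.measurable_dist_uePos r₀).comp (by fun_prop)).pow_const _)
  let G : ℝ × (LinkState → ℝ) × LinkState → (ℝ × ℝ) × LinkState := fun x ↦ ((x.1, x.2.1 s), x.2.2)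
  have hG : Measurable G := by fun_prop
  exact h4.comp hF hG

/-- The conditional law of the network given the link state. -/
lemma IsNetwork.measure_inter_preimage (h : IsNetwork μ p r₀ Φ y g g0 S) (hRc : 0 < p.Rc)
    (hr0 : 0 ≤ r₀) (hr0Rc : r₀ ≤ p.Rc) (hlam : 0 < p.lam) (hα : 2 < p.alphaN) (hmL : 1 ≤ p.mL)
    (s : LinkState) {T : Set ((ℝ × ℝ≥0∞) × ℝ × ℝ)} (hT : MeasurableSet T) :
    μ (S ⁻¹' {s} ∩
        (fun ω ↦ ((ueDist r₀ y 0 ω, farInterference p r₀ y g ω), (g 0 ω, g0 s ω))) ⁻¹' T)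
      = μ (S ⁻¹' {s}) * ∫⁻ r, ∫⁻ z,
        ((expMeasure 1).prod (gammaMeasure (p.m s) (p.m s))) (Prod.mk (r, z) ⁻¹' T)
          ∂condDistrib (farInterference p r₀ y g) (ueDist r₀ y 0) μ r ∂p.nearestLaw r₀ := by
  have hg := h.measurable_g
  have hg0 := h.measurable_g0
  have hS := h.measurable_S
  have hD := h.measurable_ueDist 0
  have hI := h.measurable_farInterference
  have hm : (0 : ℝ) < p.m s := by exact_mod_cast NetParams.one_le_m hmL s
  have := isProbabilityMeasure_gammaMeasure hm hm
  have := isProbabilityMeasure_expMeasure one_pos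
  have hlaw := h.map_ueDist hRc hr0 hr0Rc hlam hα
  have hU : Measurable fun ω ↦ (g 0 ω, g0 s ω) := (hg 0).prodMk (hg0 s)
  have hW : Measurable fun ω ↦ (ueDist r₀ y 0 ω, farInterference p r₀ y g ω) := hD.prodMk hI
  have h1 := (h.indepFun_interference s).prodMk_left_of_prodMk_right hW hU hS (h.indepFun_fading s)
  have h2 : IndepFun (fun ω ↦ (ueDist r₀ y 0 ω, farInterference p r₀ y g ω))
      (fun ω ↦ (g 0 ω, g0 s ω)) μ := (h.indepFun_interference s).comp measurable_id measurable_fst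
  let G : (LinkState → ℝ) × LinkState → ℝ := fun x ↦ x.1 s
  have hG : Measurable G := by fun_prop
  have h3 : IndepFun (g 0) (g0 s) μ := h.indep_g.comp (measurable_pi_apply 0) hG
  have hprob : IsProbabilityMeasure (p.nearestLaw r₀) := by
    rw [← hlaw]; exact Measure.isProbabilityMeasure_map hD.aemeasurable
  have hlawW : μ.map (fun ω ↦ (ueDist r₀ y 0 ω, farInterference p r₀ y g ω))
      = p.nearestLaw r₀ ⊗ₘ condDistrib (farInterference p r₀ y g) (ueDist r₀ y 0) μ := by
    rw [← hlaw]
    exact (compProd_map_condDistrib hI.aemeasurable).symm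
  have hlawU : μ.map (fun ω ↦ (g 0 ω, g0 s ω))
      = (expMeasure 1).prod (gammaMeasure (p.m s) (p.m s)) := by
    rw [(indepFun_iff_map_prod_eq_prod_map_map (hg 0).aemeasurable (hg0 s).aemeasurable).1 h3,
      (h.hasLaw_g 0).map_eq, (h.hasLaw_g0 s).map_eq]
  have hlawWU := (indepFun_iff_map_prod_eq_prod_map_map hW.aemeasurable hU.aemeasurable).1 h2
  rw [inter_comm, h1.measure_inter_preimage_eq_mul _ _ hT (measurableSet_singleton s), mul_comm]
  congr 1
  rw [← Measure.map_apply (hW.prodMk hU) hT, hlawWU, hlawW, hlawU, Measure.prod_apply hT,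
    Measure.lintegral_compProd (measurable_measure_prodMk_left hT)]

end Network

/-- The event that a user is of type `i` and covered, in terms of the distance to the nearest ground
BS, of the far interference and of the fading powers of the nearest ground BS and of the UAV. -/
def NetParams.coveredSet (p : NetParams) (r₀ : ℝ) (s : LinkState) (i : Region) :
    Set ((ℝ × ℝ≥0∞) × ℝ × ℝ) :=
  {x | x.1.1 ∈ p.range r₀ s i ∧ (x.1.2, x.2) ∈ coverSet (p.airLoss r₀ s) (x.1.1 ^ p.alphaN) p.eps i}

namespace NetParams

variable {p : NetParams} {r₀ : ℝ}

lemma measurableSet_coveredSet (s : LinkState) (i : Region) :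
    MeasurableSet (p.coveredSet r₀ s i) := by
  refine ((measurableSet_range i).preimage (measurable_fst.comp measurable_fst)).inter ?_
  cases i
  all_goals exact measurableSet_lt (by fun_prop) (by fun_prop)

/-- Makes conditioning on the link state meaningful. -/
lemma linkProb_pos (hC : 0 < p.C) (s : LinkState) : 0 < p.linkProb r₀ s := by
  have h : 0 < p.C * Real.exp (-p.B * (p.elevation r₀ - p.C)) := by positivity
  cases s
  · exact div_pos one_pos (by linarith)
  · exact sub_pos.2 ((div_lt_one (by linarith)).2 (by linarith))

end NetParams

section Covered

variable {Ω : Type*} {p : NetParams} {r₀ : ℝ} {y : ℕ → Ω → EuclideanSpace ℝ (Fin 2)}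
  {g : ℕ → Ω → ℝ} {g0 : LinkState → Ω → ℝ} {S : Ω → LinkState}

/-- Clearing the denominator is allowed even when it is 0 or ∞, because the threshold is positive
and finite. -/
lemma lt_sir_iff_mem_coverSet (heps : 0 < p.eps) {ω : Ω} {s : LinkState} (hs : S ω = s) (i : Region) :
    ENNReal.ofReal p.eps < sir p r₀ y g g0 S ω i ↔
      (farInterference p r₀ y g ω, g 0 ω, g0 s ω)
        ∈ coverSet (p.airLoss r₀ s) (ueDist r₀ y 0 ω ^ p.alphaN) p.eps i := by
  have h0 : ENNReal.ofReal p.eps ≠ 0 := by simpa using heps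
  have key : ∀ a b : ℝ≥0∞, ENNReal.ofReal p.eps < a / b ↔ ENNReal.ofReal p.eps * b < a := fun a b ↦
    ENNReal.lt_div_iff_mul_lt (Or.inr ENNReal.ofReal_ne_top) (Or.inr h0)
  subst hs
  cases i with
  | bs => exact key _ _
  | coop => exact key _ _
  | uav =>
    refine (key _ _).trans ?_
    rw [tsum_eq_zero_add' ENNReal.summable]
    rfl

lemma preimage_los_union_preimage_nlos (S : Ω → LinkState) (A : Set Ω) :
    A = (S ⁻¹' {.los} ∩ A) ∪ (S ⁻¹' {.nlos} ∩ A) := by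
  ext ω
  cases hω : S ω <;> simp [hω]

lemma covered_eq_union : covered p r₀ y g g0 S = coveredIn p r₀ y g g0 S .bs
    ∪ coveredIn p r₀ y g g0 S .coop ∪ coveredIn p r₀ y g g0 S .uav := by
  ext ω
  simp only [covered, coveredIn, mem_union, mem_ofPred_eq]
  cases ueRegion p r₀ y S ω <;> simp

lemma disjoint_coveredIn {i j : Region} (hij : i ≠ j) :
    Disjoint (coveredIn p r₀ y g g0 S i) (coveredIn p r₀ y g g0 S j) :=
  Set.disjoint_left.2 fun _ h1 h2 ↦ hij (h1.1.symm.trans h2.1)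

end Covered

/-! ### Assembly -/

section Network

variable {Ω : Type*} [MeasurableSpace Ω] {μ : Measure Ω} {p : NetParams} {r₀ : ℝ}
  {Φ : Ω → Set (EuclideanSpace ℝ (Fin 2))} {y : ℕ → Ω → EuclideanSpace ℝ (Fin 2)}
  {g : ℕ → Ω → ℝ} {g0 : LinkState → Ω → ℝ} {S : Ω → LinkState}

/-- Types and ranges of r₁ correspond only for positive distances, hence equality up to a null set.
The right side is measurable, so the coverage events are null-measurable. -/
lemma IsNetwork.inter_coveredIn_ae_eq (h : IsNetwork μ p r₀ Φ y g g0 S) (hH : 0 < p.H)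
    (hα : 2 < p.alphaN) (hdelta0 : 0 ≤ p.delta) (hdelta1 : p.delta ≤ 1) (heps : 0 < p.eps)
    (hr0 : 0 ≤ r₀) (hr0Rc : r₀ ≤ p.Rc) (s : LinkState) (i : Region) :
    (S ⁻¹' {s} ∩ coveredIn p r₀ y g g0 S i : Set Ω) =ᵐ[μ] (S ⁻¹' {s} ∩
      (fun ω ↦ ((ueDist r₀ y 0 ω, farInterference p r₀ y g ω), (g 0 ω, g0 s ω))) ⁻¹'
        p.coveredSet r₀ s i : Set Ω) := by
  filter_upwards [h.ueDist_pos hr0 hr0Rc] with ω hω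
  refine propext (and_congr_right fun hs ↦ ?_)
  have hs' : S ω = s := hs
  refine and_congr ?_ (lt_sir_iff_mem_coverSet heps hs' i)
  rw [ueRegion, hs']
  exact NetParams.regionOf_eq_iff hH hα hdelta0 hdelta1 (hω 0) i

lemma IsNetwork.nullMeasurableSet_inter_coveredIn (h : IsNetwork μ p r₀ Φ y g g0 S) (hH : 0 < p.H)
    (hα : 2 < p.alphaN) (hdelta0 : 0 ≤ p.delta) (hdelta1 : p.delta ≤ 1) (heps : 0 < p.eps)
    (hr0 : 0 ≤ r₀) (hr0Rc : r₀ ≤ p.Rc) (s : LinkState) (i : Region) :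
    NullMeasurableSet (S ⁻¹' {s} ∩ coveredIn p r₀ y g g0 S i) μ := by
  refine NullMeasurableSet.congr (MeasurableSet.nullMeasurableSet ?_)
    (h.inter_coveredIn_ae_eq hH hα hdelta0 hdelta1 heps hr0 hr0Rc s i).symm
  exact (h.measurable_S (measurableSet_singleton s)).inter (((h.measurable_ueDist 0).prodMk
    h.measurable_farInterference).prodMk ((h.measurable_g 0).prodMk (h.measurable_g0 s))
      (NetParams.measurableSet_coveredSet s i))

lemma IsNetwork.nullMeasurableSet_coveredIn (h : IsNetwork μ p r₀ Φ y g g0 S) (hH : 0 < p.H)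
    (hα : 2 < p.alphaN) (hdelta0 : 0 ≤ p.delta) (hdelta1 : p.delta ≤ 1) (heps : 0 < p.eps)
    (hr0 : 0 ≤ r₀) (hr0Rc : r₀ ≤ p.Rc) (i : Region) :
    NullMeasurableSet (coveredIn p r₀ y g g0 S i) μ := by
  rw [preimage_los_union_preimage_nlos S (coveredIn p r₀ y g g0 S i)]
  exact (h.nullMeasurableSet_inter_coveredIn hH hα hdelta0 hdelta1 heps hr0 hr0Rc .los i).union
    (h.nullMeasurableSet_inter_coveredIn hH hα hdelta0 hdelta1 heps hr0 hr0Rc .nlos i)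

lemma measureReal_covered {ν : Measure Ω} [IsFiniteMeasure ν]
    (h : ∀ i, NullMeasurableSet (coveredIn p r₀ y g g0 S i) ν) :
    ν.real (covered p r₀ y g g0 S) = ν.real (coveredIn p r₀ y g g0 S .bs)
      + ν.real (coveredIn p r₀ y g g0 S .coop) + ν.real (coveredIn p r₀ y g g0 S .uav) := by
  rw [covered_eq_union, measureReal_union₀ (h .uav) (Disjoint.aedisjoint (Disjoint.union_left
      (disjoint_coveredIn (by simp)) (disjoint_coveredIn (by simp)))),
    measureReal_union₀ (h .coop) (disjoint_coveredIn (by simp)).aedisjoint]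

variable [IsProbabilityMeasure μ]

/-- For a given link state, the coverage integral exists, and it is the conditional probability that
the user is of type `i` and covered. -/
lemma IsNetwork.integrableOn_and_measureReal_inter (h : IsNetwork μ p r₀ Φ y g g0 S) (hlam : 0 < p.lam)
    (hRc : 0 < p.Rc) (hH : 0 < p.H) (hα : 2 < p.alphaN) (hmL : 1 ≤ p.mL)
    (hdelta0 : 0 ≤ p.delta) (hdelta1 : p.delta ≤ 1) (heps : 0 < p.eps)
    (hr0 : 0 ≤ r₀) (hr0Rc : r₀ ≤ p.Rc) (s : LinkState) (i : Region) :
    IntegrableOn (fun r ↦ p.cov r₀ s i r * p.pdf r₀ r) (p.range r₀ s i) ∧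
      μ.real (S ⁻¹' {s} ∩ coveredIn p r₀ y g g0 S i) = p.linkProb r₀ s * p.Pc r₀ s i := by
  have hm : (0 : ℝ) < p.m s := by exact_mod_cast NetParams.one_le_m hmL s
  have := isProbabilityMeasure_gammaMeasure hm hm
  have := isProbabilityMeasure_expMeasure one_pos
  have hlaw := h.map_ueDist hRc hr0 hr0Rc hlam hα
  have hprob : IsProbabilityMeasure (p.nearestLaw r₀) := by
    rw [← hlaw]; exact Measure.isProbabilityMeasure_map (h.measurable_ueDist 0).aemeasurable
  set κ := condDistrib (farInterference p r₀ y g) (ueDist r₀ y 0) μ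
  set P := (expMeasure 1).prod (gammaMeasure (p.m s) (p.m s)) with hP
  have hT : MeasurableSet (p.coveredSet r₀ s i) := NetParams.measurableSet_coveredSet s i
  have hPm : Measurable fun x ↦ P (Prod.mk x ⁻¹' p.coveredSet r₀ s i) := measurable_measure_prodMk_left hT
  set J : ℝ → ℝ≥0∞ := fun r ↦ ∫⁻ z, P (Prod.mk (r, z) ⁻¹' p.coveredSet r₀ s i) ∂κ r with hJ
  have hJm : Measurable J := hPm.lintegral_kernel_prod_right'
  have hJ1 : ∀ r, J r ≤ 1 := fun r ↦ by
    calc J r ≤ ∫⁻ _, 1 ∂κ r := lintegral_mono fun z ↦ prob_le_one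
      _ = 1 := by simp
  -- Partial fractions fail only where β₀ = β₁. This is a single radius, and the law of the nearest
  -- distance has a density.
  have hβ : ∀ᵐ r ∂p.nearestLaw r₀, p.m s * p.airLoss r₀ s ≠ r ^ p.alphaN := by
    have hac : p.nearestLaw r₀ ≪ volume :=
      (withDensity_absolutelyContinuous _ _).trans Measure.absolutelyContinuous_restrict
    have h1 : ∀ᵐ r : ℝ, r ≠ (p.m s * p.airLoss r₀ s) ^ p.alphaN⁻¹ := by
      simp [ae_iff, measure_singleton]
    filter_upwards [hac.ae_le h1, NetParams.ae_nearestLaw] with r hr hr' heq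
    exact hr (by rw [heq, Real.rpow_rpow_inv hr'.1.le (by linarith)])
  -- J is a conditional probability, so it is measurable and at most 1; `cov` inherits its
  -- integrability through this equality.
  have hcov : (fun r ↦ (J r).toReal) =ᵐ[p.nearestLaw r₀] (p.range r₀ s i).indicator (p.cov r₀ s i) := by
    filter_upwards [h.lintegral_condDistrib hRc hr0 hr0Rc hlam hα, NetParams.ae_nearestLaw, hβ]
      with r hr hr' hrβ
    by_cases hri : r ∈ p.range r₀ s i
    · rw [indicator_of_mem hri, ← NetParams.integral_coverSet hH hmL heps hr'.1 hr hrβ i]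
      have hset : ∀ z, Prod.mk (r, z) ⁻¹' p.coveredSet r₀ s i
          = Prod.mk z ⁻¹' coverSet (p.airLoss r₀ s) (r ^ p.alphaN) p.eps i := fun z ↦ by
        ext x
        exact and_iff_right hri
      simp only [hJ, measureReal_def, ← hset, ← hP]
      exact (integral_toReal (hPm.comp measurable_prodMk_left).aemeasurable
        (ae_of_all _ fun z ↦ measure_lt_top _ _)).symm
    · rw [indicator_of_notMem hri]
      have hset : ∀ z, Prod.mk (r, z) ⁻¹' p.coveredSet r₀ s i = ∅ := fun z ↦ by
        ext x
        exact iff_of_false (fun hx ↦ hri hx.1) (notMem_empty x)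
      simp [hJ, hset]
  have hJi : Integrable (fun r ↦ (J r).toReal) (p.nearestLaw r₀) :=
    integrable_toReal_of_lintegral_ne_top hJm.aemeasurable
      (((lintegral_mono hJ1).trans_lt (by simp)).ne)
  have hci := hJi.congr hcov
  have hpdf : Measurable fun r ↦ ENNReal.ofReal (p.pdf r₀ r) := NetParams.measurable_pdf.ennreal_ofReal
  have hind : ∀ r ∈ Ioi (0 : ℝ), (ENNReal.ofReal (p.pdf r₀ r)).toReal •
      (p.range r₀ s i).indicator (p.cov r₀ s i) r
      = (p.range r₀ s i).indicator (fun r ↦ p.cov r₀ s i r * p.pdf r₀ r) r := fun r hr ↦ by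
    rw [ENNReal.toReal_ofReal (NetParams.pdf_nonneg hr0 hr0Rc hRc hlam hr)]
    by_cases hri : r ∈ p.range r₀ s i
    · rw [indicator_of_mem hri, indicator_of_mem hri, smul_eq_mul, mul_comm]
    · rw [indicator_of_notMem hri, indicator_of_notMem hri, smul_zero]
  have hsub : p.range r₀ s i ⊆ Ioi 0 := NetParams.range_subset hH hdelta0 i
  have hms : MeasurableSet (p.range r₀ s i) := NetParams.measurableSet_range i
  have hinter : (volume.restrict (Ioi (0 : ℝ))).restrict (p.range r₀ s i)
      = volume.restrict (p.range r₀ s i) := by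
    rw [Measure.restrict_restrict hms, inter_eq_left.2 hsub]
  constructor
  · rw [NetParams.nearestLaw, integrable_withDensity_iff_integrable_smul' hpdf
      (ae_of_all _ fun _ ↦ ENNReal.ofReal_lt_top)] at hci
    have h1 := (integrable_congr ((ae_restrict_iff' measurableSet_Ioi).2 (ae_of_all _ hind))).1 hci
    rw [integrable_indicator_iff hms, IntegrableOn, hinter] at h1
    exact h1
  · have h1 : ∫ r, (J r).toReal ∂p.nearestLaw r₀ = p.Pc r₀ s i := by
      rw [integral_congr_ae hcov, NetParams.nearestLaw,
        integral_withDensity_eq_integral_toReal_smul hpdf (ae_of_all _ fun _ ↦ ENNReal.ofReal_lt_top),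
        setIntegral_congr_fun measurableSet_Ioi hind, integral_indicator hms, hinter, NetParams.Pc]
    rw [measureReal_def, measure_congr
      (h.inter_coveredIn_ae_eq hH hα hdelta0 hdelta1 heps hr0 hr0Rc s i),
      h.measure_inter_preimage hRc hr0 hr0Rc hlam hα hmL s hT, ENNReal.toReal_mul, ← measureReal_def,
      h.prob_S, ← h1, integral_toReal hJm.aemeasurable
        (ae_of_all _ fun r ↦ (hJ1 r).trans_lt ENNReal.one_lt_top)]

end Network

theorem theorem1 {Ω : Type*} [MeasurableSpace Ω] (μ : Measure Ω) [IsProbabilityMeasure μ]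
    (p : NetParams) (r₀ : ℝ)
    (hlam : 0 < p.lam) (hRc : 0 < p.Rc) (hH : 0 < p.H)
    (halphaL : 0 < p.alphaL) (halphaN : 2 < p.alphaN) (hmL : 1 ≤ p.mL) (hC : 0 < p.C)
    (hdelta0 : 0 ≤ p.delta) (hdelta1 : p.delta ≤ 1) (heps : 0 < p.eps)
    (hr0 : 0 ≤ r₀) (hr0Rc : r₀ ≤ p.Rc)
    (Φ : Ω → Set (EuclideanSpace ℝ (Fin 2))) (y : ℕ → Ω → EuclideanSpace ℝ (Fin 2))
    (g : ℕ → Ω → ℝ) (g0 : LinkState → Ω → ℝ) (S : Ω → LinkState)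
    (hnet : IsNetwork μ p r₀ Φ y g g0 S) :
    -- the integrals below exist
    (∀ (s : LinkState) (i : Region),
      IntegrableOn (fun r ↦ p.cov r₀ s i r * p.pdf r₀ r) (p.range r₀ s i)) ∧
    -- given the state of the air-to-ground link
    (∀ (s : LinkState) (i : Region),
      (μ[|S ⁻¹' {s}]).real (coveredIn p r₀ y g g0 S i) = p.Pc r₀ s i) ∧
    (∀ s : LinkState,
      (μ[|S ⁻¹' {s}]).real (covered p r₀ y g g0 S)
        = p.Pc r₀ s .bs + p.Pc r₀ s .coop + p.Pc r₀ s .uav) ∧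
    -- averaged over the state of the air-to-ground link
    (∀ i : Region, μ.real (coveredIn p r₀ y g g0 S i)
      = p.linkProb r₀ .los * p.Pc r₀ .los i + p.linkProb r₀ .nlos * p.Pc r₀ .nlos i) ∧
    μ.real (covered p r₀ y g g0 S)
      = μ.real (coveredIn p r₀ y g g0 S .bs) + μ.real (coveredIn p r₀ y g g0 S .coop)
        + μ.real (coveredIn p r₀ y g g0 S .uav) := by
  have main := hnet.integrableOn_and_measureReal_inter hlam hRc hH halphaN hmL hdelta0 hdelta1 heps
    hr0 hr0Rc
  have hnull := hnet.nullMeasurableSet_coveredIn hH halphaN hdelta0 hdelta1 heps hr0 hr0Rc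
  have hcond : ∀ (s : LinkState) (i : Region),
      (μ[|S ⁻¹' {s}]).real (coveredIn p r₀ y g g0 S i) = p.Pc r₀ s i := fun s i ↦ by
    rw [measureReal_def, cond_apply (hnet.measurable_S (measurableSet_singleton s)),
      ENNReal.toReal_mul, ENNReal.toReal_inv, ← measureReal_def, ← measureReal_def, (main s i).2,
      hnet.prob_S, inv_mul_cancel_left₀ (NetParams.linkProb_pos hC s).ne']
  refine ⟨fun s i ↦ (main s i).1, hcond, fun s ↦ ?_, fun i ↦ ?_, measureReal_covered hnull⟩
  -- Null-measurability passes to the conditional measure, which is absolutely continuous with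
  -- respect to μ.
  · rw [measureReal_covered fun i ↦ (hnull i).mono_ac (cond_absolutelyContinuous), hcond, hcond, hcond]
  · conv_lhs => rw [preimage_los_union_preimage_nlos S (coveredIn p r₀ y g g0 S i)]
    rw [measureReal_union₀ (hnet.nullMeasurableSet_inter_coveredIn hH halphaN hdelta0 hdelta1 heps
      hr0 hr0Rc .nlos i), (main .los i).2, (main .nlos i).2]
    refine Disjoint.aedisjoint (Set.disjoint_left.2 fun ω h1 h2 ↦ ?_)
    exact absurd (h1.1.symm.trans h2.1) (by simp)
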